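/- Let $W$ be a finite complex reflection group, i.e. a finite group with a faithful finite-dimensional complex representation $\mathfrak h$ such that $W$ is generated by elements whose fixed space in $\mathfrak h$ is a hyperplane. Let $\mathsf{Irr}\,W$ be the set of isomorphism classes of irreducible complex representations of $W$; for $\chi\in\mathsf{Irr}\,W$ let $L_\chi$ be a realization and $\chi^\vee$ the class of the dual. Let $A_W=\mathbb CW\ltimes\mathbb C[\mathfrak h^*]$, where $\mathbb C[\mathfrak h^*]=\mathrm{Sym}(\mathfrak h)$, graded by $\deg w=0$ for $w\in W$ and $\deg x=2$ for $x\in\mathfrak h$. For a graded vector space $V$ put $\mathsf{gdim}\,V=\sum_i t^{i/2}\dim V_i$. For graded modules $E,F$ let $\mathrm{hom}_{A_W}(E,F)_j$ and $\mathrm{ext}^i_{A_W}(E,F)_j$ denote homomorphisms and extensions of degree $j$, and put $$\langle E,F\rangle_{\mathsf{gEP}}=\sum_{i\ge0}(-1)^i\,\mathsf{gdim}\,\mathrm{ext}^i_{A_W}(E,F),\qquad [E:L_\chi]=\mathsf{gdim}\,\mathrm{hom}_W(L_\chi,E).$$ The graded dual $E^*$, with $(E^*)_{-d}=\mathrm{Hom}_{\mathbb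 C}(E_d,\mathbb C)$, is an $A_W$-module through the anti-involution of $A_W$ that is the identity on $\mathbb C[\mathfrak h^*]$ and $w\mapsto w^{-1}$ on $W$. Let $P_\chi=A_We_\chi$, where $e_\chi\in\mathbb CW$ is a minimal idempotent with $\mathbb CWe_\chi\cong L_\chi$. Let $J_W\subset\mathbb C[\mathfrak h^*]^W$ be the ideal of invariants vanishing at $0$, and let $C_{\mathsf{triv}}=P_{\mathsf{triv}}/\langle J_W\rangle P_{\mathsf{triv}}$ and $$\Omega_{\chi,\eta}=\mathsf{gdim}\,\mathrm{hom}_W(L_\chi\otimes L_{\eta^\vee},C_{\mathsf{triv}}).$$ Let $\mathcal P$ be a phyla of $W$, i.e. an ordered subdivision $\mathsf{Irr}\,W=\mathcal O_1\sqcup\cdots\sqcup\mathcal O_m$, and write $\chi\lesssim\eta$ (resp. $\chi\sim\eta$) if $\chi\in\mathcal O_i$, $\eta\in\mathcal O_j$ with $i\le j$ (resp. $i=j$). Let $\overline{\mathcal P}$ be the phyla with parts $\{\chi^\vee:\chi\in\mathcal O_i\}$. The $\mathcal P$-trace of $P_\chi$ is the quotient of $P_\chi$ by the sum of the images of all homogeneous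 homomorphisms $P_\eta\to P_\chi$ of positive degree with $\eta\lesssim\chi$. A Kostka system adapted to $\mathcal P$ is a collection $\{K^\pm_\chi\}_{\chi\in\mathsf{Irr}\,W}$ of graded $A_W$-modules such that $K^+_\chi$ is (isomorphic to) the $\mathcal P$-trace and $K^-_\chi$ the $\overline{\mathcal P}$-trace of $P_\chi$ for every $\chi$, and such that $\langle K^+_\chi,(K^-_\eta)^*\rangle_{\mathsf{gEP}}\ne0$ only if $\chi\sim\eta^\vee$. **Theorem.** Let $\{K^\pm_\chi\}_\chi$ be a Kostka system adapted to $\mathcal P$. Then the series $K^\pm_{\chi,\eta}=[K^\pm_\chi:L_\eta]$ lie in $\mathbb Q(\!(t)\!)$, and there is a matrix $\Lambda$ with entries in $\mathbb Q(\!(t)\!)$ such that $(K^+,K^-,\Lambda)$ is the unique solution over $\mathbb Q(\!(t)\!)$ of the Lusztig–Shoji matrix equation $${}^{\mathtt t}K^+\cdot\Lambda\cdot(K^-)^\sigma=\Omega$$ subject to: $K^+_{\chi,\chi}=1$ and $K^+_{\chi,\eta}=0$ if $\eta\lesssim\chi$, $\eta\neq\chi$; $K^-_{\chi,\chi}=1$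 and $K^-_{\chi,\eta}=0$ if $\eta^\vee\lesssim\chi^\vee$, $\eta^\vee\ne\chi^\vee$; $\Lambda_{\chi,\eta}\ne0$ only if $\chi\sim\eta$. Here $(K^\sigma)_{\chi,\eta}=K_{\chi^\vee,\eta^\vee}$. -/

import Mathlib

universe v u

noncomputable section

open CategoryTheory

namespace KostkaSystem

section GradedModules

variable {k : Type v} {A : Type u} [CommRing k] [Ring A] [Algebra k A]

/-- A family of subspaces is a direct sum decomposition as soon as it spans and there are
projections separating its members. -/
theorem isInternal_of_proj {M : Type u} [AddCommGroup M] [Module k M] (deg : ℤ → Submodule k M)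
    (p : ℤ → M →ₗ[k] M) (h1 : ∀ i, ∀ m ∈ deg i, p i m = m)
    (h2 : ∀ i j, i ≠ j → ∀ m ∈ deg j, p i m = 0) (h3 : ⨆ i, deg i = ⊤) :
    DirectSum.IsInternal deg := by
  rw [DirectSum.isInternal_submodule_iff_iSupIndep_and_iSup_eq_top]
  refine ⟨fun i => ?_, h3⟩
  rw [Submodule.disjoint_def]
  intro x hx hx'
  have hle : (⨆ (j) (_ : j ≠ i), deg j) ≤ LinearMap.ker (p i) :=
    iSup₂_le fun j hj m hm => h2 i j hj.symm m hm
  rw [← h1 i x hx]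
  exact hle hx'

/-- A `ℤ`-graded (left) module over the `k`-algebra `A` with homogeneous parts `𝒜 i`. -/
structure GrMod (𝒜 : ℤ → Submodule k A) where
  /-- the underlying module -/
  carrier : Type u
  [addCommGroup : AddCommGroup carrier]
  [module : Module A carrier]
  [moduleBase : Module k carrier]
  [isScalarTower : IsScalarTower k A carrier]
  /-- the homogeneous parts -/
  deg : ℤ → Submodule k carrier
  isInternal : DirectSum.IsInternal deg
  smul_mem : ∀ {i j : ℤ} {a : A} {m : carrier}, a ∈ 𝒜 i → m ∈ deg j → a • m ∈ deg (i + j)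

namespace GrMod

variable {𝒜 : ℤ → Submodule k A}

instance : CoeSort (GrMod 𝒜) (Type u) := ⟨GrMod.carrier⟩

attribute [instance] addCommGroup module moduleBase isScalarTower

theorem bijective (M : GrMod 𝒜) : Function.Bijective (DirectSum.coeLinearMap M.deg) :=
  M.isInternal

/-- The projection to the homogeneous part of degree `i`. -/
def proj (M : GrMod 𝒜) (i : ℤ) : M →ₗ[k] M :=
  (M.deg i).subtype ∘ₗ DirectSum.component k ℤ (fun j => M.deg j) i ∘ₗ
    (LinearEquiv.ofBijective (DirectSum.coeLinearMap M.deg) M.bijective).symm.toLinearMap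

theorem proj_mem (M : GrMod 𝒜) (i : ℤ) (m : M) : M.proj i m ∈ M.deg i :=
  Subtype.coe_prop _

theorem symm_of_mem (M : GrMod 𝒜) {i : ℤ} {m : M} (hm : m ∈ M.deg i) :
    (LinearEquiv.ofBijective (DirectSum.coeLinearMap M.deg) M.bijective).symm m =
      DirectSum.lof k ℤ (fun j => M.deg j) i ⟨m, hm⟩ := by
  rw [LinearEquiv.symm_apply_eq]
  simp

theorem proj_same (M : GrMod 𝒜) {i : ℤ} {m : M} (hm : m ∈ M.deg i) : M.proj i m = m := by
  simp only [proj, LinearMap.comp_apply, LinearEquiv.coe_coe, M.symm_of_mem hm]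
  simp [DirectSum.component.lof_self]

theorem proj_ne (M : GrMod 𝒜) {i j : ℤ} (hij : i ≠ j) {m : M} (hm : m ∈ M.deg j) :
    M.proj i m = 0 := by
  simp only [proj, LinearMap.comp_apply, LinearEquiv.coe_coe, M.symm_of_mem hm]
  rw [DirectSum.component.of, dif_neg hij.symm]
  simp

theorem iSup_deg (M : GrMod 𝒜) : ⨆ i, M.deg i = ⊤ :=
  M.isInternal.submodule_iSup_eq_top

@[elab_as_elim]
theorem induction (M : GrMod 𝒜) {motive : M → Prop} (hom : ∀ i, ∀ m ∈ M.deg i, motive m)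
    (add : ∀ m n, motive m → motive n → motive (m + n)) (m : M) : motive m := by
  have hm : m ∈ ⨆ i, M.deg i := M.iSup_deg ▸ Submodule.mem_top
  exact Submodule.iSup_induction (motive := motive) M.deg hm hom
    (hom 0 0 (Submodule.zero_mem _)) add

theorem sum_proj (M : GrMod 𝒜) (m : M) :
    ∃ s : Finset ℤ, ∑ i ∈ s, M.proj i m = m := by
  classical
  let e := LinearEquiv.ofBijective (DirectSum.coeLinearMap M.deg) M.bijective
  have h : DirectSum.coeLinearMap M.deg (e.symm m) = m := e.apply_symm_apply m
  rw [DirectSum.coeLinearMap_eq_dfinsuppSum] at h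
  exact ⟨_, h⟩

/-! ### Morphisms -/

/-- The `A`-linear maps of degree `0`. -/
def homSub (M N : GrMod 𝒜) : Submodule k (M →ₗ[A] N) where
  carrier := {f | ∀ i, ∀ m ∈ M.deg i, f m ∈ N.deg i}
  add_mem' hf hg _ _ hm := Submodule.add_mem _ (hf _ _ hm) (hg _ _ hm)
  zero_mem' _ _ _ := Submodule.zero_mem _
  smul_mem' c _ hf _ _ hm := Submodule.smul_mem _ c (hf _ _ hm)

instance category : Category (GrMod 𝒜) where
  Hom M N := homSub M N
  id M := ⟨LinearMap.id, fun _ _ hm => hm⟩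
  comp f g := ⟨g.1 ∘ₗ f.1, fun i m hm => g.2 i _ (f.2 i m hm)⟩

/-- The linear map underlying a morphism. -/
def lin {M N : GrMod 𝒜} (f : M ⟶ N) : M →ₗ[A] N := Subtype.val f

theorem lin_mem {M N : GrMod 𝒜} (f : M ⟶ N) {i : ℤ} {m : M} (hm : m ∈ M.deg i) :
    lin f m ∈ N.deg i := Subtype.property f i m hm

/-- A morphism from a linear map of degree `0`. -/
def mkHom {M N : GrMod 𝒜} (f : M →ₗ[A] N) (hf : ∀ i, ∀ m ∈ M.deg i, f m ∈ N.deg i) : M ⟶ N :=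
  ⟨f, hf⟩

@[simp] theorem lin_mkHom {M N : GrMod 𝒜} (f : M →ₗ[A] N) (hf) :
    lin (mkHom f hf : M ⟶ N) = f := rfl

@[simp] theorem lin_id (M : GrMod 𝒜) : lin (𝟙 M) = LinearMap.id := rfl

@[simp] theorem lin_comp {M N L : GrMod 𝒜} (f : M ⟶ N) (g : N ⟶ L) :
    lin (f ≫ g) = lin g ∘ₗ lin f := rfl

@[ext] theorem hom_ext {M N : GrMod 𝒜} {f g : M ⟶ N} (h : ∀ m, lin f m = lin g m) : f = g :=
  Subtype.ext (LinearMap.ext h)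

instance (M N : GrMod 𝒜) : AddCommGroup (M ⟶ N) := inferInstanceAs (AddCommGroup (homSub M N))

instance (M N : GrMod 𝒜) : Module k (M ⟶ N) := inferInstanceAs (Module k (homSub M N))

@[simp] theorem lin_zero (M N : GrMod 𝒜) : lin (0 : M ⟶ N) = 0 := rfl

@[simp] theorem lin_add {M N : GrMod 𝒜} (f g : M ⟶ N) : lin (f + g) = lin f + lin g := rfl

@[simp] theorem lin_smul {M N : GrMod 𝒜} (c : k) (f : M ⟶ N) : lin (c • f) = c • lin f := rfl

instance preadditive : Preadditive (GrMod 𝒜) where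
  add_comp _ _ _ f f' g := by ext m; simp
  comp_add _ _ _ f g g' := by ext m; simp

instance linear : Linear k (GrMod 𝒜) where
  smul_comp _ _ _ r f g := by
    ext m
    simp only [lin_comp, lin_smul, LinearMap.comp_apply, LinearMap.smul_apply]
    rw [← algebraMap_smul A r (lin f m), map_smul, algebraMap_smul]
  comp_smul _ _ _ f r g := by ext m; simp

theorem lin_proj {M N : GrMod 𝒜} (f : M ⟶ N) (i : ℤ) (m : M) :
    lin f (M.proj i m) = N.proj i (lin f m) := by
  induction m using M.induction with
  | hom j m hm =>
    by_cases hij : i = j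
    · subst hij; rw [M.proj_same hm, N.proj_same (lin_mem f hm)]
    · rw [M.proj_ne hij hm, N.proj_ne hij (lin_mem f hm), map_zero]
  | add m n hm hn => simp only [map_add, hm, hn]

/-! ### Homogeneous submodules and quotients -/

/-- A submodule is homogeneous if it contains the homogeneous components of its elements. -/
def IsHomogeneous (M : GrMod 𝒜) (N : Submodule A M) : Prop :=
  ∀ n ∈ N, ∀ i, M.proj i n ∈ N

theorem IsHomogeneous.iSup {M : GrMod 𝒜} {ι : Sort*} {N : ι → Submodule A M}
    (hN : ∀ j, M.IsHomogeneous (N j)) : M.IsHomogeneous (⨆ j, N j) := by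
  intro n hn i
  induction hn using Submodule.iSup_induction' with
  | mem j x hx => exact Submodule.mem_iSup_of_mem j (hN j x hx i)
  | zero => rw [map_zero]; exact Submodule.zero_mem _
  | add x y _ _ hx hy => rw [map_add]; exact Submodule.add_mem _ hx hy

theorem isHomogeneous_range {M N : GrMod 𝒜} (f : M ⟶ N) :
    N.IsHomogeneous (LinearMap.range (lin f)) := by
  rintro _ ⟨m, rfl⟩ i
  exact ⟨M.proj i m, lin_proj f i m⟩

theorem isHomogeneous_ker {M N : GrMod 𝒜} (f : M ⟶ N) :
    M.IsHomogeneous (LinearMap.ker (lin f)) := by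
  intro m hm i
  rw [LinearMap.mem_ker] at hm ⊢
  rw [lin_proj, hm, map_zero]

/-- A homogeneous submodule, as a graded module. -/
def sub (M : GrMod 𝒜) (N : Submodule A M) (hN : M.IsHomogeneous N) : GrMod 𝒜 where
  carrier := N
  deg i := (M.deg i).comap (N.subtype.restrictScalars k)
  isInternal := by
    refine isInternal_of_proj _
      (fun i => (M.proj i).restrict (p := N.restrictScalars k) (q := N.restrictScalars k)
        fun n hn => hN n hn i) ?_ ?_ ?_
    · intro i m hm; exact Subtype.ext (M.proj_same hm)
    · intro i j hij m hm; exact Subtype.ext (M.proj_ne hij hm)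
    · rw [eq_top_iff]
      rintro ⟨n, hn⟩ -
      obtain ⟨s, hs⟩ := M.sum_proj n
      have h : (⟨n, hn⟩ : N) = ∑ i ∈ s, ⟨M.proj i n, hN n hn i⟩ := by
        apply Subtype.ext
        simp [hs]
      rw [h]
      exact Submodule.sum_mem _ fun i _ => Submodule.mem_iSup_of_mem i (M.proj_mem i n)
  smul_mem ha hm := M.smul_mem ha hm

/-- The quotient by a homogeneous submodule, as a graded module. -/
def quot (M : GrMod 𝒜) (N : Submodule A M) (hN : M.IsHomogeneous N) : GrMod 𝒜 where
  carrier := M ⧸ N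
  deg i := (M.deg i).map (N.mkQ.restrictScalars k)
  isInternal := by
    refine isInternal_of_proj _
      (fun i => (Submodule.mapQ (N.restrictScalars k) (N.restrictScalars k) (M.proj i)
        fun n hn => hN n hn i)) ?_ ?_ ?_
    · rintro i _ ⟨m, hm, rfl⟩
      change N.mkQ (M.proj i m) = N.mkQ m
      rw [M.proj_same hm]
    · rintro i j hij _ ⟨m, hm, rfl⟩
      change N.mkQ (M.proj i m) = 0
      rw [M.proj_ne hij hm, map_zero]
    · rw [← Submodule.map_iSup, M.iSup_deg, Submodule.map_top, LinearMap.range_eq_top]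
      exact N.mkQ_surjective
  smul_mem := by
    rintro i j a _ ha ⟨m, hm, rfl⟩
    exact ⟨a • m, M.smul_mem ha hm, map_smul N.mkQ a m⟩

/-- The grading shift `M⟨d⟩`, with `M⟨d⟩ᵢ = Mᵢ₋d`. -/
def shift (M : GrMod 𝒜) (d : ℤ) : GrMod 𝒜 where
  carrier := M
  deg i := M.deg (i - d)
  isInternal := by
    refine isInternal_of_proj _ (fun i => M.proj (i - d)) ?_ ?_ ?_
    · intro i m hm; exact M.proj_same hm
    · intro i j hij m hm; exact M.proj_ne (by omega) hm
    · rw [← M.iSup_deg]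
      exact (Equiv.subRight d).iSup_comp (g := M.deg)
  smul_mem {i j a m} ha hm := by
    rw [show i + j - d = i + (j - d) by ring]
    exact M.smul_mem ha hm

/-! ### The category of graded modules is abelian -/

/-- The zero module. -/
def zeroObj : GrMod 𝒜 where
  carrier := PUnit
  deg _ := ⊤
  isInternal := by
    refine isInternal_of_proj _ (fun _ => 0) ?_ ?_ ?_
    · intros; rfl
    · intros; rfl
    · simp
  smul_mem _ _ := Submodule.mem_top

/-- The direct sum of two graded modules. -/
def prodObj (M N : GrMod 𝒜) : GrMod 𝒜 where
  carrier := M × N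
  deg i := (M.deg i).prod (N.deg i)
  isInternal := by
    refine isInternal_of_proj _ (fun i => (M.proj i).prodMap (N.proj i)) ?_ ?_ ?_
    · rintro i ⟨m, n⟩ ⟨hm, hn⟩; exact Prod.ext (M.proj_same hm) (N.proj_same hn)
    · rintro i j hij ⟨m, n⟩ ⟨hm, hn⟩; exact Prod.ext (M.proj_ne hij hm) (N.proj_ne hij hn)
    · rw [eq_top_iff]
      rintro ⟨m, n⟩ -
      have h : (m, n) = LinearMap.inl k M N m + LinearMap.inr k M N n := by simp
      rw [h]
      refine Submodule.add_mem _ ?_ ?_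
      · have : (⨆ i, M.deg i) ≤ (⨆ i, (M.deg i).prod (N.deg i)).comap (LinearMap.inl k M N) :=
          iSup_le fun i x hx => Submodule.mem_iSup_of_mem i ⟨hx, Submodule.zero_mem _⟩
        exact this (M.iSup_deg ▸ Submodule.mem_top)
      · have : (⨆ i, N.deg i) ≤ (⨆ i, (M.deg i).prod (N.deg i)).comap (LinearMap.inr k M N) :=
          iSup_le fun i x hx => Submodule.mem_iSup_of_mem i ⟨Submodule.zero_mem _, hx⟩
        exact this (N.iSup_deg ▸ Submodule.mem_top)
  smul_mem ha hm := ⟨M.smul_mem ha hm.1, N.smul_mem ha hm.2⟩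

open Limits

instance : HasZeroObject (GrMod 𝒜) :=
  ⟨zeroObj, (IsZero.iff_id_eq_zero _).2 (hom_ext fun _ => rfl)⟩

instance : HasBinaryBiproducts (GrMod 𝒜) where
  has_binary_biproduct M N := hasBinaryBiproduct_of_total
    { pt := prodObj M N
      fst := mkHom (LinearMap.fst A M N) fun _ _ h => h.1
      snd := mkHom (LinearMap.snd A M N) fun _ _ h => h.2
      inl := mkHom (LinearMap.inl A M N) fun _ _ h => ⟨h, Submodule.zero_mem _⟩
      inr := mkHom (LinearMap.inr A M N) fun _ _ h => ⟨Submodule.zero_mem _, h⟩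
      inl_fst := rfl
      inl_snd := rfl
      inr_fst := rfl
      inr_snd := rfl }
    (by
      ext m
      change (m.1, (0 : N)) + ((0 : M), m.2) = m
      exact Prod.ext (add_zero _) (zero_add _))

/-- The inclusion of a homogeneous submodule. -/
def subι (M : GrMod 𝒜) (N : Submodule A M) (hN : M.IsHomogeneous N) : M.sub N hN ⟶ M :=
  mkHom N.subtype fun _ _ h => h

/-- The projection onto the quotient by a homogeneous submodule. -/
def quotπ (M : GrMod 𝒜) (N : Submodule A M) (hN : M.IsHomogeneous N) : M ⟶ M.quot N hN :=
  mkHom N.mkQ fun _ m h => ⟨m, h, rfl⟩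

/-- A morphism into `N` with values in a homogeneous submodule factors through it. -/
def subLift {M L : GrMod 𝒜} (N : Submodule A M) (hN : M.IsHomogeneous N) (g : L ⟶ M)
    (hg : ∀ x, lin g x ∈ N) : L ⟶ M.sub N hN :=
  mkHom ((lin g).codRestrict N hg) fun _ _ h => lin_mem g h

/-- A morphism vanishing on a homogeneous submodule factors through the quotient. -/
def quotDesc {M L : GrMod 𝒜} (N : Submodule A M) (hN : M.IsHomogeneous N) (g : M ⟶ L)
    (hg : N ≤ LinearMap.ker (lin g)) : M.quot N hN ⟶ L :=
  mkHom (N.liftQ (lin g) hg) fun _ _ h => by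
    obtain ⟨m, hm, rfl⟩ := h
    exact lin_mem g hm

theorem subLift_subι {M L : GrMod 𝒜} (N : Submodule A M) (hN : M.IsHomogeneous N) (g : L ⟶ M)
    (hg : ∀ x, lin g x ∈ N) : subLift N hN g hg ≫ subι M N hN = g := rfl

theorem quotπ_desc {M L : GrMod 𝒜} (N : Submodule A M) (hN : M.IsHomogeneous N) (g : M ⟶ L)
    (hg : N ≤ LinearMap.ker (lin g)) : quotπ M N hN ≫ quotDesc N hN g hg = g := rfl

theorem lin_eq_zero {M N L : GrMod 𝒜} {f : M ⟶ N} {g : N ⟶ L} (h : f ≫ g = 0) (x : M) :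
    lin g (lin f x) = 0 :=
  LinearMap.congr_fun (congrArg lin h) x

instance : HasKernels (GrMod 𝒜) where
  has_limit {M _} f := HasLimit.mk
    { cone := KernelFork.ofι (subι M _ (isHomogeneous_ker f)) (hom_ext fun x => x.2)
      isLimit := KernelFork.IsLimit.ofι _ _
        (fun g hg => subLift _ (isHomogeneous_ker f) g fun x => lin_eq_zero hg x)
        (fun _ _ => rfl)
        (fun _ _ _ hm => hom_ext fun x =>
          Subtype.ext (LinearMap.congr_fun (congrArg lin hm) x)) }

instance : HasCokernels (GrMod 𝒜) where
  has_colimit {_ N} f := HasColimit.mk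
    { cocone := CokernelCofork.ofπ (quotπ N _ (isHomogeneous_range f))
        (hom_ext fun x => (Submodule.Quotient.mk_eq_zero _).2 ⟨x, rfl⟩)
      isColimit := CokernelCofork.IsColimit.ofπ _ _
        (fun g hg => quotDesc _ (isHomogeneous_range f) g
          (by rintro _ ⟨x, rfl⟩; exact lin_eq_zero hg x))
        (fun _ _ => rfl)
        (fun _ _ _ hm => hom_ext fun x => by
          obtain ⟨y, rfl⟩ := Submodule.mkQ_surjective _ x
          exact LinearMap.congr_fun (congrArg lin hm) y) }

theorem injective_of_mono {M N : GrMod 𝒜} (f : M ⟶ N) [Mono f] :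
    Function.Injective (lin f) := by
  have h : subι M _ (isHomogeneous_ker f) = 0 := by
    rw [← cancel_mono f, zero_comp]
    exact hom_ext fun x => x.2
  rw [← LinearMap.ker_eq_bot, eq_bot_iff]
  intro x hx
  exact LinearMap.congr_fun (congrArg lin h) ⟨x, hx⟩

theorem surjective_of_epi {M N : GrMod 𝒜} (f : M ⟶ N) [Epi f] :
    Function.Surjective (lin f) := by
  have h : quotπ N _ (isHomogeneous_range f) = 0 := by
    rw [← cancel_epi f, comp_zero]
    exact hom_ext fun x => (Submodule.Quotient.mk_eq_zero _).2 ⟨x, rfl⟩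
  intro y
  exact (Submodule.Quotient.mk_eq_zero _).1 (LinearMap.congr_fun (congrArg lin h) y)

instance : IsNormalMonoCategory (GrMod 𝒜) where
  normalMonoOfMono {M N} f _ := by
    have hinj := injective_of_mono f
    refine ⟨{ Z := _, g := quotπ N _ (isHomogeneous_range f), w := ?_, isLimit := ?_ }⟩
    · exact hom_ext fun x => (Submodule.Quotient.mk_eq_zero _).2 ⟨x, rfl⟩
    · refine KernelFork.IsLimit.ofι' _ _ fun {L} g hg => ?_
      have hg' : ∀ x, lin g x ∈ LinearMap.range (lin f) := fun x =>
        (Submodule.Quotient.mk_eq_zero _).1 (lin_eq_zero hg x)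
      let e := LinearEquiv.ofInjective (lin f) hinj
      have he : ∀ x, lin f (e.symm x) = x := fun x =>
        congrArg Subtype.val (e.apply_symm_apply x)
      refine ⟨mkHom (e.symm.toLinearMap ∘ₗ (lin g).codRestrict _ hg') fun i x hx => ?_, ?_⟩
      · set y := (e.symm.toLinearMap ∘ₗ (lin g).codRestrict _ hg') x with hy
        have hfy : lin f y = lin g x := he _
        have : M.proj i y = y := hinj (by
          rw [lin_proj, hfy, N.proj_same (lin_mem g hx)])
        rw [← this]
        exact M.proj_mem i y
      · exact hom_ext fun x => he _

instance : IsNormalEpiCategory (GrMod 𝒜) where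
  normalEpiOfEpi {M N} f _ := by
    have hsurj := surjective_of_epi f
    refine ⟨{ W := _, g := subι M _ (isHomogeneous_ker f), w := ?_, isColimit := ?_ }⟩
    · exact hom_ext fun x => x.2
    · refine CokernelCofork.IsColimit.ofπ' _ _ fun {L} g hg => ?_
      have hg' : LinearMap.ker (lin f) ≤ LinearMap.ker (lin g) := fun x hx =>
        lin_eq_zero hg ⟨x, hx⟩
      let e := (lin f).quotKerEquivOfSurjective hsurj
      have he : ∀ x, e.symm (lin f x) = (LinearMap.ker (lin f)).mkQ x := fun x => by
        rw [LinearEquiv.symm_apply_eq]; rfl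
      refine ⟨mkHom ((LinearMap.ker (lin f)).liftQ (lin g) hg' ∘ₗ e.symm.toLinearMap)
        fun i y hy => ?_, ?_⟩
      · obtain ⟨x, rfl⟩ := hsurj y
        rw [← N.proj_same hy, ← lin_proj, LinearMap.comp_apply, LinearEquiv.coe_coe, he]
        exact lin_mem g (M.proj_mem i x)
      · refine hom_ext fun x => ?_
        change (LinearMap.ker (lin f)).liftQ (lin g) hg' (e.symm (lin f x)) = lin g x
        rw [he]; rfl

instance abelian : Abelian (GrMod 𝒜) where
  has_finite_products := hasFiniteProducts_of_has_binary_and_terminal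

instance hasExt : HasExt.{max (u + 1) v} (GrMod 𝒜) := HasExt.standard _

/-- The graded extension space `ext^i(E, F)_j`, in the abelian category of graded modules. As a
morphism `E → F` of degree `j` is a morphism `E⟨j⟩ → F` of degree `0`, it is `Ext^i(E⟨j⟩, F)`. -/
abbrev ext (E F : GrMod 𝒜) (i : ℕ) (j : ℤ) : Type (max (u + 1) v) := Abelian.Ext (E.shift j) F i


end GrMod
end GradedModules

section ReflectionGroups

variable {W : Type u} [Group W] {h : Type u} [AddCommGroup h] [Module ℂ h]

/-- `W`, acting on `h` through `ρ`, is a complex reflection group: the action is faithful and `W` is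
generated by elements whose fixed space is a hyperplane. -/
structure IsComplexReflectionGroup (ρ : Representation ℂ W h) : Prop where
  faithful : Function.Injective ρ
  closure_reflections :
    Subgroup.closure {w : W | Module.finrank ℂ (LinearMap.range (ρ w - 1)) = 1} = ⊤

/-- The algebra `ℂ[h*]` of polynomial functions on `h*`, that is the symmetric algebra of `h`. -/
def Sym (_ρ : Representation ℂ W h) : Type u := SymmetricAlgebra ℂ h

variable (ρ : Representation ℂ W h)

namespace Sym

instance : CommRing (Sym ρ) := inferInstanceAs (CommRing (SymmetricAlgebra ℂ h))

instance : Algebra ℂ (Sym ρ) := inferInstanceAs (Algebra ℂ (SymmetricAlgebra ℂ h))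

/-- The inclusion of the linear part. -/
def ι : h →ₗ[ℂ] Sym ρ := SymmetricAlgebra.ι ℂ h

/-- The algebra map induced by a linear map. -/
def lift {B : Type*} [CommRing B] [Algebra ℂ B] (f : h →ₗ[ℂ] B) : Sym ρ →ₐ[ℂ] B :=
  SymmetricAlgebra.lift f

@[simp] theorem lift_ι {B : Type*} [CommRing B] [Algebra ℂ B] (f : h →ₗ[ℂ] B) (x : h) :
    lift ρ f (ι ρ x) = f x := SymmetricAlgebra.lift_ι_apply f x

variable {ρ} in
theorem algHom_ext {B : Type*} [CommRing B] [Algebra ℂ B] {F G : Sym ρ →ₐ[ℂ] B}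
    (hFG : ∀ x, F (ι ρ x) = G (ι ρ x)) : F = G :=
  SymmetricAlgebra.algHom_ext (LinearMap.ext hFG)

variable {ρ} in
theorem induction {motive : Sym ρ → Prop} (scalar : ∀ r : ℂ, motive (algebraMap ℂ (Sym ρ) r))
    (lin : ∀ x, motive (ι ρ x)) (mul : ∀ a b, motive a → motive b → motive (a * b))
    (add : ∀ a b, motive a → motive b → motive (a + b)) (p : Sym ρ) : motive p :=
  SymmetricAlgebra.induction (R := ℂ) (M := h) (motive := motive) scalar lin mul add p

/-- The action of `w` on `ℂ[h*]`. -/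
def act (w : W) : Sym ρ →ₐ[ℂ] Sym ρ := lift ρ (ι ρ ∘ₗ ρ w)

instance : MulSemiringAction W (Sym ρ) where
  smul w p := act ρ w p
  one_smul p := by
    have : act ρ (1 : W) = AlgHom.id ℂ _ := algHom_ext fun x => by simp [act]
    exact DFunLike.congr_fun this p
  mul_smul v w p := by
    have : act ρ (v * w) = (act ρ v).comp (act ρ w) := algHom_ext fun x => by simp [act]
    exact DFunLike.congr_fun this p
  smul_zero w := map_zero (act ρ w)
  smul_add w := map_add (act ρ w)
  smul_one w := map_one (act ρ w)
  smul_mul w := map_mul (act ρ w)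

theorem smul_eq (w : W) (p : Sym ρ) : w • p = act ρ w p := rfl

@[simp] theorem smul_ι (w : W) (x : h) : w • ι ρ x = ι ρ (ρ w x) := lift_ι _ _ _

instance : SMulCommClass W ℂ (Sym ρ) := ⟨fun w c p => map_smul (act ρ w) c p⟩

/-- The homogeneous polynomials of polynomial degree `n`. -/
def homog (n : ℕ) : Submodule ℂ (Sym ρ) := LinearMap.range (ι ρ) ^ n

/-- The part of degree `d` of `ℂ[h*]`, where elements of `h` have degree `2`. -/
def deg (d : ℤ) : Submodule ℂ (Sym ρ) := ⨆ (n : ℕ) (_ : d = 2 * n), homog ρ n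

/-- The algebra map `p ↦ ∑ pₙ Tⁿ` recording homogeneous components. -/
def expand : Sym ρ →ₐ[ℂ] Polynomial (Sym ρ) :=
  lift ρ ((LinearMap.mulLeft ℂ (Polynomial.X : Polynomial (Sym ρ))) ∘ₗ
    (Algebra.linearMap (Sym ρ) (Polynomial (Sym ρ))).restrictScalars ℂ ∘ₗ ι ρ)

theorem expand_of_mem {n : ℕ} {p : Sym ρ} (hp : p ∈ homog ρ n) :
    expand ρ p = Polynomial.monomial n p := by
  rw [homog] at hp
  induction hp using Submodule.pow_induction_on_left' with
  | algebraMap r => rw [AlgHom.commutes]; rfl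
  | add x y i hx hy ihx ihy => rw [map_add, ihx, ihy, map_add]
  | mem_mul m hm i x hx ih =>
    obtain ⟨y, rfl⟩ := hm
    rw [map_mul, ih, expand, lift_ι]
    simp [Polynomial.X_mul_C, ← Polynomial.C_mul_X_pow_eq_monomial]
    ring

/-- The component of degree `d`. -/
def proj (d : ℤ) : Sym ρ →ₗ[ℂ] Sym ρ :=
  if d % 2 = 0 ∧ 0 ≤ d then
    (Polynomial.lcoeff (Sym ρ) (d / 2).toNat).restrictScalars ℂ ∘ₗ (expand ρ).toLinearMap
  else 0

theorem deg_two_mul (n : ℕ) : deg ρ (2 * n) = homog ρ n := by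
  apply le_antisymm
  · refine iSup₂_le fun m hm => ?_
    obtain rfl : n = m := by omega
    exact le_rfl
  · exact le_iSup₂_of_le n rfl le_rfl

theorem deg_induction {d : ℤ} {p : Sym ρ} (hp : p ∈ deg ρ d) :
    p = 0 ∨ ∃ n : ℕ, d = 2 * n ∧ p ∈ homog ρ n := by
  by_cases hd : ∃ n : ℕ, d = 2 * n
  · obtain ⟨n, rfl⟩ := hd
    exact Or.inr ⟨n, rfl, deg_two_mul ρ n ▸ hp⟩
  · left
    have : deg ρ d ≤ ⊥ := iSup₂_le fun n hn => (hd ⟨n, hn⟩).elim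
    exact (Submodule.mem_bot ℂ).1 (this hp)

theorem proj_same {d : ℤ} {p : Sym ρ} (hp : p ∈ deg ρ d) : proj ρ d p = p := by
  obtain rfl | ⟨n, rfl, hp'⟩ := deg_induction ρ hp
  · exact map_zero _
  · rw [proj, if_pos (by omega)]
    simp [expand_of_mem ρ hp']

theorem proj_ne {d e : ℤ} (hde : d ≠ e) {p : Sym ρ} (hp : p ∈ deg ρ e) : proj ρ d p = 0 := by
  obtain rfl | ⟨n, rfl, hp'⟩ := deg_induction ρ hp
  · exact map_zero _
  · rw [proj]
    split_ifs with h
    · simp only [LinearMap.comp_apply, AlgHom.toLinearMap_apply, expand_of_mem ρ hp']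
      simp only [LinearMap.restrictScalars_apply, Polynomial.lcoeff_apply]
      rw [Polynomial.coeff_monomial, if_neg (by omega)]
    · rfl

theorem iSup_deg : ⨆ d, deg ρ d = ⊤ := by
  have hle : ∀ n, homog ρ n ≤ ⨆ d, deg ρ d := fun n =>
    (deg_two_mul ρ n).ge.trans (le_iSup (deg ρ) _)
  have key : ∀ p : Sym ρ, p ∈ ⨆ n, homog ρ n := by
    intro p
    refine induction (motive := fun p => p ∈ ⨆ n, homog ρ n) ?_ ?_ ?_ ?_ p
    · intro r
      refine Submodule.mem_iSup_of_mem 0 ?_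
      rw [homog, pow_zero]
      exact Submodule.algebraMap_mem r
    · intro x
      refine Submodule.mem_iSup_of_mem 1 ?_
      rw [homog, pow_one]
      exact ⟨x, rfl⟩
    · intro a b ha hb
      have := Submodule.mul_mem_mul ha hb
      rw [Submodule.iSup_mul] at this
      refine (iSup_le fun i => ?_ : _ ≤ ⨆ n, homog ρ n) this
      rw [Submodule.mul_iSup]
      refine iSup_le fun j => ?_
      rw [homog, homog, ← pow_add]
      exact le_iSup (homog ρ) (i + j)
    · intro a b ha hb; exact Submodule.add_mem _ ha hb
  rw [eq_top_iff]
  intro p _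
  exact (iSup_le hle : _ ≤ _) (key p)

theorem smul_mem_homog (w : W) {n : ℕ} {p : Sym ρ} (hp : p ∈ homog ρ n) : w • p ∈ homog ρ n := by
  have : (homog ρ n).map (act ρ w).toLinearMap ≤ homog ρ n := by
    rw [homog, Submodule.map_pow]
    refine pow_le_pow_left' ?_ n
    rintro _ ⟨_, ⟨x, rfl⟩, rfl⟩
    exact ⟨ρ w x, (smul_ι ρ w x).symm⟩
  exact this ⟨p, hp, rfl⟩

theorem smul_mem_deg (w : W) {d : ℤ} {p : Sym ρ} (hp : p ∈ deg ρ d) : w • p ∈ deg ρ d := by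
  obtain rfl | ⟨n, rfl, hp'⟩ := deg_induction ρ hp
  · rw [smul_zero]; exact Submodule.zero_mem _
  · rw [deg_two_mul]; exact smul_mem_homog ρ w hp'

theorem mul_mem_deg {d e : ℤ} {p q : Sym ρ} (hp : p ∈ deg ρ d) (hq : q ∈ deg ρ e) :
    p * q ∈ deg ρ (d + e) := by
  obtain rfl | ⟨m, rfl, hp'⟩ := deg_induction ρ hp
  · rw [zero_mul]; exact Submodule.zero_mem _
  obtain rfl | ⟨n, rfl, hq'⟩ := deg_induction ρ hq
  · rw [mul_zero]; exact Submodule.zero_mem _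
  rw [show (2 * m + 2 * n : ℤ) = 2 * ((m + n : ℕ) : ℤ) by push_cast; ring, deg_two_mul, homog, pow_add]
  exact Submodule.mul_mem_mul hp' hq'

end Sym

/-- The graded algebra `A_W = ℂW ⋉ ℂ[h*]`: its elements are the sums of products `p w`, with `p` in
`ℂ[h*]` and `w` in `W`, and `w p = (w • p) w`. -/
abbrev AW : Type u := SkewMonoidAlgebra (Sym ρ) W

namespace AW

variable {ρ} in
/-- The element `p w`. -/
abbrev mk (p : Sym ρ) (w : W) : AW ρ := SkewMonoidAlgebra.single w p

/-- The part of degree `d`, where `W` has degree `0` and `h` has degree `2`. -/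
def deg (d : ℤ) : Submodule ℂ (AW ρ) where
  carrier := {a | ∀ w, a.coeff w ∈ Sym.deg ρ d}
  add_mem' ha hb w := by
    rw [SkewMonoidAlgebra.coeff_add]; exact Submodule.add_mem _ (ha w) (hb w)
  zero_mem' w := by rw [SkewMonoidAlgebra.coeff_zero]; exact Submodule.zero_mem _
  smul_mem' c a ha w := by
    rw [SkewMonoidAlgebra.coeff_smul]; exact Submodule.smul_mem _ c (ha w)

theorem mk_mem {d : ℤ} {p : Sym ρ} (hp : p ∈ Sym.deg ρ d) (w : W) : mk p w ∈ deg ρ d := by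
  classical
  intro v
  rw [SkewMonoidAlgebra.coeff_single_apply]
  split_ifs
  · exact hp
  · exact Submodule.zero_mem _

theorem iSup_deg : ⨆ d, deg ρ d = ⊤ := by
  rw [eq_top_iff]
  intro a _
  induction a using SkewMonoidAlgebra.induction_on with
  | zero => exact Submodule.zero_mem _
  | single w p =>
    have hp : p ∈ ⨆ d, Sym.deg ρ d := Sym.iSup_deg ρ ▸ Submodule.mem_top
    refine Submodule.iSup_induction (motive := fun p => mk p w ∈ ⨆ d, deg ρ d) _ hp ?_ ?_ ?_
    · intro d p hp; exact Submodule.mem_iSup_of_mem d (mk_mem ρ hp w)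
    · simp
    · intro p q hp hq
      rw [mk, SkewMonoidAlgebra.single_add]; exact Submodule.add_mem _ hp hq
  | add a b ha hb => exact Submodule.add_mem _ (ha trivial) (hb trivial)

/-- The component of degree `d`. -/
def proj (d : ℤ) : AW ρ →ₗ[ℂ] AW ρ :=
  (SkewMonoidAlgebra.coeffLinearEquiv (S := ℂ)).symm.toLinearMap ∘ₗ
    Finsupp.mapRange.linearMap (Sym.proj ρ d) ∘ₗ
      (SkewMonoidAlgebra.coeffLinearEquiv (S := ℂ)).toLinearMap

theorem coeff_proj (d : ℤ) (a : AW ρ) (w : W) : (proj ρ d a).coeff w = Sym.proj ρ d (a.coeff w) :=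
  rfl

theorem isInternal : DirectSum.IsInternal (deg ρ) := by
  refine isInternal_of_proj _ (proj ρ) ?_ ?_ (iSup_deg ρ)
  · intro d a ha; ext w; rw [coeff_proj, Sym.proj_same ρ (ha w)]
  · intro d e hde a ha; ext w; rw [coeff_proj, Sym.proj_ne ρ hde (ha w)]; rfl

theorem mul_mem {d e : ℤ} {a b : AW ρ} (ha : a ∈ deg ρ d) (hb : b ∈ deg ρ e) :
    a * b ∈ deg ρ (d + e) := by
  rw [SkewMonoidAlgebra.mul_def, SkewMonoidAlgebra.sum_def]
  refine Submodule.sum_mem _ fun v _ => ?_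
  dsimp only
  rw [SkewMonoidAlgebra.sum_def]
  exact Submodule.sum_mem _ fun w _ =>
    mk_mem ρ (Sym.mul_mem_deg ρ (ha v) (Sym.smul_mem_deg ρ v (hb w))) _

end AW

end ReflectionGroups

section Irreducibles

variable (W : Type u) [Group W]

/-- An irreducible finite-dimensional complex representation of `W`. -/
structure IrrRep where
  /-- the representation space -/
  V : Type
  [addCommGroup : AddCommGroup V]
  [module : Module ℂ V]
  [finite : FiniteDimensional ℂ V]
  /-- the action -/
  rep : Representation ℂ W V
  irreducible : rep.IsIrreducible

attribute [instance] IrrRep.addCommGroup IrrRep.module IrrRep.finite IrrRep.irreducible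

/-- Isomorphism of representations. -/
instance IrrRep.setoid : Setoid (IrrRep W) where
  r X Y := Nonempty (X.rep.Equiv Y.rep)
  iseqv := ⟨fun X => ⟨.refl X.rep⟩, fun ⟨e⟩ => ⟨e.symm⟩, fun ⟨e⟩ ⟨f⟩ => ⟨e.trans f⟩⟩

/-- The set of isomorphism classes of irreducible representations of `W`. -/
def Irr : Type (max 1 u) := Quotient (IrrRep.setoid W)

variable {W}

namespace Irr

/-- A realization `L_χ` of `χ`. -/
def L (χ : Irr W) : IrrRep W := Quotient.out χ

theorem eq_of_equiv {χ η : Irr W} (h : Nonempty (χ.L.rep.Equiv η.L.rep)) : χ = η :=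
  Quotient.out_equiv_out.1 h

theorem dual_isIrreducible (X : IrrRep W) : X.rep.dual.IsIrreducible := by
  have hX : IsSimpleOrder (Subrepresentation X.rep) := X.irreducible
  have hne : Nontrivial X.V := by
    by_contra hn
    rw [not_nontrivial_iff_subsingleton] at hn
    obtain ⟨x, y, hxy⟩ := hX.exists_pair_ne
    refine hxy (Subrepresentation.toSubmodule_injective ?_)
    exact Subsingleton.elim _ _
  refine { exists_pair_ne := ⟨⊥, ⊤, fun h => ?_⟩, eq_bot_or_eq_top := fun N => ?_ }
  · have h' : (⊥ : Submodule ℂ (Module.Dual ℂ X.V)) = ⊤ :=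
      congrArg Subrepresentation.toSubmodule h
    exact bot_ne_top h'
  · let M : Subrepresentation X.rep :=
      ⟨N.toSubmodule.dualCoannihilator, fun g v hv => by
        rw [Submodule.mem_dualCoannihilator] at hv ⊢
        intro φ hφ
        have := hv _ (N.apply_mem_toSubmodule g⁻¹ hφ)
        simpa [Representation.dual_apply, Module.Dual.transpose_apply] using this⟩
    have key : M.toSubmodule.dualAnnihilator = N.toSubmodule :=
      Subspace.dualCoannihilator_dualAnnihilator_eq
    rcases hX.eq_bot_or_eq_top M with h | h
    · right
      apply Subrepresentation.toSubmodule_injective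
      rw [← key, h]
      exact Submodule.dualAnnihilator_bot
    · left
      apply Subrepresentation.toSubmodule_injective
      rw [← key, h]
      exact Submodule.dualAnnihilator_top

/-- The class `χ^∨` of the dual representation. -/
def dual (χ : Irr W) : Irr W :=
  Quotient.mk (IrrRep.setoid W) ⟨Module.Dual ℂ χ.L.V, χ.L.rep.dual, dual_isIrreducible χ.L⟩

theorem trivial_isIrreducible : (Representation.trivial ℂ W ℂ).IsIrreducible := by
  refine { exists_pair_ne := ⟨⊥, ⊤, fun h => ?_⟩, eq_bot_or_eq_top := fun N => ?_ }
  · have h' : (⊥ : Submodule ℂ ℂ) = ⊤ := congrArg Subrepresentation.toSubmodule h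
    exact bot_ne_top h'
  · rcases eq_bot_or_eq_top N.toSubmodule with h | h
    · exact Or.inl (Subrepresentation.toSubmodule_injective h)
    · exact Or.inr (Subrepresentation.toSubmodule_injective h)

variable (W) in
/-- The class of the trivial representation. -/
def triv : Irr W :=
  Quotient.mk (IrrRep.setoid W) ⟨ℂ, Representation.trivial ℂ W ℂ, trivial_isIrreducible⟩

variable [Finite W]

instance : Finite (Irr W) := by
  classical
  have := Fintype.ofFinite W
  have hc : (Nat.card W : ℂ) ≠ 0 := Nat.cast_ne_zero.2 Nat.card_pos.ne'
  have := invertibleOfNonzero hc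
  have hli : LinearIndependent ℂ (fun χ : Irr W => χ.L.rep.character) := by
    rw [linearIndependent_iff']
    intro s c hs η hη
    have h : ∑ χ ∈ s, c χ * ((Nat.card W : ℂ)⁻¹ *
        ∑ g : W, χ.L.rep.character g * η.L.rep.character g⁻¹) = 0 := by
      have h0 : ∀ g, ∑ χ ∈ s, c χ * χ.L.rep.character g = 0 := fun g => by
        simpa using congrFun hs g
      calc _ = (Nat.card W : ℂ)⁻¹ * ∑ g : W,
            (∑ χ ∈ s, c χ * χ.L.rep.character g) * η.L.rep.character g⁻¹ := by
            simp only [Finset.mul_sum, Finset.sum_mul]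
            rw [Finset.sum_comm]
            refine Finset.sum_congr rfl fun _ _ => Finset.sum_congr rfl fun _ _ => by ring
        _ = 0 := by simp [h0]
    simp only [Representation.char_orthonormal] at h
    rw [Finset.sum_eq_single η] at h
    · simpa [Nonempty.intro (Representation.Equiv.refl (ρ := η.L.rep))] using h
    · intro χ _ hne
      rw [if_neg (fun h => hne (eq_of_equiv h).symm), mul_zero]
    · intro hn; exact (hn hη).elim
  exact hli.finite

instance : Fintype (Irr W) := Fintype.ofFinite _

theorem exists_idempotent (χ : Irr W) : ∃ e : MonoidAlgebra ℂ W, IsIdempotentElem e ∧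
    Nonempty (χ.L.rep.asModule ≃ₗ[MonoidAlgebra ℂ W] Ideal.span {e}) := by
  have : NeZero (Nat.card W : ℂ) := ⟨Nat.cast_ne_zero.2 Nat.card_pos.ne'⟩
  obtain ⟨I, hI⟩ := IsSemisimpleRing.exists_linearEquiv_ideal_of_isSimpleModule
    (MonoidAlgebra ℂ W) χ.L.rep.asModule
  obtain ⟨e, he, rfl⟩ := IsSemisimpleRing.ideal_eq_span_idempotent I
  exact ⟨e, he, hI⟩

/-- A minimal idempotent `e_χ` of the group algebra, with `ℂW e_χ ≅ L_χ`. -/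
def idem (χ : Irr W) : MonoidAlgebra ℂ W := χ.exists_idempotent.choose

end Irr

end Irreducibles

section GradedModules

variable {k : Type v} {A : Type u} [CommRing k] [Ring A] [Algebra k A] {𝒜 : ℤ → Submodule k A}

theorem GrMod.proj_smul (M : GrMod 𝒜) {j : ℤ} {a : A} (ha : a ∈ 𝒜 j) (i : ℤ) (m : M) :
    M.proj i (a • m) = a • M.proj (i - j) m := by
  induction m using M.induction with
  | hom l m hm =>
    by_cases hil : i = j + l
    · subst hil
      rw [M.proj_same (M.smul_mem ha hm), show j + l - j = l by ring, M.proj_same hm]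
    · rw [M.proj_ne hil (M.smul_mem ha hm), M.proj_ne (by omega) hm, smul_zero]
  | add m n hm hn => simp only [smul_add, map_add, hm, hn]

theorem GrMod.isHomogeneous_span (h𝒜 : ⨆ i, 𝒜 i = ⊤) (M : GrMod 𝒜) (s : Set M)
    (hs : ∀ x ∈ s, ∀ i, M.proj i x ∈ Submodule.span A s) :
    M.IsHomogeneous (Submodule.span A s) := by
  intro x hx
  induction hx using Submodule.span_induction with
  | mem x hx => exact hs x hx
  | zero => intro i; rw [map_zero]; exact Submodule.zero_mem _
  | add x y _ _ hx hy => intro i; rw [map_add]; exact Submodule.add_mem _ (hx i) (hy i)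
  | smul a x _ hx =>
    intro i
    have ha : a ∈ ⨆ i, 𝒜 i := h𝒜 ▸ Submodule.mem_top
    refine Submodule.iSup_induction
      (motive := fun a => M.proj i (a • x) ∈ Submodule.span A s) 𝒜 ha ?_ ?_ ?_
    · intro j a ha
      rw [M.proj_smul ha]
      exact Submodule.smul_mem _ _ (hx _)
    · rw [zero_smul, map_zero]; exact Submodule.zero_mem _
    · intro a b ha hb
      rw [add_smul, map_add]; exact Submodule.add_mem _ ha hb

end GradedModules

section Traces

variable {W : Type u} [Group W] {h : Type u} [AddCommGroup h] [Module ℂ h]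
variable (ρ : Representation ℂ W h)

/-- The graded left module `A_W`. -/
def AW.regular : GrMod (AW.deg ρ) where
  carrier := AW ρ
  deg := AW.deg ρ
  isInternal := AW.isInternal ρ
  smul_mem ha hm := AW.mul_mem ρ ha hm

/-- The inclusion of the group algebra in `A_W`. -/
def AW.ofGroupAlgebra : MonoidAlgebra ℂ W →ₐ[ℂ] AW ρ :=
  MonoidAlgebra.lift ℂ (AW ρ) W
    { toFun w := AW.mk 1 w
      map_one' := rfl
      map_mul' v w := by simp [AW.mk, SkewMonoidAlgebra.single_mul_single] }

theorem AW.ofGroupAlgebra_mem (x : MonoidAlgebra ℂ W) : AW.ofGroupAlgebra ρ x ∈ AW.deg ρ 0 := by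
  have h1 : (1 : Sym ρ) ∈ Sym.deg ρ 0 := by
    have h := Sym.deg_two_mul ρ 0
    rw [Nat.cast_zero, mul_zero] at h
    rw [h, Sym.homog, pow_zero]
    exact Submodule.one_le.1 le_rfl
  induction x using MonoidAlgebra.induction_linear with
  | zero => rw [map_zero]; exact Submodule.zero_mem _
  | add x y hx hy => rw [map_add]; exact Submodule.add_mem _ hx hy
  | single w c =>
    rw [AW.ofGroupAlgebra, MonoidAlgebra.lift_single]
    exact Submodule.smul_mem _ c (AW.mk_mem ρ h1 w)

/-- The evaluation `ℂ[h*] → ℂ` at `0 ∈ h*`. -/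
def Sym.eval0 : Sym ρ →ₐ[ℂ] ℂ := Sym.lift ρ 0

/-- The ideal `J_W` of the invariant ring `ℂ[h*]^W`: the invariants which vanish at `0`. -/
def J : Set (Sym ρ) := {p | (∀ w : W, w • p = p) ∧ Sym.eval0 ρ p = 0}

theorem Sym.deg_ind {motive : Sym ρ → Prop} (hom : ∀ d, ∀ p ∈ Sym.deg ρ d, motive p)
    (add : ∀ p q, motive p → motive q → motive (p + q)) (p : Sym ρ) : motive p := by
  have hp : p ∈ ⨆ i, Sym.deg ρ i := Sym.iSup_deg ρ ▸ Submodule.mem_top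
  exact Submodule.iSup_induction (motive := motive) (Sym.deg ρ) hp hom
    (hom 0 0 (Submodule.zero_mem _)) add

theorem Sym.proj_mem (d : ℤ) (p : Sym ρ) : Sym.proj ρ d p ∈ Sym.deg ρ d := by
  induction p using Sym.deg_ind with
  | hom e p hp =>
    by_cases hde : d = e
    · subst hde; rw [Sym.proj_same ρ hp]; exact hp
    · rw [Sym.proj_ne ρ hde hp]; exact Submodule.zero_mem _
  | add p q hp hq => rw [map_add]; exact Submodule.add_mem _ hp hq

theorem Sym.proj_smul (w : W) (d : ℤ) (p : Sym ρ) :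
    Sym.proj ρ d (w • p) = w • Sym.proj ρ d p := by
  induction p using Sym.deg_ind with
  | hom e p hp =>
    by_cases hde : d = e
    · subst hde; rw [Sym.proj_same ρ hp, Sym.proj_same ρ (Sym.smul_mem_deg ρ w hp)]
    · rw [Sym.proj_ne ρ hde hp, Sym.proj_ne ρ hde (Sym.smul_mem_deg ρ w hp), smul_zero]
  | add p q hp hq => simp only [smul_add, map_add, hp, hq]

theorem Sym.eval0_of_mem {d : ℤ} (hd : d ≠ 0) {p : Sym ρ} (hp : p ∈ Sym.deg ρ d) :
    Sym.eval0 ρ p = 0 := by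
  obtain rfl | ⟨n, rfl, hp'⟩ := Sym.deg_induction ρ hp
  · exact map_zero _
  · have hmap : (Sym.homog ρ n).map (Sym.eval0 ρ).toLinearMap = ⊥ := by
      have h1 : (LinearMap.range (Sym.ι ρ)).map (Sym.eval0 ρ).toLinearMap = ⊥ := by
        rw [eq_bot_iff]
        rintro _ ⟨_, ⟨x, rfl⟩, rfl⟩
        simp [Sym.eval0]
      rw [Sym.homog, Submodule.map_pow, h1]
      exact Submodule.bot_pow (by omega)
    exact (Submodule.mem_bot ℂ).1 (hmap ▸ ⟨p, hp', rfl⟩)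

theorem Sym.eval0_proj_zero (p : Sym ρ) : Sym.eval0 ρ (Sym.proj ρ 0 p) = Sym.eval0 ρ p := by
  induction p using Sym.deg_ind with
  | hom e p hp =>
    by_cases he : e = 0
    · subst he; rw [Sym.proj_same ρ hp]
    · rw [Sym.proj_ne ρ (Ne.symm he) hp, Sym.eval0_of_mem ρ he hp, map_zero]
  | add p q hp hq => simp only [map_add, hp, hq]

theorem J_proj {p : Sym ρ} (hp : p ∈ J ρ) (d : ℤ) : Sym.proj ρ d p ∈ J ρ := by
  refine ⟨fun w => by rw [← Sym.proj_smul, hp.1 w], ?_⟩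
  by_cases hd : d = 0
  · subst hd; rw [Sym.eval0_proj_zero, hp.2]
  · exact Sym.eval0_of_mem ρ hd (Sym.proj_mem ρ d p)

theorem proj_mk_smul (M : GrMod (AW.deg ρ)) (p : Sym ρ) {j : ℤ} {m : M} (hm : m ∈ M.deg j)
    (i : ℤ) : M.proj i ((AW.mk p 1 : AW ρ) • m) = (AW.mk (Sym.proj ρ (i - j) p) 1 : AW ρ) • m := by
  induction p using Sym.deg_ind with
  | hom e p hp =>
    rw [M.proj_smul (AW.mk_mem ρ hp 1)]
    by_cases hij : i - j = e
    · rw [hij, Sym.proj_same ρ hp, show i - e = j by omega, M.proj_same hm]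
    · rw [Sym.proj_ne ρ hij hp, M.proj_ne (by omega) hm, smul_zero, AW.mk,
        SkewMonoidAlgebra.single_zero, zero_smul]
  | add p q hp hq =>
    rw [AW.mk, SkewMonoidAlgebra.single_add, add_smul, map_add, hp, hq, map_add, ← add_smul,
      AW.mk, AW.mk, ← SkewMonoidAlgebra.single_add]

/-- The submodule `⟨J_W⟩ M`, generated by the products `p m` with `p ∈ J_W`, `m ∈ M`. -/
def JM (M : GrMod (AW.deg ρ)) : Submodule (AW ρ) M :=
  Submodule.span (AW ρ) {x | ∃ p ∈ J ρ, ∃ m : M, (AW.mk p 1 : AW ρ) • m = x}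

theorem isHomogeneous_JM (M : GrMod (AW.deg ρ)) : M.IsHomogeneous (JM ρ M) := by
  refine GrMod.isHomogeneous_span (AW.iSup_deg ρ) M _ ?_
  rintro _ ⟨p, hp, m, rfl⟩ i
  induction m using M.induction with
  | hom j m hm =>
    rw [proj_mk_smul ρ M p hm]
    exact Submodule.subset_span ⟨_, J_proj ρ hp _, m, rfl⟩
  | add m n hm hn => rw [smul_add, map_add]; exact Submodule.add_mem _ hm hn

variable [Finite W]

/-- The graded projective module `P_χ = A_W e_χ`. -/
def projCover (χ : Irr W) : GrMod (AW.deg ρ) :=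
  (AW.regular ρ).sub (Submodule.span (AW ρ) {AW.ofGroupAlgebra ρ χ.idem})
    (GrMod.isHomogeneous_span (AW.iSup_deg ρ) (AW.regular ρ) _ (by
      rintro _ rfl i
      have hm : AW.ofGroupAlgebra ρ χ.idem ∈ (AW.regular ρ).deg 0 := AW.ofGroupAlgebra_mem ρ _
      by_cases hi : i = 0
      · subst hi
        rw [(AW.regular ρ).proj_same hm]
        exact Submodule.subset_span rfl
      · rw [(AW.regular ρ).proj_ne hi hm]
        exact Submodule.zero_mem _))

/-- The module `P_χ^{(0)} = P_χ / ⟨J_W⟩ P_χ`. -/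
def projCover0 (χ : Irr W) : GrMod (AW.deg ρ) :=
  (projCover ρ χ).quot (JM ρ (projCover ρ χ)) (isHomogeneous_JM ρ _)

/-- A phyla of `W`: an ordered subdivision `Irr W = 𝒪₁ ⊔ ⋯ ⊔ 𝒪ₘ`, given by the map which sends
`χ` to the index of the phylum which contains it. -/
structure Phyla (W : Type u) [Group W] where
  /-- the number of phyla -/
  m : ℕ
  /-- the index of the phylum of `χ` -/
  index : Irr W → Fin m

/-- The conjugate phyla: `χ` lies in the conjugate of the `i`-th phylum if and only if `χ^∨` lies in
the `i`-th phylum. -/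
def Phyla.conj (P : Phyla W) : Phyla W := ⟨P.m, fun χ => P.index χ.dual⟩

/-- The sum of the images of the homogeneous morphisms `P_η → P_χ` of positive degree with
`η ≲ χ`. -/
def traceSub (P : Phyla W) (χ : Irr W) : Submodule (AW ρ) (projCover ρ χ) :=
  ⨆ (η : Irr W) (_ : P.index η ≤ P.index χ) (d : ℤ) (_ : 0 < d)
    (f : (projCover ρ η).shift d ⟶ projCover ρ χ), LinearMap.range (GrMod.lin f)

/-- The `P`-trace of `P_χ`. -/
def trace (P : Phyla W) (χ : Irr W) : GrMod (AW.deg ρ) :=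
  (projCover ρ χ).quot (traceSub ρ P χ)
    (.iSup fun _ => .iSup fun _ => .iSup fun _ => .iSup fun _ => .iSup fun f =>
      GrMod.isHomogeneous_range f)

end Traces

section Duals

variable {W : Type u} [Group W] {h : Type u} [AddCommGroup h] [Module ℂ h]
variable (ρ : Representation ℂ W h)

/-- The anti-involution of `A_W` which is the identity on `ℂ[h*]` and sends `w` to `w⁻¹`, that is
`p w ↦ w⁻¹ p`. -/
def AW.anti : AW ρ →ₗ[ℂ] AW ρ :=
  (SkewMonoidAlgebra.coeffLinearEquiv (S := ℂ)).symm.toLinearMap ∘ₗ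
    (Finsupp.lsum ℂ fun w : W => Finsupp.lsingle w⁻¹ ∘ₗ (Sym.act ρ w⁻¹).toLinearMap) ∘ₗ
      (SkewMonoidAlgebra.coeffLinearEquiv (S := ℂ)).toLinearMap

theorem AW.anti_mk (p : Sym ρ) (w : W) :
    AW.anti ρ (AW.mk p w) = AW.mk 1 w⁻¹ * AW.mk p 1 := by
  have h1 : AW.anti ρ (AW.mk p w) = AW.mk (w⁻¹ • p) w⁻¹ := by
    ext v
    simp only [AW.anti, LinearMap.comp_apply]
    erw [Finsupp.lsum_single]
    rfl
  rw [h1, AW.mk, AW.mk, AW.mk, SkewMonoidAlgebra.single_mul_single, one_mul, mul_one]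

theorem AW.anti_mk' (p : Sym ρ) (w : W) : AW.anti ρ (AW.mk p w) = AW.mk (w⁻¹ • p) w⁻¹ := by
  rw [AW.anti_mk, AW.mk, AW.mk, AW.mk, SkewMonoidAlgebra.single_mul_single, one_mul, mul_one]

@[elab_as_elim]
theorem AW.ind {motive : AW ρ → Prop} (mk : ∀ p w, motive (AW.mk p w))
    (add : ∀ a b, motive a → motive b → motive (a + b)) (a : AW ρ) : motive a := by
  induction a using SkewMonoidAlgebra.induction_on with
  | zero => have := mk 0 1; rwa [AW.mk, SkewMonoidAlgebra.single_zero] at this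
  | single w p => exact mk p w
  | add a b ha hb => exact add a b ha hb

theorem AW.anti_one : AW.anti ρ 1 = 1 := by
  have := AW.anti_mk' ρ 1 1
  rw [smul_one, inv_one] at this
  exact this

theorem AW.anti_mul (a b : AW ρ) : AW.anti ρ (a * b) = AW.anti ρ b * AW.anti ρ a := by
  induction a using AW.ind with
  | mk p v =>
    induction b using AW.ind with
    | mk q w =>
      rw [AW.anti_mk', AW.anti_mk', AW.mk, AW.mk, SkewMonoidAlgebra.single_mul_single,
        ← AW.mk, AW.anti_mk', AW.mk, AW.mk, AW.mk, SkewMonoidAlgebra.single_mul_single,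
        smul_mul', mul_inv_rev, mul_smul, mul_smul, inv_smul_smul, mul_comm]
    | add b c hb hc => rw [mul_add, map_add, hb, hc, map_add, add_mul]
  | add a c ha hc => rw [add_mul, map_add, ha, hc, map_add, mul_add]

theorem AW.anti_mem {d : ℤ} {a : AW ρ} (ha : a ∈ AW.deg ρ d) : AW.anti ρ a ∈ AW.deg ρ d := by
  have h : a = ∑ w ∈ a.support, AW.mk (a.coeff w) w := by
    conv_lhs => rw [← SkewMonoidAlgebra.sum_single a, SkewMonoidAlgebra.sum_def]
    rfl
  rw [h, map_sum]
  refine Submodule.sum_mem _ fun w _ => ?_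
  rw [AW.anti_mk']
  exact AW.mk_mem ρ (Sym.smul_mem_deg ρ _ (ha w)) _

variable {ρ}

namespace GrMod

variable (M : GrMod (AW.deg ρ))

/-- The dual of the part of degree `-d` of `M`, as the space of linear forms on `M` which vanish on
all the other homogeneous parts. -/
def dualDeg (d : ℤ) : Submodule ℂ (M →ₗ[ℂ] ℂ) where
  carrier := {φ | ∀ j, j ≠ -d → ∀ m ∈ M.deg j, φ m = 0}
  add_mem' hφ hψ j hj m hm := by rw [LinearMap.add_apply, hφ j hj m hm, hψ j hj m hm, add_zero]
  zero_mem' _ _ _ _ := rfl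
  smul_mem' c _ hφ j hj m hm := by rw [LinearMap.smul_apply, hφ j hj m hm, smul_zero]

/-- The direct sum of the duals of the homogeneous parts of `M`. -/
def DualSpace : Type u := ↥(⨆ d, M.dualDeg d)

instance : AddCommGroup M.DualSpace := inferInstanceAs (AddCommGroup ↥(⨆ d, M.dualDeg d))

instance : Module ℂ M.DualSpace := inferInstanceAs (Module ℂ ↥(⨆ d, M.dualDeg d))

/-- The action of `a` on `M`, as a linear map over `ℂ`. -/
def actL : AW ρ →ₗ[ℂ] M →ₗ[ℂ] M where
  toFun a :=
    { toFun m := a • m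
      map_add' := smul_add a
      map_smul' c m := smul_comm a c m }
  map_add' a b := LinearMap.ext fun m => add_smul a b m
  map_smul' c a := LinearMap.ext fun m => smul_assoc c a m

@[simp] theorem actL_apply (a : AW ρ) (m : M) : M.actL a m = a • m := rfl

theorem comp_mem_dualDeg {d e : ℤ} {a : AW ρ} (ha : a ∈ AW.deg ρ d) {φ : M →ₗ[ℂ] ℂ}
    (hφ : φ ∈ M.dualDeg e) : φ ∘ₗ M.actL (AW.anti ρ a) ∈ M.dualDeg (d + e) := by
  intro j hj m hm
  exact hφ (d + j) (by omega) _ (M.smul_mem (AW.anti_mem ρ ha) hm)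

theorem comp_mem_iSup (a : AW ρ) {φ : M →ₗ[ℂ] ℂ} (hφ : φ ∈ ⨆ d, M.dualDeg d) :
    φ ∘ₗ M.actL (AW.anti ρ a) ∈ ⨆ d, M.dualDeg d := by
  have ha : a ∈ ⨆ d, AW.deg ρ d := AW.iSup_deg ρ ▸ Submodule.mem_top
  refine Submodule.iSup_induction
    (motive := fun a => φ ∘ₗ M.actL (AW.anti ρ a) ∈ ⨆ d, M.dualDeg d) _ ha ?_ ?_ ?_
  · intro d a ha
    refine Submodule.iSup_induction
      (motive := fun φ => φ ∘ₗ M.actL (AW.anti ρ a) ∈ ⨆ d, M.dualDeg d) _ hφ ?_ ?_ ?_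
    · intro e φ hφ; exact Submodule.mem_iSup_of_mem _ (M.comp_mem_dualDeg ha hφ)
    · rw [LinearMap.zero_comp]; exact Submodule.zero_mem _
    · intro φ ψ hφ hψ; rw [LinearMap.add_comp]; exact Submodule.add_mem _ hφ hψ
  · rw [map_zero, map_zero, LinearMap.comp_zero]; exact Submodule.zero_mem _
  · intro a b ha hb
    rw [map_add, map_add, LinearMap.comp_add]; exact Submodule.add_mem _ ha hb

/-- `A_W` acts on the dual through the anti-involution: `(a φ)(m) = φ(a' m)`, where `a'` is the image
of `a`. -/
instance : Module (AW ρ) M.DualSpace where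
  smul a φ := ⟨φ.1 ∘ₗ M.actL (AW.anti ρ a), M.comp_mem_iSup a φ.2⟩
  one_smul φ := Subtype.ext (LinearMap.ext fun m => by
    change φ.1 (AW.anti ρ 1 • m) = φ.1 m
    rw [AW.anti_one, one_smul])
  mul_smul a b φ := Subtype.ext (LinearMap.ext fun m => by
    change φ.1 (AW.anti ρ (a * b) • m) = φ.1 (AW.anti ρ b • AW.anti ρ a • m)
    rw [AW.anti_mul, mul_smul])
  smul_zero a := rfl
  smul_add a φ ψ := rfl
  add_smul a b φ := Subtype.ext (LinearMap.ext fun m => by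
    change φ.1 (AW.anti ρ (a + b) • m) = φ.1 (AW.anti ρ a • m) + φ.1 (AW.anti ρ b • m)
    rw [map_add, add_smul, map_add])
  zero_smul φ := Subtype.ext (LinearMap.ext fun m => by
    change φ.1 (AW.anti ρ 0 • m) = 0
    rw [map_zero, zero_smul, map_zero])

instance : IsScalarTower ℂ (AW ρ) M.DualSpace where
  smul_assoc c a φ := Subtype.ext (LinearMap.ext fun m => by
    change φ.1 (AW.anti ρ (c • a) • m) = c • φ.1 (AW.anti ρ a • m)
    rw [map_smul (AW.anti ρ), smul_assoc]
    exact LinearMap.map_smul φ.1 c _)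

/-- The linear form underlying an element of the dual. -/
def dualIncl : M.DualSpace →ₗ[ℂ] (M →ₗ[ℂ] ℂ) := (⨆ d, M.dualDeg d).subtype

theorem comp_proj_mem (φ : M →ₗ[ℂ] ℂ) (d : ℤ) : φ ∘ₗ M.proj (-d) ∈ M.dualDeg d := by
  intro j hj m hm
  rw [LinearMap.comp_apply, M.proj_ne hj.symm hm, map_zero]

/-- The graded dual `M^*`, with `(M^*)_d = Hom_ℂ(M_{-d}, ℂ)`. -/
def dual : GrMod (AW.deg ρ) where
  carrier := M.DualSpace
  deg d := (M.dualDeg d).comap M.dualIncl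
  isInternal := by
    refine isInternal_of_proj _
      (fun d => LinearMap.codRestrict (⨆ d, M.dualDeg d)
        ((LinearMap.lcomp ℂ ℂ (M.proj (-d))) ∘ₗ M.dualIncl)
        fun φ => Submodule.mem_iSup_of_mem d (M.comp_proj_mem _ d)) ?_ ?_ ?_
    · rintro d φ hφ
      refine Subtype.ext (LinearMap.ext fun m => ?_)
      change φ.1 (M.proj (-d) m) = φ.1 m
      induction m using M.induction with
      | hom j m hm =>
        by_cases hj : j = -d
        · subst hj; rw [M.proj_same hm]
        · rw [M.proj_ne (Ne.symm hj) hm, map_zero]; exact (hφ j hj m hm).symm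
      | add m n hm hn => simp only [map_add, hm, hn]
    · rintro d e hde φ hφ
      refine Subtype.ext (LinearMap.ext fun m => ?_)
      exact hφ (-d) (by omega) _ (M.proj_mem _ m)
    · rw [eq_top_iff]
      rintro ⟨φ, hφ⟩ -
      have : (⨆ d, M.dualDeg d) ≤ (⨆ d, (M.dualDeg d).comap M.dualIncl).map M.dualIncl :=
        iSup_le fun d ψ hψ => ⟨⟨ψ, Submodule.mem_iSup_of_mem d hψ⟩,
          Submodule.mem_iSup_of_mem d hψ, rfl⟩
      obtain ⟨ψ, hψ, hψφ⟩ := this hφ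
      have : ψ = ⟨φ, hφ⟩ := Subtype.ext hψφ
      exact this ▸ hψ
  smul_mem ha hφ := M.comp_mem_dualDeg ha hφ

/-- The graded Euler-Poincaré pairing `⟨E, F⟩ = ∑ᵢ (-1)ⁱ gdim extⁱ(E, F)`, as a formal series in
`t^{1/2}` given by its coefficients: the value at `j` is the coefficient of `t^{j/2}`. -/
def gEP (E F : GrMod (AW.deg ρ)) : ℤ → ℤ := fun j =>
  ∑ᶠ i : ℕ, (-1) ^ i * (Module.finrank ℂ (ext E F i j) : ℤ)

/-- The space of `W`-equivariant maps from a representation of `W` to the part of degree `i` of `M`. -/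
def homW {V : Type*} [AddCommGroup V] [Module ℂ V] (τ : Representation ℂ W V) (i : ℤ) :
    Submodule ℂ (V →ₗ[ℂ] M) where
  carrier := {f | (∀ w v, f (τ w v) = (AW.mk 1 w : AW ρ) • f v) ∧ ∀ v, f v ∈ M.deg i}
  add_mem' hf hg := ⟨fun w v => by simp only [LinearMap.add_apply, hf.1, hg.1, smul_add],
    fun v => Submodule.add_mem _ (hf.2 v) (hg.2 v)⟩
  zero_mem' := ⟨fun w v => by simp, fun v => Submodule.zero_mem _⟩
  smul_mem' c f hf := ⟨fun w v => by
      rw [LinearMap.smul_apply, LinearMap.smul_apply, hf.1]; exact (smul_comm _ c _).symm,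
    fun v => Submodule.smul_mem _ c (hf.2 v)⟩

end GrMod

end Duals

section KostkaSystems

/-- The Laurent series `∑ cᵢ t^{i/2}` in the variable `t^{1/2}`, for coefficients `cᵢ` which vanish for
`i` small enough. -/
def halfSeries (c : ℤ → ℕ) : LaurentSeries ℚ :=
  open scoped Classical in
  if hc : BddBelow (Function.support fun i => (c i : ℚ)) then
    HahnSeries.ofSuppBddBelow (fun i => (c i : ℚ)) hc
  else 0

/-- The inclusion of `ℚ((t))` in `ℚ((t^{1/2}))`. -/
def inclT : LaurentSeries ℚ →+* LaurentSeries ℚ :=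
  HahnSeries.embDomainRingHom (AddMonoidHom.mulLeft (2 : ℤ))
    (fun a b hab => by simpa using hab) (fun a b => by simp)

variable {W : Type u} [Group W] {h : Type u} [AddCommGroup h] [Module ℂ h]
variable {ρ : Representation ℂ W h}

/-- The graded multiplicity `gdim hom_W(τ, M) = ∑ᵢ t^{i/2} dim Hom_W(τ, Mᵢ)`. -/
def gdimHomW (M : GrMod (AW.deg ρ)) {V : Type*} [AddCommGroup V] [Module ℂ V]
    (τ : Representation ℂ W V) : LaurentSeries ℚ :=
  halfSeries fun i => Module.finrank ℂ (M.homW τ i)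

/-- The graded multiplicity `[M : L_χ]`. -/
def mult (M : GrMod (AW.deg ρ)) (χ : Irr W) : LaurentSeries ℚ := gdimHomW M χ.L.rep

variable [Finite W]

variable (ρ) in
/-- The matrix `Ω`, with `Ω_{χ,η} = gdim hom_W(L_χ ⊗ L_{η^∨}, C_triv)` and
`C_triv = P_triv^{(0)}`. -/
def Omega : Matrix (Irr W) (Irr W) (LaurentSeries ℚ) := fun χ η =>
  gdimHomW (projCover0 ρ (Irr.triv W)) (χ.L.rep.tprod η.dual.L.rep)

/-- A Kostka system adapted to `P`. -/
structure IsKostkaSystem (P : Phyla W) (Kp Km : Irr W → GrMod (AW.deg ρ)) : Prop where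
  /-- each `K⁺_χ` is a `P`-trace of `P_χ` -/
  plus : ∀ χ, Nonempty (Kp χ ≅ trace ρ P χ)
  /-- each `K⁻_χ` is a trace of `P_χ` for the conjugate phyla -/
  minus : ∀ χ, Nonempty (Km χ ≅ trace ρ P.conj χ)
  /-- the pairing of `K⁺_χ` and `(K⁻_η)^*` is nonzero only if `χ ∼ η^∨` -/
  orthogonal : ∀ χ η, GrMod.gEP (Kp χ) (Km η).dual ≠ 0 → P.index χ = P.index η.dual

/-- The matrix `K^σ`, with `(K^σ)_{χ,η} = K_{χ^∨,η^∨}`. -/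
def sigma (K : Matrix (Irr W) (Irr W) (LaurentSeries ℚ)) :
    Matrix (Irr W) (Irr W) (LaurentSeries ℚ) := K.submatrix Irr.dual Irr.dual

variable (ρ) in
/-- The matrices `K⁺`, `K⁻`, `Λ` with entries in `ℚ((t))` solve the equation of Lusztig and Shoji
`ᵗK⁺ ⬝ Λ ⬝ (K⁻)^σ = Ω`, with the normalizations attached to the phyla `P`. -/
structure IsLusztigShojiSolution (P : Phyla W)
    (Kp Km Λ : Matrix (Irr W) (Irr W) (LaurentSeries ℚ)) : Prop where
  plus_diag : ∀ χ, Kp χ χ = 1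
  plus_zero : ∀ χ η, P.index η ≤ P.index χ → η ≠ χ → Kp χ η = 0
  minus_diag : ∀ χ, Km χ χ = 1
  minus_zero : ∀ χ η, P.index η.dual ≤ P.index χ.dual → η.dual ≠ χ.dual → Km χ η = 0
  block : ∀ χ η, Λ χ η ≠ 0 → P.index χ = P.index η
  equation : (Kp.transpose * Λ * sigma Km).map inclT = Omega ρ

end KostkaSystems

end KostkaSystem

end

/-!
For a graded module `M` in even degrees let `m(M)` be the vector of the series
`∑ₙ [M_{2n} : L_ψ] tⁿ`, and let `𝐏` be the matrix whose rows are the vectors `m(P_χ)`. The part of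
degree `0` of `P_χ` is `L_χ`, so `𝐏` has constant term `1` and is invertible over `ℚ⟦t⟧`.

**The pairing.** The modules `P_χ⟨d⟩` are projective and `Hom(P_χ⟨d⟩, F) = e_χ F_d`. If `E` lives in
degrees `≥ 0` and `F` in degrees `≤ 0`, additivity in `E` therefore gives
`⟨E, F⟩ = m(F) ᵗ𝐏⁻¹ ᵗm(E)`, where `m(F)` records the multiplicities in the degrees `-2n`
(`GrMod.gEP_eq`). No bound on projective dimensions enters: a module living in degrees above those of
`F` has no extensions by `F` (`GrMod.ext_subsingleton`), and up to such modules `E` is assembled from finitely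
many `P_χ⟨d⟩` by short exact sequences.

**The matrix `Λ`.** A vector of positive degree in `e_η P_χ` is the image of the generator of `P_η`,
so it dies in the trace of `P_χ` if `η ≲ χ`. This makes the matrices `U` of `K⁺` and `V` of `(K⁻)^σ`
block unitriangular (`trace_props`). The multiplicities of `(K⁻_η)^*` are those of `K⁻_η`, up to
duality, so the orthogonality of the Kostka system says that `V ᵗ𝐏⁻¹ ᵗU` is block diagonal. Its
inverse `G` satisfies `ᵗU G V = ᵗ𝐏`.

**The matrix `Ω`.** By Chevalley's lemma (`Sym.chevalley`), a basis of a graded complement of the ideal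
generated by the invariants vanishing at `0` is a basis of `ℂ[h*]` over the invariants, so
`P_η ≅ ℂ[h*] ⊗ L_η` has the character of `ℂ[h*]^W ⊗ C_triv ⊗ L_η` (`Sym.character_degRep`). Hence
`Ω = H⁻¹ ᵗ𝐏`, with `H` the Hilbert series of the invariants (`Omega_eq`), and `Λ = H⁻¹ G` solves the
equation.

**Uniqueness.** As `Λ` is invertible, this is the uniqueness of the decomposition of a matrix as a
product of a block lower unitriangular, a block diagonal and a block upper unitriangular one
(`blockDecomposition_unique`).
-/

noncomputable section

open CategoryTheory

namespace KostkaSystem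

/-! ### Euler characteristics of extension groups -/

section EulerCharacteristic

/-- In a long exact sequence `0 → C₀ → B₀ → A₀ → C₁ → B₁ → ⋯`, the alternating sum of dimensions up
to index `n` is the rank of the last connecting map, up to sign. -/
theorem alternating_sum_finrank {k : Type*} [Field k] {A B C : ℕ → Type*}
    [∀ i, AddCommGroup (A i)] [∀ i, Module k (A i)] [∀ i, FiniteDimensional k (A i)]
    [∀ i, AddCommGroup (B i)] [∀ i, Module k (B i)] [∀ i, FiniteDimensional k (B i)]
    [∀ i, AddCommGroup (C i)] [∀ i, Module k (C i)] [∀ i, FiniteDimensional k (C i)]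
    (a : ∀ i, C i →ₗ[k] B i) (b : ∀ i, B i →ₗ[k] A i) (δ : ∀ i, A i →ₗ[k] C (i + 1))
    (h0 : Function.Injective (a 0)) (hab : ∀ i, LinearMap.range (a i) = LinearMap.ker (b i))
    (hbδ : ∀ i, LinearMap.range (b i) = LinearMap.ker (δ i))
    (hδa : ∀ i, LinearMap.range (δ i) = LinearMap.ker (a (i + 1))) (n : ℕ) :
    ∑ i ∈ Finset.range (n + 1), (-1 : ℤ) ^ i *
      ((Module.finrank k (B i) : ℤ) - Module.finrank k (A i) - Module.finrank k (C i)) =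
    -(-1) ^ n * Module.finrank k (LinearMap.range (δ n)) := by
  have hB : ∀ i, (Module.finrank k (B i) : ℤ) =
      Module.finrank k (LinearMap.range (b i)) + Module.finrank k (LinearMap.range (a i)) := by
    intro i
    rw [hab]
    exact_mod_cast (LinearMap.finrank_range_add_finrank_ker (b i)).symm
  have hA : ∀ i, (Module.finrank k (A i) : ℤ) =
      Module.finrank k (LinearMap.range (δ i)) + Module.finrank k (LinearMap.range (b i)) := by
    intro i
    rw [hbδ]
    exact_mod_cast (LinearMap.finrank_range_add_finrank_ker (δ i)).symm
  have hC : ∀ i, (Module.finrank k (C (i + 1)) : ℤ) =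
      Module.finrank k (LinearMap.range (a (i + 1))) +
        Module.finrank k (LinearMap.range (δ i)) := by
    intro i
    rw [hδa]
    exact_mod_cast (LinearMap.finrank_range_add_finrank_ker (a (i + 1))).symm
  have hC0 : Module.finrank k (C 0) = Module.finrank k (LinearMap.range (a 0)) :=
    (LinearMap.finrank_range_of_inj h0).symm
  induction n with
  | zero => simp [hB, hA, hC0]; ring
  | succ n ih =>
    rw [Finset.sum_range_succ, ih, hB, hA, hC]
    ring

variable {k : Type*} [Field k] {𝒞 : Type*} [Category 𝒞] [Abelian 𝒞] [Linear k 𝒞] [HasExt 𝒞]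

open Abelian

variable (k) in
/-- All the spaces `Extⁱ(X, Y)` have finite dimension, and almost all of them vanish. -/
def ExtFinite (X Y : 𝒞) : Prop :=
  (∀ i, FiniteDimensional k (Ext X Y i)) ∧ ∃ n, ∀ i, n ≤ i → Subsingleton (Ext X Y i)

variable (k) in
/-- The Euler characteristic `∑ᵢ (-1)ⁱ dim Extⁱ(X, Y)`. -/
def euler (X Y : 𝒞) : ℤ := ∑ᶠ i : ℕ, (-1) ^ i * (Module.finrank k (Ext X Y i) : ℤ)

theorem euler_eq_sum {X Y : 𝒞} {n : ℕ} (hn : ∀ i, n ≤ i → Subsingleton (Ext X Y i)) :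
    euler k X Y = ∑ i ∈ Finset.range n, (-1) ^ i * (Module.finrank k (Ext X Y i) : ℤ) := by
  refine finsum_eq_sum_of_support_subset _ fun i hi => ?_
  by_contra hi'
  have := hn i (by simpa using hi')
  exact hi (by simp [Module.finrank_zero_of_subsingleton])

variable {S : ShortComplex 𝒞} (hS : S.ShortExact) (Y : 𝒞)

/-- Composition with a fixed morphism, as a linear map on extensions. -/
def precompL {X X' : 𝒞} (f : X ⟶ X') (Y : 𝒞) (i : ℕ) : Ext X' Y i →ₗ[k] Ext X Y i :=
  Ext.bilinearCompOfLinear k X X' Y 0 i i (zero_add i) (Ext.mk₀ f)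

/-- The connecting map of the contravariant long exact sequence. -/
def deltaL (i : ℕ) : Ext S.X₁ Y i →ₗ[k] Ext S.X₃ Y (i + 1) :=
  Ext.bilinearCompOfLinear k S.X₃ S.X₁ Y 1 i (i + 1) (add_comm 1 i) hS.extClass

include hS in
theorem range_precompL (i : ℕ) :
    LinearMap.range (precompL (k := k) S.g Y i) = LinearMap.ker (precompL (k := k) S.f Y i) := by
  apply le_antisymm
  · rintro _ ⟨x, rfl⟩
    change (Ext.mk₀ S.f).comp ((Ext.mk₀ S.g).comp x (zero_add i)) (zero_add i) = 0
    simp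
  · intro x hx
    exact Ext.contravariant_sequence_exact₂ hS Y x hx

theorem range_precompL_eq_ker_deltaL (i : ℕ) :
    LinearMap.range (precompL (k := k) S.f Y i) = LinearMap.ker (deltaL (k := k) hS Y i) := by
  apply le_antisymm
  · rintro _ ⟨x, rfl⟩
    change hS.extClass.comp ((Ext.mk₀ S.f).comp x (zero_add i)) (add_comm 1 i) = 0
    rw [← Ext.comp_assoc hS.extClass (Ext.mk₀ S.f) x (add_zero 1) (zero_add i) (by omega)]
    simp
  · intro x hx
    exact Ext.contravariant_sequence_exact₁ hS Y x (add_comm 1 i) hx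

theorem range_deltaL (i : ℕ) :
    LinearMap.range (deltaL (k := k) hS Y i) =
      LinearMap.ker (precompL (k := k) S.g Y (i + 1)) := by
  apply le_antisymm
  · rintro _ ⟨x, rfl⟩
    change (Ext.mk₀ S.g).comp (hS.extClass.comp x (add_comm 1 i)) (zero_add (i + 1)) = 0
    rw [← Ext.comp_assoc (Ext.mk₀ S.g) hS.extClass x (zero_add 1) (add_comm 1 i) (by omega)]
    simp
  · intro x hx
    exact Ext.contravariant_sequence_exact₃ hS Y x hx (add_comm 1 i)

include hS in
theorem precompL_zero_injective : Function.Injective (precompL (k := k) S.g Y 0) := by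
  have := hS.epi_g
  exact Ext.precomp_mk₀_injective_of_epi Y S.g

variable {Y}

/-- A vector space in the middle of an exact sequence of finite-dimensional spaces. -/
theorem finiteDimensional_of_exact {U V T : Type*} [AddCommGroup U] [Module k U] [AddCommGroup V]
    [Module k V] [AddCommGroup T] [Module k T] [FiniteDimensional k U] [FiniteDimensional k T]
    (f : U →ₗ[k] V) (g : V →ₗ[k] T) (hfg : LinearMap.range f = LinearMap.ker g) :
    FiniteDimensional k V := by
  have h1 : FiniteDimensional k (LinearMap.ker g) := hfg ▸ inferInstance
  have h2 : FiniteDimensional k (V ⧸ LinearMap.ker g) :=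
    Module.Finite.equiv g.quotKerEquivRange.symm
  exact Module.Finite.of_submodule_quotient (LinearMap.ker g)

theorem subsingleton_of_exact {U V T : Type*} [AddCommGroup U] [Module k U] [AddCommGroup V]
    [Module k V] [AddCommGroup T] [Module k T] [Subsingleton U] [Subsingleton T]
    (f : U →ₗ[k] V) (g : V →ₗ[k] T) (hfg : LinearMap.range f = LinearMap.ker g) :
    Subsingleton V := by
  refine subsingleton_of_forall_eq 0 fun x => ?_
  obtain ⟨y, rfl⟩ : x ∈ LinearMap.range f := by
    rw [hfg]; exact Subsingleton.elim _ _
  rw [Subsingleton.elim y 0, map_zero]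

include hS in
theorem ExtFinite.middle (h1 : ExtFinite k S.X₁ Y) (h3 : ExtFinite k S.X₃ Y) :
    ExtFinite k S.X₂ Y := by
  obtain ⟨f1, n1, h1⟩ := h1
  obtain ⟨f3, n3, h3⟩ := h3
  refine ⟨fun i => finiteDimensional_of_exact _ _ (range_precompL hS Y i), max n1 n3,
    fun i hi => ?_⟩
  have := h1 i (by omega)
  have := h3 i (by omega)
  exact subsingleton_of_exact (k := k) _ _ (range_precompL hS Y i)

include hS in
theorem ExtFinite.right (h1 : ExtFinite k S.X₁ Y) (h2 : ExtFinite k S.X₂ Y) :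
    ExtFinite k S.X₃ Y := by
  obtain ⟨f1, n1, h1⟩ := h1
  obtain ⟨f2, n2, h2⟩ := h2
  refine ⟨fun i => ?_, max n1 n2 + 1, fun i hi => ?_⟩
  · cases i with
    | zero => exact Module.Finite.of_injective _ (precompL_zero_injective (k := k) hS Y)
    | succ i => exact finiteDimensional_of_exact _ _ (range_deltaL hS Y i)
  · obtain ⟨i, rfl⟩ : ∃ j, i = j + 1 := ⟨i - 1, by omega⟩
    have := h1 i (by omega)
    have := h2 (i + 1) (by omega)
    exact subsingleton_of_exact (k := k) _ _ (range_deltaL hS Y i)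

include hS in
theorem euler_middle (h1 : ExtFinite k S.X₁ Y) (h3 : ExtFinite k S.X₃ Y) :
    euler k S.X₂ Y = euler k S.X₁ Y + euler k S.X₃ Y := by
  have h2 := ExtFinite.middle hS h1 h3
  obtain ⟨f1, n1, h1⟩ := h1
  obtain ⟨f2, n2, h2⟩ := h2
  obtain ⟨f3, n3, h3⟩ := h3
  set n := max n1 (max n2 n3) with hn
  rw [euler_eq_sum (n := n + 1) fun i hi => h1 i (by omega),
    euler_eq_sum (n := n + 1) fun i hi => h2 i (by omega),
    euler_eq_sum (n := n + 1) fun i hi => h3 i (by omega)]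
  have key := alternating_sum_finrank (k := k) (fun i => precompL S.g Y i)
    (fun i => precompL S.f Y i) (fun i => deltaL hS Y i) (precompL_zero_injective hS Y)
    (range_precompL hS Y) (range_precompL_eq_ker_deltaL hS Y) (range_deltaL hS Y) n
  have hz : Module.finrank k (LinearMap.range (deltaL (k := k) hS Y n)) = 0 := by
    have := h1 n (by omega)
    have : Subsingleton (LinearMap.range (deltaL (k := k) hS Y n)) :=
      (LinearMap.surjective_rangeRestrict _).subsingleton
    exact Module.finrank_zero_of_subsingleton
  rw [hz, Nat.cast_zero, mul_zero] at key
  simp only [mul_sub, Finset.sum_sub_distrib] at key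
  linarith

theorem extFinite_of_projective (X Y : 𝒞) [Projective X] [FiniteDimensional k (X ⟶ Y)] :
    ExtFinite k X Y := by
  refine ⟨fun i => ?_, 1, fun i hi => ?_⟩
  · cases i with
    | zero => exact Module.Finite.equiv (Ext.linearEquiv₀ (R := k) (X := X) (Y := Y)).symm
    | succ i =>
      have := Ext.subsingleton_of_projective X Y i
      infer_instance
  · obtain ⟨j, rfl⟩ : ∃ j, i = j + 1 := ⟨i - 1, by omega⟩
    exact Ext.subsingleton_of_projective X Y j

theorem euler_of_projective (X Y : 𝒞) [Projective X] :
    euler k X Y = Module.finrank k (X ⟶ Y) := by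
  rw [euler_eq_sum (n := 1) fun i hi => ?_]
  · simp [(Ext.linearEquiv₀ (R := k) (X := X) (Y := Y)).finrank_eq]
  · obtain ⟨j, rfl⟩ : ∃ j, i = j + 1 := ⟨i - 1, by omega⟩
    exact Ext.subsingleton_of_projective X Y j

theorem extFinite_of_subsingleton {X Y : 𝒞} (h : ∀ i, Subsingleton (Ext X Y i)) :
    ExtFinite k X Y :=
  ⟨fun _ => inferInstance, 0, fun i _ => h i⟩

theorem euler_of_subsingleton {X Y : 𝒞} (h : ∀ i, Subsingleton (Ext X Y i)) :
    euler k X Y = 0 := by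
  rw [euler_eq_sum (n := 0) fun i _ => h i, Finset.sum_range_zero]

end EulerCharacteristic

/-! ### Exact sequences and free objects in the category of graded modules -/

section GradedModules

variable {k : Type v} {A : Type u} [CommRing k] [Ring A] [Algebra k A]

namespace GrMod

variable {𝒜 : ℤ → Submodule k A}

theorem mono_of_injective {M N : GrMod 𝒜} {f : M ⟶ N} (hf : Function.Injective (lin f)) :
    Mono f :=
  ⟨fun _ _ h => hom_ext fun x => hf (LinearMap.congr_fun (congrArg lin h) x)⟩

theorem epi_of_surjective {M N : GrMod 𝒜} {f : M ⟶ N} (hf : Function.Surjective (lin f)) :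
    Epi f :=
  ⟨fun _ _ h => hom_ext fun x => by
    obtain ⟨y, rfl⟩ := hf x
    exact LinearMap.congr_fun (congrArg lin h) y⟩

/-- The short complex `ker f → M → N`. -/
def kerComplex {M N : GrMod 𝒜} (f : M ⟶ N) : ShortComplex (GrMod 𝒜) :=
  ShortComplex.mk (subι M _ (isHomogeneous_ker f)) f (hom_ext fun x => x.2)

theorem kerComplex_shortExact {M N : GrMod 𝒜} (f : M ⟶ N)
    (hf : Function.Surjective (lin f)) : (kerComplex f).ShortExact := by
  have : Mono (kerComplex f).f := mono_of_injective (Submodule.subtype_injective _)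
  have : Epi (kerComplex f).g := epi_of_surjective hf
  refine ShortComplex.ShortExact.mk' (ShortComplex.exact_of_f_is_kernel _ ?_) ‹_› ‹_›
  exact Limits.KernelFork.IsLimit.ofι _ _
    (fun g hg => subLift _ (isHomogeneous_ker f) g fun x =>
      LinearMap.congr_fun (congrArg lin hg) x)
    (fun _ _ => rfl)
    (fun _ _ _ hm => hom_ext fun x =>
      Subtype.ext (LinearMap.congr_fun (congrArg lin hm) x))

theorem exists_deg_lift {M N : GrMod 𝒜} {f : M ⟶ N} (hf : Function.Surjective (lin f)) {i : ℤ}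
    {y : N} (hy : y ∈ N.deg i) : ∃ x ∈ M.deg i, lin f x = y := by
  obtain ⟨x, rfl⟩ := hf y
  exact ⟨M.proj i x, M.proj_mem i x, by rw [lin_proj, N.proj_same hy]⟩

/-- The direct sum `⨁ₓ R⟨s x⟩` of shifts of a graded module `R`. -/
def sumShift (R : GrMod 𝒜) {X : Type u} (s : X → ℤ) : GrMod 𝒜 where
  carrier := X →₀ R
  deg i := Submodule.comap (Finsupp.lcoeFun : (X →₀ R) →ₗ[k] X → R)
    (Submodule.pi Set.univ fun x => R.deg (i - s x))
  isInternal := by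
    classical
    refine isInternal_of_proj _
      (fun i => Finsupp.lsum k fun x => Finsupp.lsingle x ∘ₗ R.proj (i - s x)) ?_ ?_ ?_
    · intro i f hf
      conv_rhs => rw [← Finsupp.sum_single f]
      refine Finset.sum_congr rfl fun x _ => ?_
      have h : f x ∈ R.deg (i - s x) := hf x trivial
      change Finsupp.single x (R.proj (i - s x) (f x)) = _
      rw [R.proj_same h]
    · intro i j hij f hf
      refine Finset.sum_eq_zero fun x _ => ?_
      have h : f x ∈ R.deg (j - s x) := hf x trivial
      change Finsupp.single x (R.proj (i - s x) (f x)) = _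
      rw [R.proj_ne (by omega) h, Finsupp.single_zero]
    · rw [eq_top_iff]
      intro f _
      rw [← Finsupp.sum_single f]
      refine Submodule.sum_mem _ fun x _ => ?_
      obtain ⟨t, ht⟩ := R.sum_proj (f x)
      rw [← ht, Finsupp.single_finsetSum]
      refine Submodule.sum_mem _ fun i _ => Submodule.mem_iSup_of_mem (i + s x) ?_
      intro y _
      change Finsupp.single x (R.proj i (f x)) y ∈ R.deg (i + s x - s y)
      by_cases hxy : x = y
      · subst hxy
        rw [Finsupp.single_eq_same, add_sub_cancel_right]
        exact R.proj_mem i _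
      · rw [Finsupp.single_eq_of_ne (Ne.symm hxy)]
        exact Submodule.zero_mem _
  smul_mem {i j a m} ha hm x _ := by
    change a • m x ∈ R.deg (i + j - s x)
    rw [add_sub_assoc]
    exact R.smul_mem ha (hm x trivial)

theorem mem_sumShift {R : GrMod 𝒜} {X : Type u} {s : X → ℤ} {i : ℤ} {f : X →₀ R} :
    f ∈ (sumShift R s).deg i ↔ ∀ x, f x ∈ R.deg (i - s x) :=
  ⟨fun h x => h x trivial, fun h x _ => h x⟩

/-- `M` vanishes in degrees `< D`. -/
def BoundedBelow (M : GrMod 𝒜) (D : ℤ) : Prop := ∀ i < D, M.deg i = ⊥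

/-- `M` vanishes in degrees `≥ D`. -/
def BoundedAbove (M : GrMod 𝒜) (D : ℤ) : Prop := ∀ i, D ≤ i → M.deg i = ⊥

theorem BoundedBelow.sub {M : GrMod 𝒜} {D : ℤ} (hM : M.BoundedBelow D) (N : Submodule A M)
    (hN : M.IsHomogeneous N) : (M.sub N hN).BoundedBelow D := by
  intro i hi
  rw [eq_bot_iff]
  intro x hx
  have : N.subtype x ∈ M.deg i := hx
  rw [hM i hi] at this
  exact Subtype.ext this

theorem BoundedBelow.of_surjective {M N : GrMod 𝒜} {D : ℤ} (hM : M.BoundedBelow D) (f : M ⟶ N)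
    (hf : Function.Surjective (lin f)) : N.BoundedBelow D := by
  intro i hi
  rw [eq_bot_iff]
  intro y hy
  obtain ⟨x, hx, rfl⟩ := exists_deg_lift hf hy
  rw [hM i hi, Submodule.mem_bot] at hx
  rw [hx, map_zero]
  exact Submodule.zero_mem _

theorem hom_subsingleton {M N : GrMod 𝒜} {D : ℤ} (hM : M.BoundedBelow D)
    (hN : N.BoundedAbove D) : Subsingleton (M ⟶ N) := by
  refine subsingleton_of_forall_eq 0 fun f => hom_ext fun m => ?_
  induction m using M.induction with
  | hom i m hm =>
    rcases lt_or_ge i D with hi | hi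
    · rw [hM i hi, Submodule.mem_bot] at hm
      rw [hm, map_zero, map_zero]
    · have := lin_mem f hm
      rw [hN i hi] at this
      exact this
  | add m n hm hn => rw [map_add, map_add, hm, hn]

end GrMod

end GradedModules

section Regular

variable {W : Type u} [Group W] {h : Type u} [AddCommGroup h] [Module ℂ h]
variable (ρ : Representation ℂ W h)

theorem Sym.deg_neg {d : ℤ} (hd : d < 0) : Sym.deg ρ d = ⊥ := by
  rw [eq_bot_iff]
  exact iSup₂_le fun n hn => by omega

theorem AW.deg_neg {d : ℤ} (hd : d < 0) : AW.deg ρ d = ⊥ := by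
  rw [eq_bot_iff]
  intro a ha
  rw [Submodule.mem_bot]
  ext w
  have := ha w
  rw [Sym.deg_neg ρ hd, Submodule.mem_bot] at this
  exact this

theorem AW.one_mem : (1 : AW ρ) ∈ AW.deg ρ 0 := by
  have := AW.ofGroupAlgebra_mem ρ 1
  rwa [map_one] at this

namespace GrMod

variable {ρ} {X : Type u} (s : X → ℤ)

/-- The morphism from a free graded module given by the images of the generators. -/
def freeDesc (N : GrMod (AW.deg ρ)) (y : X → N) (hy : ∀ x, y x ∈ N.deg (s x)) :
    sumShift (AW.regular ρ) s ⟶ N :=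
  mkHom (Finsupp.linearCombination (AW ρ) y : (X →₀ AW ρ) →ₗ[AW ρ] N) fun i f hf => by
    refine Submodule.sum_mem _ fun x _ => ?_
    have := N.smul_mem (mem_sumShift.1 hf x) (hy x)
    rwa [sub_add_cancel] at this

/-- The generator with index `x` of a free graded module. -/
def gen (x : X) : sumShift (AW.regular ρ) s := (Finsupp.single x 1 : X →₀ AW ρ)

theorem freeDesc_gen (N : GrMod (AW.deg ρ)) (y : X → N) (hy : ∀ x, y x ∈ N.deg (s x))
    (x : X) : lin (freeDesc s N y hy) (gen s x) = y x := by
  change Finsupp.linearCombination (AW ρ) y (Finsupp.single x 1) = y x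
  rw [Finsupp.linearCombination_single, one_smul]

theorem gen_mem (x : X) : gen s x ∈ (sumShift (AW.regular ρ) s).deg (s x) := by
  classical
  refine mem_sumShift.2 fun y => ?_
  change (Finsupp.single x 1 : X →₀ AW ρ) y ∈ AW.deg ρ (s x - s y)
  by_cases hxy : x = y
  · subst hxy
    rw [Finsupp.single_eq_same, sub_self]
    exact AW.one_mem ρ
  · rw [Finsupp.single_eq_of_ne (Ne.symm hxy)]
    exact Submodule.zero_mem _

theorem free_hom_ext {N : GrMod (AW.deg ρ)} {f g : sumShift (AW.regular ρ) s ⟶ N}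
    (hfg : ∀ x, lin f (gen s x) = lin g (gen s x)) : f = g := by
  have key : (lin f : (X →₀ AW ρ) →ₗ[AW ρ] N) = lin g :=
    Finsupp.lhom_ext' fun x => LinearMap.ext_ring (hfg x)
  exact Subtype.ext key

instance free_projective : Projective (sumShift (AW.regular ρ) s) where
  factors {N M} f e _ := by
    have he := surjective_of_epi e
    choose y hy hey using fun x => exists_deg_lift he (lin_mem f (gen_mem s x))
    refine ⟨freeDesc s N y hy, free_hom_ext s fun x => ?_⟩
    rw [lin_comp, LinearMap.comp_apply, freeDesc_gen, hey]

theorem free_boundedBelow {D : ℤ} (hs : ∀ x, D ≤ s x) :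
    (sumShift (AW.regular ρ) s).BoundedBelow D := by
  intro i hi
  rw [eq_bot_iff]
  intro f hf
  let g : X →₀ AW ρ := f
  change g = 0
  refine Finsupp.ext fun x => ?_
  have h1 : g x ∈ AW.deg ρ (i - s x) := mem_sumShift.1 hf x
  rw [AW.deg_neg ρ (by have := hs x; omega)] at h1
  exact h1

theorem exists_free_surjection {M : GrMod (AW.deg ρ)} {D : ℤ} (hM : M.BoundedBelow D) :
    ∃ (Q : GrMod (AW.deg ρ)) (_ : Projective Q) (f : Q ⟶ M),
      Q.BoundedBelow D ∧ Function.Surjective (lin f) := by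
  let X : Type u := {p : ℤ × M // p.2 ∈ M.deg p.1 ∧ D ≤ p.1}
  let s : X → ℤ := fun p => p.1.1
  let f := freeDesc s M (fun p => p.1.2) fun p => p.2.1
  refine ⟨sumShift (AW.regular ρ) s, free_projective s, f,
    free_boundedBelow s fun p => p.2.2, fun m => ?_⟩
  change m ∈ LinearMap.range (lin f)
  induction m using M.induction with
  | hom i m hm =>
    rcases lt_or_ge i D with hi | hi
    · rw [hM i hi, Submodule.mem_bot] at hm
      rw [hm]
      exact Submodule.zero_mem _
    · exact ⟨_, freeDesc_gen s M _ _ ⟨(i, m), hm, hi⟩⟩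
  | add m n hm hn => exact Submodule.add_mem _ hm hn

/-- Since a module living in degrees `≥ D` has a free resolution living in degrees `≥ D`, it has no
extensions by modules living in degrees `< D`. -/
theorem ext_subsingleton {M N : GrMod (AW.deg ρ)} {D : ℤ} (hM : M.BoundedBelow D)
    (hN : N.BoundedAbove D) (i : ℕ) : Subsingleton (Abelian.Ext M N i) := by
  induction i generalizing M with
  | zero =>
    have := hom_subsingleton hM hN
    exact (Abelian.Ext.linearEquiv₀ (R := ℂ) (X := M) (Y := N)).toEquiv.subsingleton
  | succ i ih =>
    obtain ⟨Q, _, f, hQ, hf⟩ := exists_free_surjection hM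
    have : Subsingleton (Abelian.Ext (kerComplex f).X₁ N i) :=
      ih (hQ.sub _ (isHomogeneous_ker f))
    have : Subsingleton (Abelian.Ext (kerComplex f).X₂ N (i + 1)) :=
      Abelian.Ext.subsingleton_of_projective Q N i
    exact subsingleton_of_exact (k := ℂ) _ _ (range_deltaL (kerComplex_shortExact f hf) N i)

end GrMod

end Regular

/-! ### Multiplicities -/

section Multiplicities

variable {W : Type u} [Group W] {h : Type u} [AddCommGroup h] [Module ℂ h]
variable {ρ : Representation ℂ W h}

namespace GrMod

/-- The representation of `W` on the homogeneous part `M_i`. -/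
def degRep (M : GrMod (AW.deg ρ)) (i : ℤ) : Representation ℂ W (M.deg i) where
  toFun w := (M.actL (AW.mk 1 w)).restrict fun m hm => by
    have := M.smul_mem (AW.ofGroupAlgebra_mem ρ (MonoidAlgebra.of ℂ W w)) hm
    rw [zero_add] at this
    simpa [AW.ofGroupAlgebra] using this
  map_one' := by
    ext m
    change (1 : AW ρ) • (m : M) = m
    rw [one_smul]
  map_mul' v w := by
    ext m
    change (AW.mk 1 (v * w) : AW ρ) • (m : M) = (AW.mk 1 v : AW ρ) • (AW.mk 1 w : AW ρ) • (m : M)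
    rw [smul_smul]
    simp [AW.mk, SkewMonoidAlgebra.single_mul_single]

/-- The equivariant maps to `M_i`, as linear maps to `M` and as intertwining maps. -/
def homWEquivIntertwining (M : GrMod (AW.deg ρ)) {V : Type*} [AddCommGroup V] [Module ℂ V]
    (τ : Representation ℂ W V) (i : ℤ) :
    M.homW τ i ≃ₗ[ℂ] Representation.IntertwiningMap τ (M.degRep i) where
  toFun f := ⟨f.1.codRestrict (M.deg i) f.2.2, fun w => LinearMap.ext fun v =>
    Subtype.ext (f.2.1 w v)⟩
  invFun f := ⟨(M.deg i).subtype ∘ₗ f.toLinearMap, fun w v =>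
    congrArg Subtype.val (LinearMap.congr_fun (f.isIntertwining' w) v), fun v => (f v).2⟩
  map_add' _ _ := rfl
  map_smul' _ _ := rfl
  left_inv _ := rfl
  right_inv _ := rfl

/-- The homogeneous parts of `M` are finite-dimensional. -/
def LocFinite (M : GrMod (AW.deg ρ)) : Prop := ∀ i, FiniteDimensional ℂ (M.deg i)

theorem LocFinite.sub {M : GrMod (AW.deg ρ)} (hM : M.LocFinite) (N : Submodule (AW ρ) M)
    (hN : M.IsHomogeneous N) : (M.sub N hN).LocFinite := fun i => by
  have := hM i
  exact Module.Finite.of_injective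
    ((N.subtype.restrictScalars ℂ).restrict (p := (M.sub N hN).deg i) (q := M.deg i)
      fun _ hx => hx) fun x y hxy => by
        have h1 := congrArg Subtype.val hxy
        exact Subtype.ext (N.subtype_injective h1)

/-- The map on homogeneous parts induced by a morphism. -/
def linDeg {M N : GrMod (AW.deg ρ)} (f : M ⟶ N) (i : ℤ) : M.deg i →ₗ[ℂ] N.deg i :=
  ((lin f).restrictScalars ℂ).restrict fun _ hm => lin_mem f hm

theorem linDeg_surjective {M N : GrMod (AW.deg ρ)} {f : M ⟶ N}
    (hf : Function.Surjective (lin f)) (i : ℤ) : Function.Surjective (linDeg f i) := by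
  rintro ⟨y, hy⟩
  obtain ⟨x, hx, rfl⟩ := exists_deg_lift hf hy
  exact ⟨⟨x, hx⟩, rfl⟩

theorem LocFinite.of_surjective {M N : GrMod (AW.deg ρ)} (hM : M.LocFinite) (f : M ⟶ N)
    (hf : Function.Surjective (lin f)) : N.LocFinite := fun i => by
  have := hM i
  exact Module.Finite.of_surjective _ (linDeg_surjective hf i)

theorem LocFinite.shift {M : GrMod (AW.deg ρ)} (hM : M.LocFinite) (d : ℤ) :
    (M.shift d).LocFinite := fun i => hM (i - d)

/-- A nonzero representation of a finite group receives a nonzero map from an irreducible one. -/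
theorem exists_irr_hom [Finite W] {V : Type*} [AddCommGroup V] [Module ℂ V]
    [FiniteDimensional ℂ V] [Nontrivial V] (τ : Representation ℂ W V) :
    ∃ (χ : Irr W) (f : Representation.IntertwiningMap χ.L.rep τ), f ≠ 0 := by
  have : NeZero (Nat.card W : ℂ) := ⟨Nat.cast_ne_zero.2 Nat.card_pos.ne'⟩
  have : Nontrivial τ.asModule := ‹Nontrivial V›
  obtain ⟨N, hN⟩ := IsSemisimpleModule.exists_simple_submodule (MonoidAlgebra ℂ W) τ.asModule
  let U := Subrepresentation.ofSubmodule' N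
  have hU : FiniteDimensional ℂ U.toSubmodule := inferInstance
  -- `IrrRep` wants its space in `Type`, so the simple subrepresentation is moved to some `ℂⁿ`
  let b := (Module.finBasis ℂ U.toSubmodule).equivFun
  let σ : Representation ℂ W (Fin (Module.finrank ℂ U.toSubmodule) → ℂ) :=
    { toFun w := b.toLinearMap ∘ₗ U.toRepresentation w ∘ₗ b.symm.toLinearMap
      map_one' := by ext; simp
      map_mul' v w := by ext; simp }
  let j : Representation.IntertwiningMap σ τ :=
    ⟨U.toSubmodule.subtype ∘ₗ b.symm.toLinearMap, fun w => LinearMap.ext fun x => by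
      change ((b.symm (b (U.toRepresentation w (b.symm x))) : U.toSubmodule) : V) = _
      rw [b.symm_apply_apply]
      rfl⟩
  have hj : Function.Injective j := Subtype.val_injective.comp b.symm.injective
  let j' := Representation.IntertwiningMap.equivLinearMapAsModule σ τ j
  have hj' : Function.Injective j' := hj
  have hr : LinearMap.range j' = N := by
    apply le_antisymm
    · rintro _ ⟨x, rfl⟩
      exact (b.symm x).2
    · intro y hy
      refine ⟨b ⟨y, hy⟩, ?_⟩
      change ((b.symm (b ⟨y, hy⟩) : U.toSubmodule) : V) = y
      rw [b.symm_apply_apply]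
  have hs : IsSimpleModule (MonoidAlgebra ℂ W) σ.asModule := by
    have : IsSimpleModule (MonoidAlgebra ℂ W) (LinearMap.range j') := hr ▸ hN
    exact IsSimpleModule.congr (LinearEquiv.ofInjective j' hj')
  have hirr : σ.IsIrreducible :=
    (Representation.irreducible_iff_isSimpleModule_asModule σ).2 hs
  let X : IrrRep W := ⟨_, σ, hirr⟩
  obtain ⟨e⟩ : Nonempty
      ((Irr.L (Quotient.mk (IrrRep.setoid W) X)).rep.Equiv X.rep) :=
    Quotient.exact (Quotient.out_eq (Quotient.mk (IrrRep.setoid W) X))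
  refine ⟨Quotient.mk (IrrRep.setoid W) X, j.comp e.toIntertwiningMap, fun h0 => ?_⟩
  have hnt : Nontrivial (Fin (Module.finrank ℂ U.toSubmodule) → ℂ) :=
    IsSimpleModule.nontrivial (MonoidAlgebra ℂ W) σ.asModule
  obtain ⟨x, hx⟩ := exists_ne (0 : Fin (Module.finrank ℂ U.toSubmodule) → ℂ)
  refine hx (hj ?_)
  have h1 := DFunLike.congr_fun h0 (e.symm x)
  change j (e (e.symm x)) = 0 at h1
  rw [map_zero]
  exact (congrArg j (e.apply_symm_apply x)).symm.trans h1

variable [Finite W]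

/-- The idempotent `e_χ` as an element of `A_W`. -/
def idemA (ρ : Representation ℂ W h) (χ : Irr W) : AW ρ := AW.ofGroupAlgebra ρ χ.idem

theorem idem_mul_self (χ : Irr W) : χ.idem * χ.idem = χ.idem :=
  χ.exists_idempotent.choose_spec.1.eq

theorem idemA_mul_self (χ : Irr W) : idemA ρ χ * idemA ρ χ = idemA ρ χ := by
  rw [idemA, ← map_mul, idem_mul_self]

theorem idemA_mem (χ : Irr W) : idemA ρ χ ∈ AW.deg ρ 0 := AW.ofGroupAlgebra_mem ρ _

/-- The subspace `e_χ M_i`. -/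
def eDeg (M : GrMod (AW.deg ρ)) (χ : Irr W) (i : ℤ) : Submodule ℂ M where
  carrier := {x | x ∈ M.deg i ∧ idemA ρ χ • x = x}
  add_mem' hx hy := ⟨Submodule.add_mem _ hx.1 hy.1, by rw [smul_add, hx.2, hy.2]⟩
  zero_mem' := ⟨Submodule.zero_mem _, smul_zero _⟩
  smul_mem' c x hx := ⟨Submodule.smul_mem _ c hx.1, by rw [smul_comm, hx.2]⟩

theorem idemA_smul_mem (M : GrMod (AW.deg ρ)) (χ : Irr W) {i : ℤ} {x : M} (hx : x ∈ M.deg i) :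
    idemA ρ χ • x ∈ M.eDeg χ i := by
  refine ⟨?_, by rw [smul_smul, idemA_mul_self]⟩
  have := M.smul_mem (idemA_mem χ) hx
  rwa [zero_add] at this

/-- The dimension of `e_χ M_i`, which by `finrank_homW` is the multiplicity of `L_χ` in `M_i`. -/
def mdim (M : GrMod (AW.deg ρ)) (χ : Irr W) (i : ℤ) : ℕ := Module.finrank ℂ (M.eDeg χ i)

/-- A realization of `L_χ` as a left ideal of the group algebra. -/
def idealEquiv (χ : Irr W) :
    χ.L.rep.asModule ≃ₗ[MonoidAlgebra ℂ W] Ideal.span {χ.idem} :=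
  χ.exists_idempotent.choose_spec.2.some

theorem mul_idem {χ : Irr W} {x : MonoidAlgebra ℂ W} (hx : x ∈ Ideal.span {χ.idem}) :
    x * χ.idem = x := by
  obtain ⟨y, rfl⟩ := Ideal.mem_span_singleton'.1 hx
  rw [mul_assoc, idem_mul_self]

/-- The vector of `L_χ` which corresponds to the idempotent `e_χ`. -/
def idemVec (χ : Irr W) : χ.L.rep.asModule :=
  (idealEquiv χ).symm ⟨χ.idem, Ideal.mem_span_singleton_self _⟩

theorem idem_smul_idemVec (χ : Irr W) : χ.idem • idemVec χ = idemVec χ := by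
  rw [idemVec, ← map_smul]
  congr 1
  exact Subtype.ext (idem_mul_self χ)

theorem smul_idemVec (χ : Irr W) (v : χ.L.rep.asModule) :
    ((idealEquiv χ v : MonoidAlgebra ℂ W)) • idemVec χ = v := by
  rw [idemVec, ← map_smul, LinearEquiv.symm_apply_eq]
  exact Subtype.ext (mul_idem (idealEquiv χ v).2)

omit [Finite W] in
theorem homW_apply_smul {M : GrMod (AW.deg ρ)} {V : Type*} [AddCommGroup V] [Module ℂ V]
    {τ : Representation ℂ W V} {i : ℤ} (f : M.homW τ i) (x : MonoidAlgebra ℂ W)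
    (v : τ.asModule) : f.1 (τ.asModuleEquiv (x • v)) =
      AW.ofGroupAlgebra ρ x • f.1 (τ.asModuleEquiv v) := by
  rw [Representation.asModuleEquiv_map_smul]
  induction x using MonoidAlgebra.induction_linear with
  | zero => simp
  | add x y hx hy => simp only [map_add, LinearMap.add_apply, hx, hy, add_smul]
  | single w c =>
    rw [Representation.asAlgebraHom_single, AW.ofGroupAlgebra, MonoidAlgebra.lift_single,
      LinearMap.smul_apply, map_smul, f.2.1]
    exact (smul_assoc c _ _).symm

/-- The equivariant maps `L_χ → M_i` are determined by the image of the vector corresponding to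
`e_χ`. -/
def homWEquivEDeg (M : GrMod (AW.deg ρ)) (χ : Irr W) (i : ℤ) :
    M.homW χ.L.rep i ≃ₗ[ℂ] M.eDeg χ i where
  toFun f := ⟨f.1 (χ.L.rep.asModuleEquiv (idemVec χ)), f.2.2 _, by
    rw [idemA, ← homW_apply_smul, idem_smul_idemVec]⟩
  map_add' _ _ := rfl
  map_smul' _ _ := rfl
  invFun x :=
    ⟨{ toFun v := AW.ofGroupAlgebra ρ (idealEquiv χ (χ.L.rep.asModuleEquiv.symm v)) • (x : M)
       map_add' v w := by simp only [map_add, Submodule.coe_add, add_smul]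
       map_smul' c v := by
        rw [Representation.asModuleEquiv_symm_map_smul, map_smul]
        change AW.ofGroupAlgebra ρ (algebraMap ℂ _ c * _) • (x : M) = _
        rw [map_mul, AlgHom.commutes, ← Algebra.smul_def, smul_assoc]
        rfl },
      fun w v => by
        change AW.ofGroupAlgebra ρ (idealEquiv χ (χ.L.rep.asModuleEquiv.symm (χ.L.rep w v))) •
          (x : M) = _
        rw [Representation.asModuleEquiv_symm_map_rho, map_smul]
        change AW.ofGroupAlgebra ρ (MonoidAlgebra.of ℂ W w * _) • (x : M) = _
        rw [map_mul, mul_smul]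
        congr 1
        simp [AW.ofGroupAlgebra],
      fun v => by
        have := M.smul_mem (AW.ofGroupAlgebra_mem ρ
          (idealEquiv χ (χ.L.rep.asModuleEquiv.symm v))) x.2.1
        rwa [zero_add] at this⟩
  left_inv f := by
    refine Subtype.ext (LinearMap.ext fun v => ?_)
    change AW.ofGroupAlgebra ρ (idealEquiv χ (χ.L.rep.asModuleEquiv.symm v)) •
      f.1 (χ.L.rep.asModuleEquiv (idemVec χ)) = f.1 v
    rw [← homW_apply_smul, smul_idemVec, LinearEquiv.apply_symm_apply]
  right_inv x := by
    refine Subtype.ext ?_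
    change AW.ofGroupAlgebra ρ (idealEquiv χ (χ.L.rep.asModuleEquiv.symm
      (χ.L.rep.asModuleEquiv (idemVec χ)))) • (x : M) = x
    rw [LinearEquiv.symm_apply_apply, idemVec, LinearEquiv.apply_symm_apply]
    exact x.2.2

theorem finrank_homW (M : GrMod (AW.deg ρ)) (χ : Irr W) (i : ℤ) :
    Module.finrank ℂ (M.homW χ.L.rep i) = M.mdim χ i :=
  (M.homWEquivEDeg χ i).finrank_eq

theorem mdim_shift (M : GrMod (AW.deg ρ)) (d : ℤ) (χ : Irr W) (i : ℤ) :
    (M.shift d).mdim χ i = M.mdim χ (i - d) := rfl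

theorem mdim_eq_zero {M : GrMod (AW.deg ρ)} {i : ℤ} (hM : M.deg i = ⊥) (χ : Irr W) :
    M.mdim χ i = 0 := by
  have : M.eDeg χ i = ⊥ := eq_bot_iff.2 fun x hx => hM ▸ hx.1
  rw [mdim, this, finrank_bot]

theorem exists_eDeg_ne_zero {M : GrMod (AW.deg ρ)} (hM : M.LocFinite) {i : ℤ}
    (hi : M.deg i ≠ ⊥) : ∃ (χ : Irr W), ∃ x ∈ M.eDeg χ i, x ≠ 0 := by
  have := hM i
  have : Nontrivial (M.deg i) := Submodule.nontrivial_iff_ne_bot.2 hi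
  obtain ⟨χ, f, hf⟩ := exists_irr_hom (M.degRep i)
  let g := M.homWEquivEDeg χ i ((M.homWEquivIntertwining _ _).symm f)
  refine ⟨χ, g, g.2, fun h0 => hf ?_⟩
  have : g = 0 := Subtype.ext h0
  simpa [g] using this

theorem mdim_add {M N : GrMod (AW.deg ρ)} (hM : M.LocFinite) (f : M ⟶ N)
    (hf : Function.Surjective (lin f)) (χ : Irr W) (i : ℤ) :
    M.mdim χ i = (M.sub _ (isHomogeneous_ker f)).mdim χ i + N.mdim χ i := by
  have := hM i
  have : FiniteDimensional ℂ (M.eDeg χ i) :=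
    Submodule.finiteDimensional_of_le (S₂ := M.deg i) fun _ hx => hx.1
  let F : M.eDeg χ i →ₗ[ℂ] N.eDeg χ i := ((lin f).restrictScalars ℂ).restrict fun x hx =>
    ⟨lin_mem f hx.1, by
      change idemA ρ χ • lin f x = lin f x
      rw [← map_smul, hx.2]⟩
  have hF : Function.Surjective F := by
    rintro ⟨y, hy, hey⟩
    obtain ⟨x, hx, rfl⟩ := exists_deg_lift hf hy
    refine ⟨⟨_, M.idemA_smul_mem χ hx⟩, Subtype.ext ?_⟩
    change lin f (idemA ρ χ • x) = lin f x
    rw [map_smul, hey]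
  let G : LinearMap.ker F ≃ₗ[ℂ] (M.sub _ (isHomogeneous_ker f)).eDeg χ i :=
    { toFun x := ⟨⟨x.1.1, congrArg Subtype.val x.2⟩, x.1.2.1, Subtype.ext x.1.2.2⟩
      map_add' _ _ := rfl
      map_smul' _ _ := rfl
      invFun y := ⟨⟨y.1.1, y.2.1, congrArg Subtype.val y.2.2⟩, Subtype.ext y.1.2⟩
      left_inv _ := rfl
      right_inv _ := rfl }
  rw [mdim, ← LinearMap.finrank_range_add_finrank_ker F, LinearMap.range_eq_top.2 hF,
    finrank_top, G.finrank_eq, add_comm]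
  rfl

end GrMod
end Multiplicities

/-! ### The projective modules `P_χ` -/

section ProjectiveModules

variable {W : Type u} [Group W] {h : Type u} [AddCommGroup h] [Module ℂ h]

section Finiteness

variable (ρ : Representation ℂ W h)

theorem Sym.finiteDimensional_deg [FiniteDimensional ℂ h] (d : ℤ) :
    FiniteDimensional ℂ (Sym.deg ρ d) := by
  by_cases hd : ∃ n : ℕ, d = 2 * n
  · obtain ⟨n, rfl⟩ := hd
    rw [Sym.deg_two_mul, Sym.homog]
    exact Module.Finite.iff_fg.2 ((Module.Finite.iff_fg.1 inferInstance).pow n)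
  · have : Sym.deg ρ d = ⊥ := eq_bot_iff.2 (iSup₂_le fun n hn => (hd ⟨n, hn⟩).elim)
    rw [this]
    infer_instance

theorem AW.finiteDimensional_deg [Finite W] [FiniteDimensional ℂ h] (d : ℤ) :
    FiniteDimensional ℂ (AW.deg ρ d) := by
  have := Sym.finiteDimensional_deg ρ d
  let F : AW.deg ρ d →ₗ[ℂ] W → Sym.deg ρ d :=
    { toFun a w := ⟨a.1.coeff w, a.2 w⟩
      map_add' a b := by
        ext w
        exact congrFun (congrArg DFunLike.coe (SkewMonoidAlgebra.coeff_add a.1 b.1)) w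
      map_smul' c a := by
        ext w
        exact congrFun (congrArg DFunLike.coe (SkewMonoidAlgebra.coeff_smul c a.1)) w }
  refine Module.Finite.of_injective F fun a b hab => Subtype.ext ?_
  ext w
  exact congrArg Subtype.val (congrFun hab w)

theorem AW.deg_odd {d : ℤ} (hd : ∀ n : ℕ, d ≠ 2 * n) : AW.deg ρ d = ⊥ := by
  have h0 : Sym.deg ρ d = ⊥ := eq_bot_iff.2 (iSup₂_le fun n hn => (hd n hn).elim)
  rw [eq_bot_iff]
  intro a ha
  rw [Submodule.mem_bot]
  ext w
  have := ha w
  rwa [h0, Submodule.mem_bot] at this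

/-- The part of degree `0` of `A_W` is the group algebra. -/
theorem AW.exists_ofGroupAlgebra {a : AW ρ} (ha : a ∈ AW.deg ρ 0) :
    ∃ x, AW.ofGroupAlgebra ρ x = a := by
  have h0 : ∀ w, ∃ c : ℂ, algebraMap ℂ (Sym ρ) c = a.coeff w := by
    intro w
    have h1 := ha w
    have h2 := Sym.deg_two_mul ρ 0
    rw [Nat.cast_zero, mul_zero] at h2
    rw [h2, Sym.homog, pow_zero] at h1
    exact Submodule.mem_one.1 h1
  choose c hc using h0
  refine ⟨∑ w ∈ a.support, MonoidAlgebra.single w (c w), ?_⟩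
  rw [map_sum]
  conv_rhs => rw [← SkewMonoidAlgebra.sum_single a, SkewMonoidAlgebra.sum_def]
  refine Finset.sum_congr rfl fun w _ => ?_
  rw [AW.ofGroupAlgebra, MonoidAlgebra.lift_single]
  change c w • AW.mk 1 w = _
  rw [AW.mk, SkewMonoidAlgebra.smul_single, ← hc, Algebra.algebraMap_eq_smul_one]

end Finiteness

variable {ρ : Representation ℂ W h} [Finite W]

namespace GrMod

variable (ρ) in
/-- The inclusion of `P_χ` in `A_W`. -/
def projIncl (χ : Irr W) : projCover ρ χ →ₗ[AW ρ] AW ρ :=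
  (Submodule.span (AW ρ) {AW.ofGroupAlgebra ρ χ.idem}).subtype

theorem projIncl_injective (χ : Irr W) : Function.Injective (projIncl ρ χ) :=
  Submodule.subtype_injective _

theorem projIncl_mem {χ : Irr W} {i : ℤ} {x : projCover ρ χ} :
    projIncl ρ χ x ∈ AW.deg ρ i ↔ x ∈ (projCover ρ χ).deg i := Iff.rfl

variable (ρ) in
/-- The generator `e_χ` of `P_χ`. -/
def projGen (χ : Irr W) : projCover ρ χ := ⟨idemA ρ χ, Submodule.subset_span rfl⟩

theorem projIncl_projGen (χ : Irr W) : projIncl ρ χ (projGen ρ χ) = idemA ρ χ := rfl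

theorem projGen_mem (χ : Irr W) : projGen ρ χ ∈ (projCover ρ χ).eDeg χ 0 :=
  ⟨idemA_mem χ, projIncl_injective χ (idemA_mul_self χ)⟩

theorem projIncl_smul_projGen {χ : Irr W} (x : projCover ρ χ) :
    projIncl ρ χ x • projGen ρ χ = x := by
  apply projIncl_injective χ
  rw [map_smul, projIncl_projGen, smul_eq_mul]
  obtain ⟨b, hb⟩ := Submodule.mem_span_singleton.1 (show projIncl ρ χ x ∈
    Submodule.span (AW ρ) {AW.ofGroupAlgebra ρ χ.idem} from x.2)
  rw [← hb]
  change b * idemA ρ χ * idemA ρ χ = b * idemA ρ χ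
  rw [mul_assoc, idemA_mul_self]

theorem projCover_locFinite [FiniteDimensional ℂ h] (χ : Irr W) : (projCover ρ χ).LocFinite := by
  have : (AW.regular ρ).LocFinite := AW.finiteDimensional_deg ρ
  exact this.sub _ _

theorem projCover_boundedBelow (χ : Irr W) : (projCover ρ χ).BoundedBelow 0 := by
  have : (AW.regular ρ).BoundedBelow 0 := fun i hi => AW.deg_neg ρ hi
  exact this.sub _ _

/-- `M` vanishes in odd degrees. -/
def IsEven (M : GrMod (AW.deg ρ)) : Prop := ∀ i, i % 2 ≠ 0 → M.deg i = ⊥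

theorem projCover_isEven (χ : Irr W) : (projCover ρ χ).IsEven := by
  intro i hi
  rw [eq_bot_iff]
  intro x hx
  apply projIncl_injective χ
  have := projIncl_mem.2 hx
  rw [AW.deg_odd ρ (by omega)] at this
  rw [map_zero]
  exact this

omit [Finite W] in
theorem IsEven.of_surjective {M N : GrMod (AW.deg ρ)} (hM : M.IsEven) (f : M ⟶ N)
    (hf : Function.Surjective (lin f)) : N.IsEven := by
  intro i hi
  rw [eq_bot_iff]
  intro y hy
  obtain ⟨x, hx, rfl⟩ := exists_deg_lift hf hy
  rw [hM i hi, Submodule.mem_bot] at hx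
  rw [hx, map_zero]
  exact Submodule.zero_mem _

/-- The generator of the shift `P_χ⟨d⟩`. -/
theorem projGen_mem_shift (χ : Irr W) (d : ℤ) :
    projGen ρ χ ∈ ((projCover ρ χ).shift d).eDeg χ d := by
  change _ ∧ _
  refine ⟨?_, (projGen_mem χ).2⟩
  change projGen ρ χ ∈ (projCover ρ χ).deg (d - d)
  rw [sub_self]
  exact (projGen_mem χ).1

/-- The morphism `P_χ⟨d⟩ → M` which sends `e_χ` to a given element of `e_χ M_d`. -/
def projDesc {M : GrMod (AW.deg ρ)} {χ : Irr W} {d : ℤ} (x : M.eDeg χ d) :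
    (projCover ρ χ).shift d ⟶ M :=
  mkHom (((LinearMap.toSpanSingleton (AW ρ) M x.1) ∘ₗ projIncl ρ χ :
      projCover ρ χ →ₗ[AW ρ] M) : ((projCover ρ χ).shift d).carrier →ₗ[AW ρ] M) fun i m hm => by
    have h1 : projIncl ρ χ m ∈ AW.deg ρ (i - d) := projIncl_mem.2 hm
    have h2 := M.smul_mem h1 x.2.1
    rwa [sub_add_cancel] at h2

theorem projDesc_projGen {M : GrMod (AW.deg ρ)} {χ : Irr W} {d : ℤ} (x : M.eDeg χ d) :
    lin (projDesc x) (projGen ρ χ) = x := x.2.2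

theorem lin_proj_apply {M : GrMod (AW.deg ρ)} {χ : Irr W} {d : ℤ}
    (f : (projCover ρ χ).shift d ⟶ M) (m : projCover ρ χ) :
    lin f m = projIncl ρ χ m • lin f (projGen ρ χ) := by
  conv_lhs => rw [← projIncl_smul_projGen m]
  exact map_smul (lin f) _ _

/-- Morphisms `P_χ⟨d⟩ → M` correspond to elements of `e_χ M_d`. -/
def projHomEquiv (M : GrMod (AW.deg ρ)) (χ : Irr W) (d : ℤ) :
    ((projCover ρ χ).shift d ⟶ M) ≃ₗ[ℂ] M.eDeg χ d where
  toFun f := ⟨lin f (projGen ρ χ), lin_mem f (projGen_mem_shift χ d).1, by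
    have h1 : lin f (idemA ρ χ • projGen ρ χ) = lin f (projGen ρ χ) :=
      congrArg (lin f) (projGen_mem χ).2
    exact (map_smul (lin f) (idemA ρ χ) (projGen ρ χ)).symm.trans h1⟩
  map_add' _ _ := rfl
  map_smul' _ _ := rfl
  invFun x := projDesc x
  left_inv f := hom_ext fun m => (lin_proj_apply f m).symm
  right_inv x := Subtype.ext (projDesc_projGen x)

theorem finrank_projHom (M : GrMod (AW.deg ρ)) (χ : Irr W) (d : ℤ) :
    Module.finrank ℂ ((projCover ρ χ).shift d ⟶ M) = M.mdim χ d :=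
  (projHomEquiv M χ d).finrank_eq

instance projCover_projective (χ : Irr W) (d : ℤ) : Projective ((projCover ρ χ).shift d) where
  factors {N M} f e _ := by
    have hf := (projHomEquiv M χ d f).2
    obtain ⟨x, hx, hxf⟩ := exists_deg_lift (surjective_of_epi e) hf.1
    have hxe : lin e (idemA ρ χ • x) = lin f (projGen ρ χ) := by
      rw [map_smul, hxf]
      exact hf.2
    refine ⟨projDesc ⟨_, N.idemA_smul_mem χ hx⟩, hom_ext fun m => ?_⟩
    rw [lin_proj_apply f m, ← hxe, ← map_smul]
    rfl

end GrMod

end ProjectiveModules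

/-! ### The lowest degree of `P_χ`, and characters -/

section LowestDegree

variable {W : Type u} [Group W] {h : Type u} [AddCommGroup h] [Module ℂ h]
variable {ρ : Representation ℂ W h}

theorem AW.coeff_ofGroupAlgebra (x : MonoidAlgebra ℂ W) (w : W) :
    (AW.ofGroupAlgebra ρ x).coeff w = algebraMap ℂ (Sym ρ) (x.coeff w) := by
  classical
  induction x using MonoidAlgebra.induction_linear with
  | zero => rw [map_zero, SkewMonoidAlgebra.coeff_zero]; exact (map_zero _).symm
  | add x y hx hy =>
    rw [map_add, SkewMonoidAlgebra.coeff_add]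
    change _ + _ = algebraMap ℂ (Sym ρ) (x.coeff w + y.coeff w)
    rw [hx, hy, map_add]
  | single v c =>
    rw [AW.ofGroupAlgebra, MonoidAlgebra.lift_single]
    change (c • AW.mk (1 : Sym ρ) v).coeff w = _
    rw [AW.mk, SkewMonoidAlgebra.smul_single, SkewMonoidAlgebra.coeff_single_apply,
      MonoidAlgebra.coeff_single, Finsupp.single_apply]
    split_ifs
    · rw [Algebra.algebraMap_eq_smul_one]
    · rw [map_zero]

instance : IsDomain (Sym ρ) := inferInstanceAs (IsDomain (SymmetricAlgebra ℂ h))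

theorem AW.ofGroupAlgebra_injective : Function.Injective (AW.ofGroupAlgebra ρ) := by
  intro x y hxy
  ext w
  have := AW.coeff_ofGroupAlgebra (ρ := ρ) x w
  rw [hxy, AW.coeff_ofGroupAlgebra] at this
  exact ((algebraMap ℂ (Sym ρ)).injective this).symm

variable [Finite W]

namespace GrMod

/-- The map `L_χ → M_i` which sends the vector corresponding to `e_χ` to a given element of
`e_χ M_i`. -/
def irrHom {M : GrMod (AW.deg ρ)} {χ : Irr W} {i : ℤ} (x : M.eDeg χ i) :
    Representation.IntertwiningMap χ.L.rep (M.degRep i) :=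
  M.homWEquivIntertwining _ _ ((M.homWEquivEDeg χ i).symm x)

theorem irrHom_coe {M : GrMod (AW.deg ρ)} {χ : Irr W} {i : ℤ} (x : M.eDeg χ i)
    (v : χ.L.rep.asModule) : (irrHom x (χ.L.rep.asModuleEquiv v) : M) =
      AW.ofGroupAlgebra ρ (idealEquiv χ v) • (x : M) := rfl

theorem irrHom_idemVec {M : GrMod (AW.deg ρ)} {χ : Irr W} {i : ℤ} (x : M.eDeg χ i) :
    (irrHom x (χ.L.rep.asModuleEquiv (idemVec χ)) : M) = x := by
  rw [irrHom_coe, idemVec, LinearEquiv.apply_symm_apply]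
  exact x.2.2

theorem irrHom_injective {M : GrMod (AW.deg ρ)} {χ : Irr W} {i : ℤ} {x : M.eDeg χ i}
    (hx : (x : M) ≠ 0) : Function.Injective (irrHom x) := by
  rcases Representation.IsIrreducible.injective_or_eq_zero (irrHom x) with h | h
  · exact h
  · refine (hx ?_).elim
    rw [← irrHom_idemVec, h]
    rfl

theorem projGen_ne_zero (χ : Irr W) : projGen ρ χ ≠ 0 := by
  intro h0
  have h1 : idemA ρ χ = 0 := by rw [← projIncl_projGen, h0, map_zero]
  have h2 : χ.idem = 0 := AW.ofGroupAlgebra_injective (h1.trans (map_zero _).symm)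
  have : Nontrivial χ.L.rep.asModule := IsSimpleModule.nontrivial (MonoidAlgebra ℂ W) _
  obtain ⟨v, hv⟩ := exists_ne (0 : χ.L.rep.asModule)
  refine hv ((idealEquiv χ).injective (Subtype.ext ?_))
  have h3 := mul_idem (idealEquiv χ v).2
  rw [map_zero]
  exact h3.symm.trans ((congrArg _ h2).trans (mul_zero _))

theorem exists_irrHom_projGen {χ : Irr W} {x : projCover ρ χ} (hx : x ∈ (projCover ρ χ).deg 0) :
    ∃ v : χ.L.rep.asModule, AW.ofGroupAlgebra ρ (idealEquiv χ v) • projGen ρ χ = x := by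
  obtain ⟨y, hy⟩ := AW.exists_ofGroupAlgebra ρ (projIncl_mem.2 hx)
  refine ⟨y • idemVec χ, ?_⟩
  rw [map_smul, idemVec, LinearEquiv.apply_symm_apply]
  change AW.ofGroupAlgebra ρ (y * χ.idem) • _ = _
  rw [map_mul, mul_smul]
  have h1 : AW.ofGroupAlgebra ρ χ.idem • projGen ρ χ = projGen ρ χ := (projGen_mem χ).2
  rw [h1, hy]
  exact projIncl_smul_projGen x

variable (ρ) in
/-- The part of degree `0` of `P_χ` is `L_χ`. -/
def projZeroEquiv (χ : Irr W) : χ.L.rep.Equiv ((projCover ρ χ).degRep 0) :=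
  Representation.IntertwiningMap.ofBijective (irrHom ⟨projGen ρ χ, projGen_mem χ⟩)
    ⟨irrHom_injective (projGen_ne_zero χ), fun x => by
      obtain ⟨v, hv⟩ := exists_irrHom_projGen x.2
      exact ⟨χ.L.rep.asModuleEquiv v, Subtype.ext hv⟩⟩

/-- A morphism from `P_χ⟨d⟩` which does not kill the generator is injective on the lowest degree. -/
theorem lin_injOn_zero {M : GrMod (AW.deg ρ)} {χ : Irr W} {d : ℤ} (x : M.eDeg χ d)
    (hx : (x : M) ≠ 0) {m : projCover ρ χ} (hm : m ∈ (projCover ρ χ).deg 0)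
    (h0 : lin (projDesc x) m = 0) : m = 0 := by
  obtain ⟨v, rfl⟩ := exists_irrHom_projGen hm
  have h1 : lin (projDesc x) (AW.ofGroupAlgebra ρ (idealEquiv χ v) • projGen ρ χ) =
      (irrHom x (χ.L.rep.asModuleEquiv v) : M) := by
    rw [irrHom_coe]
    refine (map_smul (lin (projDesc x)) _ (projGen ρ χ)).trans ?_
    exact congrArg _ (projDesc_projGen x)
  rw [h1] at h0
  have h2 : χ.L.rep.asModuleEquiv v = 0 :=
    irrHom_injective hx (Subtype.ext (h0.trans (by rw [map_zero]; rfl)))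
  have h3 : v = 0 := χ.L.rep.asModuleEquiv.injective (h2.trans (map_zero _).symm)
  rw [h3, map_zero, Submodule.coe_zero, map_zero, zero_smul]

/-- Dimensions of equivariant maps are scalar products of characters. -/
theorem finrank_homW_char {M : GrMod (AW.deg ρ)} (hM : M.LocFinite) {V : Type*} [AddCommGroup V]
    [Module ℂ V] [FiniteDimensional ℂ V] (τ : Representation ℂ W V) (i : ℤ) [Fintype W] :
    (Module.finrank ℂ (M.homW τ i) : ℂ) =
      (Nat.card W : ℂ)⁻¹ * ∑ g : W, (M.degRep i).character g * τ.character g⁻¹ := by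
  have hc : (Nat.card W : ℂ) ≠ 0 := Nat.cast_ne_zero.2 Nat.card_pos.ne'
  have := invertibleOfNonzero hc
  have := hM i
  rw [Representation.card_inv_mul_sum_char_mul_char_eq_finrank,
    (M.homWEquivIntertwining _ _).finrank_eq]

theorem mdim_projCover_zero [FiniteDimensional ℂ h] (χ η : Irr W) [Decidable (η = χ)] :
    (projCover ρ χ).mdim η 0 = if η = χ then 1 else 0 := by
  classical
  have := Fintype.ofFinite W
  have hc : (Nat.card W : ℂ) ≠ 0 := Nat.cast_ne_zero.2 Nat.card_pos.ne'
  have := invertibleOfNonzero hc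
  have h1 := finrank_homW_char (projCover_locFinite (ρ := ρ) χ) η.L.rep 0
  rw [finrank_homW, ← Representation.char_iso (projZeroEquiv ρ χ),
    Representation.char_orthonormal] at h1
  by_cases hη : η = χ
  · subst hη
    rw [if_pos ⟨Representation.Equiv.refl _⟩] at h1
    rw [if_pos rfl]
    exact_mod_cast h1
  · rw [if_neg fun h => hη (Irr.eq_of_equiv h)] at h1
    rw [if_neg hη]
    exact_mod_cast h1

end GrMod

end LowestDegree

/-! ### The Euler-Poincaré pairing in terms of multiplicities -/

section Pairing

variable {W : Type u} [Group W] [Finite W] {h : Type u} [AddCommGroup h] [Module ℂ h]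
variable {ρ : Representation ℂ W h}

namespace GrMod

/-- The series `∑ₙ [M_{2n} : L_χ] tⁿ`. -/
def hilb (M : GrMod (AW.deg ρ)) (χ : Irr W) : PowerSeries ℚ :=
  PowerSeries.mk fun n => (M.mdim χ (2 * n) : ℚ)

/-- The series `∑ₙ [M_{-2n} : L_χ] tⁿ`. -/
def hilbNeg (M : GrMod (AW.deg ρ)) (χ : Irr W) : PowerSeries ℚ :=
  PowerSeries.mk fun n => (M.mdim χ (-(2 * n)) : ℚ)

/-- The pairing of the multiplicities of `E` in the degrees `0, -2, …, -2(B - 1)` with the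
coefficients of a vector of power series. -/
def multPairing (f : Irr W → PowerSeries ℚ) (B : ℕ) (E : GrMod (AW.deg ρ)) : ℚ :=
  ∑ ψ, ∑ n ∈ Finset.range B, PowerSeries.coeff n (f ψ) * (E.mdim ψ (-(2 * n)) : ℚ)

theorem multPairing_add {E N : GrMod (AW.deg ρ)} (hE : E.LocFinite) (g : E ⟶ N)
    (hg : Function.Surjective (lin g)) (f : Irr W → PowerSeries ℚ) (B : ℕ) :
    multPairing f B E = multPairing f B (E.sub _ (isHomogeneous_ker g)) + multPairing f B N := by
  simp only [multPairing, ← Finset.sum_add_distrib, mdim_add hE g hg]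
  refine Finset.sum_congr rfl fun ψ _ => Finset.sum_congr rfl fun n _ => ?_
  push_cast
  ring

/-- `Extⁱ(E, F)` is finite-dimensional and almost always zero, and the Euler characteristic is given
by the multiplicities of `E` in the degrees `0, -2, …, -2(B - 1)`. The vector `f` will be the product
of the series of multiplicities of `F` by the inverse of the matrix of multiplicities of the `P_χ`. -/
def HasMultEuler (F : GrMod (AW.deg ρ)) (f : Irr W → PowerSeries ℚ) (B : ℕ)
    (E : GrMod (AW.deg ρ)) : Prop :=
  ExtFinite ℂ E F ∧ (euler ℂ E F : ℚ) = multPairing f B E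

variable {F : GrMod (AW.deg ρ)}

omit [Finite W] in
theorem BoundedBelow.mono {E : GrMod (AW.deg ρ)} {D D' : ℤ} (hE : E.BoundedBelow D)
    (h : D' ≤ D) : E.BoundedBelow D' := fun i hi => hE i (by omega)

theorem hasMultEuler_proj (hF : F.LocFinite) (hFe : F.IsEven) (hFb : F.BoundedAbove 1)
    {f : Irr W → PowerSeries ℚ}
    (hf : ∀ χ, ∑ ψ, f ψ * (projCover ρ χ).hilb ψ = F.hilbNeg χ) {B : ℕ} (χ : Irr W) {d : ℤ}
    (hd : -(2 * B) < d) : HasMultEuler F f B ((projCover ρ χ).shift d) := by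
  have := hF d
  have : FiniteDimensional ℂ (F.eDeg χ d) :=
    Submodule.finiteDimensional_of_le (S₂ := F.deg d) fun _ hx => hx.1
  have : FiniteDimensional ℂ ((projCover ρ χ).shift d ⟶ F) :=
    Module.Finite.equiv (projHomEquiv F χ d).symm
  refine ⟨extFinite_of_projective _ _, ?_⟩
  rw [euler_of_projective, finrank_projHom]
  simp only [multPairing, mdim_shift]
  rcases lt_or_ge 0 d with h0 | h0
  · rw [mdim_eq_zero (hFb d (by omega))]
    refine (Finset.sum_eq_zero fun ψ _ => Finset.sum_eq_zero fun n _ => ?_).symm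
    rw [mdim_eq_zero (projCover_boundedBelow χ _ (by omega)), Nat.cast_zero, mul_zero]
  by_cases hd2 : d % 2 = 0
  · obtain ⟨a, rfl⟩ : ∃ a : ℕ, d = -(2 * a) := ⟨(-d / 2).toNat, by omega⟩
    have h1 := congrArg (PowerSeries.coeff a) (hf χ)
    simp only [hilbNeg, hilb, map_sum, PowerSeries.coeff_mul, PowerSeries.coeff_mk] at h1
    rw [Int.cast_natCast, ← h1]
    refine Finset.sum_congr rfl fun ψ _ => ?_
    rw [Finset.Nat.sum_antidiagonal_eq_sum_range_succ_mk]
    refine (Finset.sum_congr rfl fun n hn => ?_).trans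
      (Finset.sum_subset (Finset.range_subset_range.2 (by omega)) fun n _ hn => ?_)
    · have : n ≤ a := by simpa [Nat.lt_succ_iff] using hn
      rw [show -(2 * (n : ℤ)) - -(2 * a) = 2 * ((a - n : ℕ) : ℤ) by push_cast [this]; ring]
    · rw [Finset.mem_range] at hn
      rw [mdim_eq_zero (projCover_boundedBelow χ _ (by omega)), Nat.cast_zero, mul_zero]
  · rw [mdim_eq_zero (hFe d hd2)]
    refine (Finset.sum_eq_zero fun ψ _ => Finset.sum_eq_zero fun n _ => ?_).symm
    rw [mdim_eq_zero (projCover_isEven χ _ (by omega)), Nat.cast_zero, mul_zero]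

theorem HasMultEuler.middle {f : Irr W → PowerSeries ℚ} {B : ℕ} {E N : GrMod (AW.deg ρ)}
    (hE : E.LocFinite) (g : E ⟶ N) (hg : Function.Surjective (lin g))
    (h1 : HasMultEuler F f B (E.sub _ (isHomogeneous_ker g))) (h3 : HasMultEuler F f B N) :
    HasMultEuler F f B E := by
  have hS := kerComplex_shortExact g hg
  refine ⟨ExtFinite.middle hS h1.1 h3.1, ?_⟩
  have h2 : euler ℂ E F = euler ℂ (E.sub _ (isHomogeneous_ker g)) F + euler ℂ N F :=
    euler_middle hS h1.1 h3.1
  rw [h2, Int.cast_add, h1.2, h3.2, multPairing_add hE g hg]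

theorem HasMultEuler.right {f : Irr W → PowerSeries ℚ} {B : ℕ} {E N : GrMod (AW.deg ρ)}
    (hE : E.LocFinite) (g : E ⟶ N) (hg : Function.Surjective (lin g))
    (h1 : HasMultEuler F f B (E.sub _ (isHomogeneous_ker g))) (h2 : HasMultEuler F f B E) :
    HasMultEuler F f B N := by
  have hS := kerComplex_shortExact g hg
  have h3 : ExtFinite ℂ N F := ExtFinite.right hS h1.1 h2.1
  refine ⟨h3, ?_⟩
  have h4 : euler ℂ E F = euler ℂ (E.sub _ (isHomogeneous_ker g)) F + euler ℂ N F :=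
    euler_middle hS h1.1 h3
  have h5 := h2.2
  rw [h4, Int.cast_add, h1.2, multPairing_add hE g hg] at h5
  exact add_left_cancel h5

variable [FiniteDimensional ℂ h]

/-- Every module which is bounded below is assembled from shifts of the modules `P_χ`, up to modules
living in positive degrees: a nonzero vector of `e_χ E_D`, for `D` the lowest degree, gives a morphism
`P_χ⟨D⟩ → E` with a smaller cokernel, and with a kernel living in degrees `> D`. -/
theorem hasMultEuler (hF : F.LocFinite) (hFe : F.IsEven) (hFb : F.BoundedAbove 1)
    {f : Irr W → PowerSeries ℚ}
    (hf : ∀ χ, ∑ ψ, f ψ * (projCover ρ χ).hilb ψ = F.hilbNeg χ) {B : ℕ} (N : ℕ) :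
    ∀ D : ℤ, 1 ≤ D + N → -(2 * B) < D → ∀ E : GrMod (AW.deg ρ), E.LocFinite →
      E.BoundedBelow D → HasMultEuler F f B E := by
  -- `N` bounds the number of degrees `≤ 0` in which `E` lives; for a given `N` the induction is on
  -- the dimension of the lowest part
  induction N with
  | zero =>
    intro D hD hDB E hE hEb
    have hsub := ext_subsingleton (hEb.mono (D' := 1) (by omega)) hFb
    refine ⟨extFinite_of_subsingleton hsub, ?_⟩
    rw [euler_of_subsingleton hsub, Int.cast_zero]
    refine (Finset.sum_eq_zero fun ψ _ => Finset.sum_eq_zero fun n _ => ?_).symm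
    rw [mdim_eq_zero (hEb _ (by omega)), Nat.cast_zero, mul_zero]
  | succ N ih =>
    intro D hD hDB E hE hEb
    generalize hr : Module.finrank ℂ (E.deg D) = r
    induction r using Nat.strong_induction_on generalizing E with
    | _ r ihr =>
      by_cases h0 : E.deg D = ⊥
      · refine ih (D + 1) (by push_cast at hD; omega) (by omega) E hE fun i hi => ?_
        rcases lt_or_eq_of_le (Int.lt_add_one_iff.1 hi) with hi | rfl
        · exact hEb i hi
        · exact h0
      · obtain ⟨χ, x, hx, hx0⟩ := exists_eDeg_ne_zero hE h0
        let φ := projDesc (⟨x, hx⟩ : E.eDeg χ D)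
        have hφ : lin φ (projGen ρ χ) = x := projDesc_projGen _
        let q := quotπ E _ (isHomogeneous_range φ)
        have hq : Function.Surjective (lin q) := Submodule.mkQ_surjective _
        have hqφ : ∀ m, lin φ m ∈ LinearMap.ker (lin q) := fun m =>
          (Submodule.Quotient.mk_eq_zero _).2 ⟨m, rfl⟩
        let φ' := subLift _ (isHomogeneous_ker q) φ hqφ
        have hφ' : Function.Surjective (lin φ') := by
          rintro ⟨y, hy⟩
          obtain ⟨m, hm⟩ := (Submodule.Quotient.mk_eq_zero _).1 hy
          exact ⟨m, Subtype.ext hm⟩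
        have hPl : ((projCover ρ χ).shift D).LocFinite := (projCover_locFinite χ).shift D
        have hPb : ((projCover ρ χ).shift D).BoundedBelow D := fun i hi =>
          projCover_boundedBelow χ (i - D) (by omega)
        refine HasMultEuler.middle hE q hq ?_ ?_
        · refine HasMultEuler.right hPl φ' hφ' ?_ (hasMultEuler_proj hF hFe hFb hf χ hDB)
          refine ih (D + 1) (by push_cast at hD; omega) (by omega) _ (hPl.sub _ _) ?_
          intro i hi
          rcases lt_or_eq_of_le (Int.lt_add_one_iff.1 hi) with hi | hi
          · exact hPb.sub _ _ i hi
          · rw [hi, eq_bot_iff]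
            rintro ⟨m, hm⟩ hm'
            refine Subtype.ext (lin_injOn_zero (⟨x, hx⟩ : E.eDeg χ D) hx0 (m := m) ?_ ?_)
            · have h1 : m ∈ (projCover ρ χ).deg (D - D) := hm'
              rwa [sub_self] at h1
            · exact congrArg Subtype.val hm
        · refine ihr _ ?_ _ (hE.of_surjective q hq) (hEb.of_surjective q hq) rfl
          have := hE D
          rw [← hr]
          change Module.finrank ℂ ((E.quot _ _).deg D) < _
          rw [← LinearMap.finrank_range_add_finrank_ker (linDeg q D),
            LinearMap.range_eq_top.2 (linDeg_surjective hq D), finrank_top,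
            Nat.lt_add_right_iff_pos, Module.finrank_pos_iff_exists_ne_zero]
          have hxq : linDeg q D ⟨x, hx.1⟩ = 0 := Subtype.ext (by
            have h1 := hqφ (projGen ρ χ)
            rw [hφ] at h1
            exact h1)
          refine ⟨⟨⟨x, hx.1⟩, hxq⟩, fun h => hx0 ?_⟩
          exact congrArg Subtype.val (congrArg Subtype.val h)

/-- The graded Euler-Poincaré pairing of modules `E` in degrees `≥ 0` and `F` in degrees `≤ 0` is the
product of the series of multiplicities of `E` by the inverse of the matrix of multiplicities of the
`P_χ` and by the series of multiplicities of `F`. -/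
theorem gEP_eq (hF : F.LocFinite) (hFe : F.IsEven) (hFb : F.BoundedAbove 1)
    {f : Irr W → PowerSeries ℚ}
    (hf : ∀ χ, ∑ ψ, f ψ * (projCover ρ χ).hilb ψ = F.hilbNeg χ) {E : GrMod (AW.deg ρ)}
    (hE : E.LocFinite) (hEb : E.BoundedBelow 0) (a : ℕ) :
    (gEP E F (-(2 * a)) : ℚ) = PowerSeries.coeff a (∑ ψ, f ψ * E.hilb ψ) := by
  have h1 := (hasMultEuler hF hFe hFb hf (B := a + 1) (2 * a + 1) (-(2 * a))
    (by push_cast; omega) (by push_cast; omega) (E.shift (-(2 * a))) (hE.shift _)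
    fun i hi => hEb _ (by omega)).2
  -- the pairing is defined by extensions of `E.shift (-(2 * a))` by `F`
  refine Eq.trans (by rfl) (h1.trans ?_)
  simp only [multPairing, mdim_shift, hilb, map_sum, PowerSeries.coeff_mul, PowerSeries.coeff_mk]
  refine Finset.sum_congr rfl fun ψ _ => ?_
  rw [Finset.Nat.sum_antidiagonal_eq_sum_range_succ_mk]
  refine Finset.sum_congr rfl fun n hn => ?_
  have : n ≤ a := by simpa [Nat.lt_succ_iff] using hn
  rw [show -(2 * (n : ℤ)) - -(2 * a) = 2 * ((a - n : ℕ) : ℤ) by push_cast [this]; ring]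

end GrMod

end Pairing

/-! ### Duals -/

section IrrDual

variable {W : Type u} [Group W]

theorem Irr.character_mk (X : IrrRep W) :
    (Irr.L (Quotient.mk (IrrRep.setoid W) X : Irr W)).rep.character = X.rep.character := by
  obtain ⟨e⟩ : Nonempty ((Irr.L (Quotient.mk (IrrRep.setoid W) X : Irr W)).rep.Equiv X.rep) :=
    Quotient.exact (Quotient.out_eq (Quotient.mk (IrrRep.setoid W) X))
  exact Representation.char_iso e

theorem Irr.character_dual (χ : Irr W) (g : W) :
    χ.dual.L.rep.character g = χ.L.rep.character g⁻¹ := by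
  rw [Irr.dual, Irr.character_mk, Representation.char_dual]

variable [Finite W]

theorem Irr.eq_of_character {χ η : Irr W} (hχη : χ.L.rep.character = η.L.rep.character) :
    χ = η := by
  classical
  have := Fintype.ofFinite W
  have := invertibleOfNonzero (Nat.cast_ne_zero.2 Nat.card_pos.ne' : (Nat.card W : ℂ) ≠ 0)
  have h1 := Representation.char_orthonormal χ.L.rep η.L.rep
  rw [hχη, Representation.char_orthonormal, if_pos ⟨Representation.Equiv.refl _⟩] at h1
  by_contra h2
  rw [if_neg fun h => h2 (Irr.eq_of_equiv h).symm] at h1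
  exact one_ne_zero h1

@[simp] theorem Irr.dual_dual (χ : Irr W) : χ.dual.dual = χ :=
  Irr.eq_of_character (by ext g; rw [Irr.character_dual, Irr.character_dual, inv_inv])

theorem Irr.dual_injective : Function.Injective (Irr.dual : Irr W → Irr W) :=
  Function.LeftInverse.injective Irr.dual_dual

end IrrDual

section Dual

variable {W : Type u} [Group W] {h : Type u} [AddCommGroup h] [Module ℂ h]
variable {ρ : Representation ℂ W h}

namespace GrMod

variable (M : GrMod (AW.deg ρ))

/-- An element of degree `d` of the graded dual is a linear form on the part of degree `-d`. -/
def dualDegEquiv (d : ℤ) : M.dual.deg d ≃ₗ[ℂ] Module.Dual ℂ (M.deg (-d)) where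
  toFun φ := (M.dualIncl φ.1) ∘ₗ (M.deg (-d)).subtype
  map_add' _ _ := rfl
  map_smul' _ _ := rfl
  invFun ψ := ⟨⟨ψ ∘ₗ (M.proj (-d)).codRestrict (M.deg (-d)) (M.proj_mem (-d)),
      Submodule.mem_iSup_of_mem d fun j hj m hm => by
        have : (M.proj (-d)).codRestrict (M.deg (-d)) (M.proj_mem (-d)) m = 0 :=
          Subtype.ext (M.proj_ne hj.symm hm)
        rw [LinearMap.comp_apply, this, map_zero]⟩,
    fun j hj m hm => by
      have : (M.proj (-d)).codRestrict (M.deg (-d)) (M.proj_mem (-d)) m = 0 :=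
        Subtype.ext (M.proj_ne hj.symm hm)
      change ψ ((M.proj (-d)).codRestrict (M.deg (-d)) (M.proj_mem (-d)) m) = 0
      rw [this, map_zero]⟩
  left_inv φ := by
    refine Subtype.ext (Subtype.ext (LinearMap.ext fun m => ?_))
    change M.dualIncl φ.1 (M.proj (-d) m) = M.dualIncl φ.1 m
    induction m using M.induction with
    | hom j m hm =>
      by_cases hj : j = -d
      · subst hj; rw [M.proj_same hm]
      · rw [M.proj_ne (Ne.symm hj) hm, map_zero]; exact (φ.2 j hj m hm).symm
    | add m n hm hn => simp only [map_add, hm, hn]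
  right_inv ψ := by
    refine LinearMap.ext fun m => ?_
    change ψ ((M.proj (-d)).codRestrict (M.deg (-d)) (M.proj_mem (-d)) m) = ψ m
    congr 1
    exact Subtype.ext (M.proj_same m.2)

/-- The equivalence `(M^*)_d ≃ (M_{-d})^*` is equivariant. -/
def dualRepEquiv (d : ℤ) : (M.dual.degRep d).Equiv (M.degRep (-d)).dual :=
  Representation.Equiv.mk (M.dualDegEquiv d) fun w => by
    refine LinearMap.ext fun φ => LinearMap.ext fun m => ?_
    change M.dualIncl φ.1 (AW.anti ρ (AW.mk 1 w) • (m : M)) =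
      M.dualIncl φ.1 ((AW.mk 1 w⁻¹ : AW ρ) • (m : M))
    rw [AW.anti_mk', smul_one]

variable {M}

theorem LocFinite.dual (hM : M.LocFinite) : M.dual.LocFinite := fun d => by
  have := hM (-d)
  exact Module.Finite.equiv (M.dualDegEquiv d).symm

theorem dual_deg_eq_bot {d : ℤ} (hd : M.deg (-d) = ⊥) : M.dual.deg d = ⊥ := by
  have : Subsingleton (M.deg (-d)) := by rw [hd]; infer_instance
  have : Subsingleton (M.dual.deg d) := (M.dualDegEquiv d).toEquiv.subsingleton
  exact Submodule.subsingleton_iff_eq_bot.1 this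

theorem BoundedBelow.dual (hM : M.BoundedBelow 0) : M.dual.BoundedAbove 1 := fun d hd =>
  dual_deg_eq_bot (hM _ (by omega))

theorem IsEven.dual (hM : M.IsEven) : M.dual.IsEven := fun d hd =>
  dual_deg_eq_bot (hM _ (by omega))

variable [Finite W]

theorem mdim_dual (hM : M.LocFinite) (χ : Irr W) (d : ℤ) :
    M.dual.mdim χ d = M.mdim χ.dual (-d) := by
  have := Fintype.ofFinite W
  have := hM (-d)
  have := hM.dual d
  have h1 := finrank_homW_char hM χ.dual.L.rep (-d)
  have h2 := finrank_homW_char hM.dual χ.L.rep d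
  rw [Representation.char_iso (M.dualRepEquiv d)] at h2
  simp only [Representation.char_dual] at h2
  simp only [Irr.character_dual, inv_inv] at h1
  rw [← Equiv.sum_comp (Equiv.inv W)] at h2
  simp only [Equiv.inv_apply, inv_inv] at h2
  rw [← h1, finrank_homW, finrank_homW] at h2
  exact_mod_cast h2

theorem hilbNeg_dual (hM : M.LocFinite) (χ : Irr W) : M.dual.hilbNeg χ = M.hilb χ.dual := by
  ext n
  rw [hilbNeg, hilb, PowerSeries.coeff_mk, PowerSeries.coeff_mk, mdim_dual hM, neg_neg]

theorem mdim_congr {N : GrMod (AW.deg ρ)} (hM : M.LocFinite) (hN : N.LocFinite) (e : M ≅ N)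
    (χ : Irr W) (i : ℤ) : M.mdim χ i = N.mdim χ i :=
  le_antisymm (by rw [mdim_add hN e.inv (surjective_of_epi _)]; exact Nat.le_add_left _ _)
    (by rw [mdim_add hM e.hom (surjective_of_epi _)]; exact Nat.le_add_left _ _)

end GrMod

end Dual

/-! ### Traces -/

section Trace

variable {W : Type u} [Group W] [Finite W] {h : Type u} [AddCommGroup h] [Module ℂ h]
variable {ρ : Representation ℂ W h}

open GrMod

/-- The projection of `P_χ` onto its trace. -/
def traceπ (ρ : Representation ℂ W h) (P : Phyla W) (χ : Irr W) :
    projCover ρ χ ⟶ trace ρ P χ := quotπ _ _ _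

theorem traceπ_surjective (P : Phyla W) (χ : Irr W) :
    Function.Surjective (lin (traceπ ρ P χ)) := Submodule.mkQ_surjective _

theorem traceπ_eq_zero {P : Phyla W} {χ : Irr W} {x : projCover ρ χ} :
    lin (traceπ ρ P χ) x = 0 ↔ x ∈ traceSub ρ P χ := Submodule.Quotient.mk_eq_zero _

omit [Finite W] in
theorem proj_zero_of_mem_iSup {M : GrMod (AW.deg ρ)} {ι : Sort*} {N : ι → Submodule (AW ρ) M}
    {i : ℤ} (hN : ∀ j, ∀ n ∈ N j, M.proj i n = 0) : ∀ n ∈ ⨆ j, N j, M.proj i n = 0 := by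
  intro n hn
  induction hn using Submodule.iSup_induction' with
  | mem j x hx => exact hN j x hx
  | zero => exact map_zero _
  | add x y _ _ hx hy => rw [map_add, hx, hy, add_zero]

/-- Morphisms of positive degree have no component of degree `0` in their image. -/
theorem traceSub_proj_zero (P : Phyla W) (χ : Irr W) :
    ∀ n ∈ traceSub ρ P χ, (projCover ρ χ).proj 0 n = 0 := by
  refine proj_zero_of_mem_iSup fun η => proj_zero_of_mem_iSup fun _ =>
    proj_zero_of_mem_iSup fun d => proj_zero_of_mem_iSup fun hd =>
    proj_zero_of_mem_iSup fun f => ?_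
  rintro _ ⟨x, rfl⟩
  rw [← lin_proj]
  have h1 : ((projCover ρ η).shift d).proj 0 x ∈ (projCover ρ η).deg (0 - d) :=
    ((projCover ρ η).shift d).proj_mem 0 x
  rw [projCover_boundedBelow η _ (by omega)] at h1
  have h2 : ((projCover ρ η).shift d).proj 0 x = 0 := h1
  exact (congrArg (lin f) h2).trans (map_zero (lin f))

theorem mdim_trace_zero [FiniteDimensional ℂ h] (P : Phyla W) (χ η : Irr W) :
    (trace ρ P χ).mdim η 0 = (projCover ρ χ).mdim η 0 := by
  rw [mdim_add (projCover_locFinite χ) (traceπ ρ P χ) (traceπ_surjective P χ) η 0,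
    mdim_eq_zero (M := (projCover ρ χ).sub _ _) (i := 0), zero_add]
  rw [eq_bot_iff]
  rintro ⟨x, hx⟩ hx0
  have h1 := traceSub_proj_zero P χ x (traceπ_eq_zero.1 hx)
  exact Subtype.ext (((projCover ρ χ).proj_same (i := 0) hx0).symm.trans h1)

/-- A vector of `e_η P_χ` of positive degree is the image of the generator under a morphism
`P_η → P_χ` of positive degree, so it dies in the trace if `η ≲ χ`. -/
theorem mdim_trace_pos {P : Phyla W} {χ η : Irr W} (hη : P.index η ≤ P.index χ) {d : ℤ}
    (hd : 0 < d) : (trace ρ P χ).mdim η d = 0 := by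
  have : (trace ρ P χ).eDeg η d = ⊥ := by
    rw [eq_bot_iff]
    rintro y ⟨hy, hey⟩
    obtain ⟨x, hx, rfl⟩ := exists_deg_lift (traceπ_surjective P χ) hy
    have hx' := (projCover ρ χ).idemA_smul_mem η hx
    rw [Submodule.mem_bot, ← hey, ← map_smul, traceπ_eq_zero]
    refine Submodule.mem_iSup_of_mem η (Submodule.mem_iSup_of_mem hη
      (Submodule.mem_iSup_of_mem d (Submodule.mem_iSup_of_mem hd
        (Submodule.mem_iSup_of_mem (projDesc ⟨_, hx'⟩) ⟨projGen ρ η, ?_⟩))))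
    exact projDesc_projGen _
  rw [mdim, this, finrank_bot]

variable [FiniteDimensional ℂ h]

/-- The properties of the modules of a Kostka system which come from the definition of the trace. -/
theorem trace_props {P : Phyla W} {χ : Irr W} {K : GrMod (AW.deg ρ)}
    (hK : Nonempty (K ≅ trace ρ P χ)) :
    K.LocFinite ∧ K.BoundedBelow 0 ∧ K.IsEven ∧ K.hilb χ = 1 ∧
      ∀ η, P.index η ≤ P.index χ → η ≠ χ → K.hilb η = 0 := by
  classical
  obtain ⟨e⟩ := hK
  have he : Function.Surjective (lin (traceπ ρ P χ ≫ e.inv)) :=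
    (surjective_of_epi e.inv).comp (traceπ_surjective P χ)
  have hT := (projCover_locFinite χ).of_surjective (traceπ ρ P χ) (traceπ_surjective P χ)
  have hl := (projCover_locFinite χ).of_surjective _ he
  have key : ∀ η, P.index η ≤ P.index χ → K.hilb η = if η = χ then 1 else 0 := by
    intro η hη
    ext n
    rw [hilb, PowerSeries.coeff_mk, mdim_congr hl hT e]
    rcases Nat.eq_zero_or_pos n with rfl | hn
    · rw [Nat.cast_zero, mul_zero, mdim_trace_zero, mdim_projCover_zero]
      split_ifs <;> simp
    · rw [mdim_trace_pos hη (by omega)]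
      split_ifs <;> simp [PowerSeries.coeff_one, hn.ne']
  refine ⟨hl, (projCover_boundedBelow χ).of_surjective _ he,
    (projCover_isEven χ).of_surjective _ he, ?_, fun η hη hne => ?_⟩
  · rw [key χ le_rfl, if_pos rfl]
  · rw [key η hη, if_neg hne]

end Trace

/-! ### The polynomial ring over the invariants of a reflection group -/

section Chevalley

variable {W : Type u} [Group W] {h : Type u} [AddCommGroup h] [Module ℂ h]
variable {ρ : Representation ℂ W h}

theorem Sym.ι_ne_zero {x : h} (hx : x ≠ 0) : Sym.ι ρ x ≠ 0 := by
  intro h0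
  refine hx ((Module.forall_dual_apply_eq_zero_iff ℂ x).1 fun f => ?_)
  rw [← Sym.lift_ι ρ f x, h0, map_zero]

theorem Sym.proj_two_mul (n : ℕ) (p : Sym ρ) :
    Sym.proj ρ (2 * n) p = (Sym.expand ρ p).coeff n := by
  rw [Sym.proj, if_pos (by omega), show ((2 * n : ℤ) / 2).toNat = n by omega]
  rfl

theorem Sym.expand_ι (x : h) : Sym.expand ρ (Sym.ι ρ x) = Polynomial.X * Polynomial.C (Sym.ι ρ x) :=
  Sym.lift_ι ρ _ x

theorem Sym.coeff_expand_smul (w : W) (n : ℕ) (p : Sym ρ) :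
    (Sym.expand ρ (w • p)).coeff n = w • (Sym.expand ρ p).coeff n := by
  rw [← Sym.proj_two_mul, Sym.proj_smul, Sym.proj_two_mul]

theorem Sym.smul_algebraMap (w : W) (c : ℂ) :
    w • algebraMap ℂ (Sym ρ) c = algebraMap ℂ (Sym ρ) c := (Sym.act ρ w).commutes c

/-- The degree of a polynomial, where elements of `h` have degree `1`. -/
def Sym.natDegree (p : Sym ρ) : ℕ := (Sym.expand ρ p).natDegree

theorem Sym.natDegree_smul_sub_le (w : W) (p : Sym ρ) : (w • p - p).natDegree ≤ p.natDegree := by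
  refine Polynomial.natDegree_le_iff_coeff_eq_zero.2 fun n hn => ?_
  have h1 : (Sym.expand ρ p).coeff n = 0 := Polynomial.coeff_eq_zero_of_natDegree_lt hn
  rw [map_sub, Polynomial.coeff_sub, Sym.coeff_expand_smul, h1, smul_zero, sub_zero]

theorem Sym.expand_ne_zero {p : Sym ρ} (hp : p ≠ 0) : Sym.expand ρ p ≠ 0 := by
  -- evaluation at `1` is a left inverse of `expand`
  have h1 : ((Polynomial.aeval (R := Sym ρ) (1 : Sym ρ)).restrictScalars ℂ).comp
      (Sym.expand ρ) = AlgHom.id ℂ (Sym ρ) :=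
    Sym.algHom_ext fun x => by simp [Sym.expand_ι]
  intro h0
  apply hp
  have h2 := DFunLike.congr_fun h1 p
  rw [AlgHom.comp_apply, h0, map_zero] at h2
  exact h2.symm

theorem Sym.natDegree_ι_mul {x : h} (hx : x ≠ 0) {q : Sym ρ} (hq : q ≠ 0) :
    (Sym.ι ρ x * q).natDegree = q.natDegree + 1 := by
  have h1 : Sym.ι ρ x ≠ 0 := Sym.ι_ne_zero hx
  rw [Sym.natDegree, map_mul, Sym.expand_ι, Polynomial.natDegree_mul
    (mul_ne_zero Polynomial.X_ne_zero (Polynomial.C_ne_zero.2 h1)) (Sym.expand_ne_zero hq),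
    Polynomial.natDegree_X_mul (Polynomial.C_ne_zero.2 h1), Polynomial.natDegree_C, add_comm]
  rfl

/-- A reflection moves a polynomial by a multiple of its root. -/
theorem Sym.exists_divided_difference {s : W}
    (hs : Module.finrank ℂ (LinearMap.range (ρ s - 1)) = 1) :
    ∃ α : h, α ≠ 0 ∧ ∀ p : Sym ρ, ∃ q, s • p - p = Sym.ι ρ α * q := by
  obtain ⟨⟨α, hα⟩, hα0, hsp⟩ := finrank_eq_one_iff'.1 hs
  refine ⟨α, fun h0 => hα0 (Subtype.ext h0), fun p => ?_⟩
  induction p using Sym.induction with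
  | scalar r => exact ⟨0, by rw [Sym.smul_algebraMap, sub_self, mul_zero]⟩
  | lin x =>
    obtain ⟨c, hc⟩ := hsp ⟨ρ s x - x, x, rfl⟩
    refine ⟨algebraMap ℂ _ c, ?_⟩
    have hc' : c • α = ρ s x - x := congrArg Subtype.val hc
    rw [Sym.smul_ι, ← map_sub, ← hc', mul_comm, ← Algebra.smul_def, ← map_smul]
  | mul a b ha hb =>
    obtain ⟨qa, ha⟩ := ha
    obtain ⟨qb, hb⟩ := hb
    refine ⟨(s • a) * qb + qa * b, ?_⟩
    rw [smul_mul']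
    linear_combination (s • a) * hb + b * ha
  | add a b ha hb =>
    obtain ⟨qa, ha⟩ := ha
    obtain ⟨qb, hb⟩ := hb
    refine ⟨qa + qb, ?_⟩
    rw [smul_add]
    linear_combination ha + hb

variable (ρ) in
/-- The ideal of `ℂ[h*]` generated by the invariants which vanish at `0`. -/
def Sym.coinvIdeal : Ideal (Sym ρ) := Ideal.span (J ρ)

theorem Sym.smul_mem_coinvIdeal (w : W) {p : Sym ρ} (hp : p ∈ Sym.coinvIdeal ρ) :
    w • p ∈ Sym.coinvIdeal ρ := by
  induction hp using Submodule.closure_induction with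
  | zero => rw [smul_zero]; exact Submodule.zero_mem _
  | add x y _ _ hx hy => rw [smul_add]; exact Submodule.add_mem _ hx hy
  | smul_mem r x hx =>
    rw [smul_eq_mul, smul_mul', hx.1 w]
    exact Ideal.mul_mem_left _ _ (Ideal.subset_span hx)

variable [Finite W]

variable (ρ) in
/-- The averaging operator onto the invariants. -/
def Sym.average (p : Sym ρ) : Sym ρ :=
  let _ := Fintype.ofFinite W
  (Nat.card W : ℂ)⁻¹ • ∑ w : W, w • p

theorem Sym.smul_average (v : W) (p : Sym ρ) : v • Sym.average ρ p = Sym.average ρ p := by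
  let _ := Fintype.ofFinite W
  rw [Sym.average, smul_comm, Finset.smul_sum]
  congr 1
  simp only [smul_smul]
  exact Fintype.sum_equiv (Equiv.mulLeft v) _ _ fun w => rfl

theorem Sym.average_add (p q : Sym ρ) :
    Sym.average ρ (p + q) = Sym.average ρ p + Sym.average ρ q := by
  simp only [Sym.average, smul_add, Finset.sum_add_distrib]

theorem Sym.average_zero : Sym.average ρ 0 = 0 := by simp [Sym.average]

theorem Sym.average_sum {κ : Type*} (s : Finset κ) (f : κ → Sym ρ) :
    Sym.average ρ (∑ i ∈ s, f i) = ∑ i ∈ s, Sym.average ρ (f i) := by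
  classical
  induction s using Finset.induction_on with
  | empty => simp [Sym.average_zero]
  | insert a s ha ih => rw [Finset.sum_insert ha, Finset.sum_insert ha, Sym.average_add, ih]

theorem Sym.average_inv_mul {g : Sym ρ} (hg : ∀ w : W, w • g = g) (p : Sym ρ) :
    Sym.average ρ (g * p) = g * Sym.average ρ p := by
  simp only [Sym.average, smul_mul', hg, ← Finset.mul_sum, mul_smul_comm]

theorem Sym.average_sub_mem {p : Sym ρ} (hp : ∀ w : W, w • p - p ∈ Sym.coinvIdeal ρ) :
    Sym.average ρ p - p ∈ Sym.coinvIdeal ρ := by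
  let _ := Fintype.ofFinite W
  have hc : (Nat.card W : ℂ) ≠ 0 := Nat.cast_ne_zero.2 Nat.card_pos.ne'
  have h1 : Sym.average ρ p - p = (Nat.card W : ℂ)⁻¹ • ∑ w : W, (w • p - p) := by
    rw [Finset.sum_sub_distrib, smul_sub, Finset.sum_const, Finset.card_univ,
      ← Nat.card_eq_fintype_card, ← Nat.cast_smul_eq_nsmul ℂ, smul_smul, inv_mul_cancel₀ hc,
      one_smul]
    rfl
  rw [h1, Algebra.smul_def]
  exact Ideal.mul_mem_left _ _ (Submodule.sum_mem _ fun w _ => hp w)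

/-- Chevalley's lemma: in a relation with invariant coefficients, one of which is not generated by the
others, the corresponding term lies in the ideal generated by the invariants vanishing at `0`.

Divided differences turn the relation into relations of smaller degree, so by induction the term is
invariant modulo the ideal, and can be replaced by its average. -/
theorem Sym.chevalley (hρ : IsComplexReflectionGroup ρ) {κ : Type*} [Fintype κ] {g : Sym ρ}
    {g' : κ → Sym ρ} (hg : ∀ w : W, w • g = g) (hg' : ∀ i, ∀ w : W, w • g' i = g' i)
    (hind : ¬ ∃ r : κ → Sym ρ, (∀ i, ∀ w : W, w • r i = r i) ∧ ∃ j ∈ J ρ,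
      g = ∑ i, g' i * r i + g * j) {p : Sym ρ} {p' : κ → Sym ρ}
    (hrel : g * p + ∑ i, g' i * p' i = 0) : p ∈ Sym.coinvIdeal ρ := by
  induction hd : p.natDegree using Nat.strong_induction_on generalizing p p' with
  | _ d ih =>
    have hrefl : ∀ s : W, Module.finrank ℂ (LinearMap.range (ρ s - 1)) = 1 →
        s • p - p ∈ Sym.coinvIdeal ρ := by
      intro s hs
      obtain ⟨α, hα, hdiff⟩ := Sym.exists_divided_difference hs
      obtain ⟨q, hq⟩ := hdiff p
      choose q' hq' using fun i => hdiff (p' i)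
      rw [hq]
      refine Ideal.mul_mem_left _ _ ?_
      by_cases hq0 : q = 0
      · rw [hq0]; exact Submodule.zero_mem _
      refine ih q.natDegree ?_ (p' := q') ?_ rfl
      · have h1 := Sym.natDegree_smul_sub_le s p
        rw [hq, Sym.natDegree_ι_mul hα hq0] at h1
        omega
      · refine (mul_eq_zero.1 (?_ : Sym.ι ρ α * _ = 0)).resolve_left (Sym.ι_ne_zero hα)
        have h1 := congrArg (s • ·) hrel
        simp only [smul_add, Finset.smul_sum, smul_mul', hg, hg', smul_zero] at h1
        rw [mul_add, Finset.mul_sum]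
        have h2 : ∀ i, Sym.ι ρ α * (g' i * q' i) = g' i * (s • p' i) - g' i * p' i := fun i => by
          rw [← mul_sub, hq']; ring
        simp only [h2, Finset.sum_sub_distrib]
        linear_combination h1 - hrel - g * hq
    have hall : ∀ w : W, w • p - p ∈ Sym.coinvIdeal ρ := by
      intro w
      have hw : w ∈ Subgroup.closure
          {w : W | Module.finrank ℂ (LinearMap.range (ρ w - 1)) = 1} :=
        hρ.closure_reflections ▸ Subgroup.mem_top w
      induction hw using Subgroup.closure_induction with
      | mem s hs => exact hrefl s hs
      | one => rw [one_smul, sub_self]; exact Submodule.zero_mem _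
      | mul v w _ _ hv hw =>
        have := Submodule.add_mem _ (Sym.smul_mem_coinvIdeal v hw) hv
        rwa [smul_sub, smul_smul, sub_add_sub_cancel] at this
      | inv w _ hw =>
        have := Submodule.neg_mem _ (Sym.smul_mem_coinvIdeal w⁻¹ hw)
        rwa [smul_sub, inv_smul_smul, neg_sub] at this
    have hav := Sym.average_sub_mem hall
    have hrel' : g * Sym.average ρ p + ∑ i, g' i * Sym.average ρ (p' i) = 0 := by
      have h1 := congrArg (Sym.average ρ) hrel
      rw [Sym.average_add, Sym.average_sum, Sym.average_zero, Sym.average_inv_mul hg] at h1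
      rw [← h1]
      exact congrArg _ (Finset.sum_congr rfl fun i _ => (Sym.average_inv_mul (hg' i) _).symm)
    have hc : Sym.eval0 ρ (Sym.average ρ p) = 0 := by
      -- otherwise the averaged relation can be solved for `g`
      by_contra hc
      set c := Sym.eval0 ρ (Sym.average ρ p) with hcdef
      refine hind ⟨fun i => -(algebraMap ℂ _ c⁻¹ * Sym.average ρ (p' i)), fun i w => ?_,
        1 - algebraMap ℂ _ c⁻¹ * Sym.average ρ p, ⟨fun w => ?_, ?_⟩, ?_⟩
      · rw [smul_neg, smul_mul', Sym.smul_algebraMap, Sym.smul_average]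
      · rw [smul_sub, smul_one, smul_mul', Sym.smul_algebraMap, Sym.smul_average]
      · rw [map_sub, map_one, map_mul, ← hcdef, AlgHom.commutes]
        change 1 - c⁻¹ * c = 0
        rw [inv_mul_cancel₀ hc, sub_self]
      · have h2 : ∑ i, g' i * -(algebraMap ℂ _ c⁻¹ * Sym.average ρ (p' i)) =
            -(algebraMap ℂ _ c⁻¹ * ∑ i, g' i * Sym.average ρ (p' i)) := by
          rw [Finset.mul_sum, ← Finset.sum_neg_distrib]
          exact Finset.sum_congr rfl fun i _ => by ring
        rw [h2]
        linear_combination algebraMap ℂ (Sym ρ) c⁻¹ * hrel'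
    have hmem : Sym.average ρ p ∈ Sym.coinvIdeal ρ :=
      Ideal.subset_span ⟨fun w => Sym.smul_average w p, hc⟩
    have := Submodule.sub_mem _ hmem hav
    rwa [sub_sub_cancel] at this

/-- Polynomials which are linearly independent modulo the ideal generated by the invariants vanishing
at `0` are linearly independent over the invariants. -/
theorem Sym.eq_zero_of_sum_inv_mul (hρ : IsComplexReflectionGroup ρ) {m : ℕ}
    {y : Fin m → Sym ρ} (hy : ∀ c : Fin m → ℂ, ∑ i, c i • y i ∈ Sym.coinvIdeal ρ → c = 0)
    {g : Fin m → Sym ρ} (hg : ∀ i, ∀ w : W, w • g i = g i) (hrel : ∑ i, g i * y i = 0) :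
    g = 0 := by
  induction m with
  | zero => exact Subsingleton.elim _ _
  | succ m ih =>
    rw [Fin.sum_univ_succ] at hrel
    -- if `g 0` is generated by the other coefficients, it can be eliminated from the relation;
    -- otherwise Chevalley's lemma puts `y 0` in the ideal
    by_cases hind : ∃ r : Fin m → Sym ρ, (∀ i, ∀ w : W, w • r i = r i) ∧ ∃ j ∈ J ρ,
      g 0 = ∑ i, g (Fin.succ i) * r i + g 0 * j
    · obtain ⟨r, hr, j, hj, h0⟩ := hind
      have h1 : (fun i => g (Fin.succ i)) = 0 := by
        refine ih (y := fun i => (1 - j) * y (Fin.succ i) + r i * y 0) (fun c hc => ?_)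
          (fun i => hg _) ?_
        · -- modulo the ideal, `j` vanishes and `r i` is a scalar
          have hmod : ∀ i, (1 - j) * y (Fin.succ i) + r i * y 0 -
              (y (Fin.succ i) + Sym.eval0 ρ (r i) • y 0) ∈ Sym.coinvIdeal ρ := by
            intro i
            have e : (1 - j) * y (Fin.succ i) + r i * y 0 -
                (y (Fin.succ i) + Sym.eval0 ρ (r i) • y 0) =
                (r i - algebraMap ℂ _ (Sym.eval0 ρ (r i))) * y 0 - j * y (Fin.succ i) := by
              rw [Algebra.smul_def]; ring
            rw [e]
            refine Submodule.sub_mem _ (Ideal.mul_mem_right _ _ (Ideal.subset_span ⟨fun w => ?_, ?_⟩))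
              (Ideal.mul_mem_right _ _ (Ideal.subset_span hj))
            · rw [smul_sub, hr, Sym.smul_algebraMap]
            · rw [map_sub, AlgHom.commutes]; exact sub_self _
          have h2 := Submodule.sub_mem _ hc (Submodule.sum_mem _ fun i (_ : i ∈ Finset.univ) =>
            (Ideal.mul_mem_left _ (algebraMap ℂ _ (c i)) (hmod i)))
          have h3 := hy (Fin.cons (∑ i, c i * Sym.eval0 ρ (r i)) c) (by
            rw [Fin.sum_univ_succ]
            simp only [Fin.cons_zero, Fin.cons_succ]
            convert h2 using 1
            rw [Finset.sum_smul, ← Finset.sum_add_distrib, ← Finset.sum_sub_distrib]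
            refine Finset.sum_congr rfl fun i _ => ?_
            simp only [Algebra.smul_def, map_mul]
            ring)
          ext i
          exact congrFun h3 (Fin.succ i)
        · have h2 : ∀ i, g (Fin.succ i) * ((1 - j) * y (Fin.succ i) + r i * y 0) =
              (1 - j) * (g (Fin.succ i) * y (Fin.succ i)) + g (Fin.succ i) * r i * y 0 :=
            fun i => by ring
          simp only [h2, Finset.sum_add_distrib, ← Finset.mul_sum, ← Finset.sum_mul]
          linear_combination (1 - j) * hrel - y 0 * h0
      have h2 : g 0 = 0 := by
        have h3 : ∀ i, g (Fin.succ i) = 0 := congrFun h1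
        simp only [h3, zero_mul, Finset.sum_const_zero, zero_add] at h0
        by_contra h4
        have h5 : j = 1 := mul_left_cancel₀ h4 (by rw [← h0, mul_one])
        have h6 := hj.2
        rw [h5, map_one] at h6
        exact one_ne_zero h6
      ext i
      refine Fin.cases h2 (fun i => congrFun h1 i) i
    · exfalso
      have h1 := Sym.chevalley hρ (hg 0) (fun i => hg _) hind hrel
      have h2 := hy (Pi.single 0 1) (by
        rw [Finset.sum_eq_single 0 (fun i _ hi => by rw [Pi.single_eq_of_ne hi, zero_smul])
          (fun h => (h (Finset.mem_univ _)).elim), Pi.single_eq_same, one_smul]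
        exact h1)
      have h3 := congrFun h2 0
      rw [Pi.single_eq_same] at h3
      exact one_ne_zero h3

end Chevalley

/-! ### Characters of the polynomial ring -/

section Freeness

variable {W : Type u} [Group W] {h : Type u} [AddCommGroup h] [Module ℂ h]
variable {ρ : Representation ℂ W h}

theorem Sym.proj_mul (n : ℕ) (p q : Sym ρ) : Sym.proj ρ (2 * n) (p * q) =
    ∑ x ∈ Finset.HasAntidiagonal.antidiagonal n, Sym.proj ρ (2 * x.1) p * Sym.proj ρ (2 * x.2) q := by
  simp only [Sym.proj_two_mul, map_mul, Polynomial.coeff_mul]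

/-- An invariant which vanishes at `0` has no constant term. -/
theorem Sym.proj_zero_of_mem_J {p : Sym ρ} (hp : p ∈ J ρ) : Sym.proj ρ (2 * (0 : ℕ)) p = 0 := by
  have h1 := Sym.proj_mem ρ (2 * (0 : ℕ)) p
  have h2 := (J_proj ρ hp (2 * (0 : ℕ))).2
  rw [Sym.deg_two_mul, Sym.homog, pow_zero] at h1
  obtain ⟨c, hc⟩ := Submodule.mem_one.1 h1
  rw [← hc, AlgHom.commutes] at h2
  rw [← hc]
  have h3 : c = 0 := h2
  rw [h3, map_zero]

theorem Sym.proj_mem_coinvIdeal {p : Sym ρ} (hp : p ∈ Sym.coinvIdeal ρ) (n : ℕ) :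
    Sym.proj ρ (2 * n) p ∈ Sym.coinvIdeal ρ := by
  induction hp using Submodule.closure_induction with
  | zero => rw [map_zero]; exact Submodule.zero_mem _
  | add x y _ _ hx hy => rw [map_add]; exact Submodule.add_mem _ hx hy
  | smul_mem r x hx =>
    rw [smul_eq_mul, Sym.proj_mul]
    exact Submodule.sum_mem _ fun i _ =>
      Ideal.mul_mem_left _ _ (Ideal.subset_span (J_proj ρ hx _))

variable (ρ) in
/-- The representation of `W` on the polynomials of degree `d`. -/
def Sym.degRep (d : ℤ) : Representation ℂ W (Sym.deg ρ d) where
  toFun w := (Sym.act ρ w).toLinearMap.restrict fun _ hp => Sym.smul_mem_deg ρ w hp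
  map_one' := LinearMap.ext fun p => Subtype.ext (one_smul W (p : Sym ρ))
  map_mul' v w := LinearMap.ext fun p => Subtype.ext (mul_smul v w (p : Sym ρ))

theorem Sym.degRep_coe (d : ℤ) (w : W) (p : Sym.deg ρ d) :
    (Sym.degRep ρ d w p : Sym ρ) = w • (p : Sym ρ) := rfl

variable (ρ) in
/-- The invariants of polynomial degree `n`, that is, of degree `2n`. -/
def Sym.inv (n : ℕ) : Submodule ℂ (Sym ρ) where
  carrier := {p | p ∈ Sym.deg ρ (2 * n) ∧ ∀ w : W, w • p = p}
  add_mem' hp hq := ⟨Submodule.add_mem _ hp.1 hq.1, fun w => by rw [smul_add, hp.2, hq.2]⟩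
  zero_mem' := ⟨Submodule.zero_mem _, fun w => smul_zero w⟩
  smul_mem' c p hp := ⟨Submodule.smul_mem _ c hp.1, fun w => by rw [smul_comm, hp.2]⟩

theorem Sym.finiteDimensional_inv [FiniteDimensional ℂ h] (n : ℕ) :
    FiniteDimensional ℂ (Sym.inv ρ n) := by
  have := Sym.finiteDimensional_deg ρ (2 * n)
  exact Submodule.finiteDimensional_of_le (S₂ := Sym.deg ρ (2 * n)) fun _ hp => hp.1

theorem Sym.finrank_inv_zero : Module.finrank ℂ (Sym.inv ρ 0) = 1 := by
  have h0 : Sym.inv ρ 0 = 1 := by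
    have h1 := Sym.deg_two_mul ρ 0
    rw [Sym.homog, pow_zero] at h1
    refine le_antisymm (fun p hp => h1 ▸ hp.1) fun p hp => ⟨h1 ▸ hp, fun w => ?_⟩
    obtain ⟨c, rfl⟩ := Submodule.mem_one.1 hp
    exact Sym.smul_algebraMap w c
  rw [h0, Submodule.one_eq_span, finrank_span_singleton one_ne_zero]

variable (ρ) in
/-- The polynomials of degree `d` in the ideal generated by the invariants vanishing at `0`. -/
def Sym.coinvSub (d : ℤ) : Subrepresentation (Sym.degRep ρ d) where
  toSubmodule := ((Sym.coinvIdeal ρ).restrictScalars ℂ).comap (Sym.deg ρ d).subtype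
  apply_mem_toSubmodule w _ hp := Sym.smul_mem_coinvIdeal w hp

variable [Finite W]

theorem Sym.exists_harm (ρ : Representation ℂ W h) (d : ℤ) : ∃ H : Submodule ℂ (Sym ρ),
    H ≤ Sym.deg ρ d ∧ (∀ w : W, ∀ p ∈ H, w • p ∈ H) ∧ (∀ p ∈ H, p ∈ Sym.coinvIdeal ρ → p = 0) ∧
    ∀ p ∈ Sym.deg ρ d, ∃ y ∈ H, ∃ q ∈ Sym.deg ρ d, q ∈ Sym.coinvIdeal ρ ∧ p = q + y := by
  have : NeZero (Nat.card W : ℂ) := ⟨Nat.cast_ne_zero.2 Nat.card_pos.ne'⟩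
  obtain ⟨H, hH⟩ : ∃ H, IsCompl (Sym.coinvSub ρ d) H := ComplementedLattice.exists_isCompl _
  refine ⟨H.toSubmodule.map (Sym.deg ρ d).subtype, ?_, ?_, ?_, ?_⟩
  · rintro _ ⟨p, -, rfl⟩
    exact p.2
  · rintro w _ ⟨p, hp, rfl⟩
    exact ⟨_, H.apply_mem_toSubmodule w hp, rfl⟩
  · rintro _ ⟨p, hp, rfl⟩ hp'
    have h2 : p ∈ (Sym.coinvSub ρ d ⊓ H).toSubmodule := ⟨hp', hp⟩
    rw [hH.disjoint.eq_bot] at h2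
    exact congrArg Subtype.val (show p = 0 from h2)
  · intro p hp
    have h2 : (⟨p, hp⟩ : Sym.deg ρ d) ∈ (Sym.coinvSub ρ d ⊔ H).toSubmodule := by
      rw [hH.codisjoint.eq_top]; trivial
    obtain ⟨q, hq, y, hy, hqy⟩ := Submodule.mem_sup.1 h2
    exact ⟨y, ⟨y, hy, rfl⟩, q, q.2, hq, (congrArg Subtype.val hqy).symm⟩

variable (ρ) in
/-- A `W`-stable complement, among the polynomials of degree `d`, of the ideal generated by the
invariants vanishing at `0`. -/
def Sym.harm (d : ℤ) : Submodule ℂ (Sym ρ) := (Sym.exists_harm ρ d).choose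

theorem Sym.harm_le_deg (d : ℤ) : Sym.harm ρ d ≤ Sym.deg ρ d :=
  (Sym.exists_harm ρ d).choose_spec.1

theorem Sym.smul_mem_harm {d : ℤ} (w : W) {p : Sym ρ} (hp : p ∈ Sym.harm ρ d) :
    w • p ∈ Sym.harm ρ d :=
  (Sym.exists_harm ρ d).choose_spec.2.1 w p hp

theorem Sym.eq_zero_of_mem_harm {d : ℤ} {p : Sym ρ} (hp : p ∈ Sym.harm ρ d)
    (hp' : p ∈ Sym.coinvIdeal ρ) : p = 0 :=
  (Sym.exists_harm ρ d).choose_spec.2.2.1 p hp hp'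

theorem Sym.exists_harm_add {d : ℤ} {p : Sym ρ} (hp : p ∈ Sym.deg ρ d) :
    ∃ y ∈ Sym.harm ρ d, ∃ q ∈ Sym.deg ρ d, q ∈ Sym.coinvIdeal ρ ∧ p = q + y :=
  (Sym.exists_harm ρ d).choose_spec.2.2.2 p hp

theorem Sym.finiteDimensional_harm [FiniteDimensional ℂ h] (d : ℤ) :
    FiniteDimensional ℂ (Sym.harm ρ d) := by
  have := Sym.finiteDimensional_deg ρ d
  exact Submodule.finiteDimensional_of_le (Sym.harm_le_deg d)

variable (ρ) in
/-- The representation of `W` on the complement in degree `d`. -/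
def Sym.harmRep (d : ℤ) : Representation ℂ W (Sym.harm ρ d) where
  toFun w := (Sym.act ρ w).toLinearMap.restrict fun _ hp => Sym.smul_mem_harm w hp
  map_one' := LinearMap.ext fun p => Subtype.ext (one_smul W (p : Sym ρ))
  map_mul' v w := LinearMap.ext fun p => Subtype.ext (mul_smul v w (p : Sym ρ))

variable (ρ) in
/-- The span of the products of an invariant with an element of one of the complements. -/
def Sym.invSpan : Submodule ℂ (Sym ρ) := Submodule.span ℂ
  {p | ∃ r : Sym ρ, (∀ w : W, w • r = r) ∧ ∃ (b : ℕ), ∃ y ∈ Sym.harm ρ (2 * b),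
    p = r * y}

theorem Sym.inv_mul_mem_invSpan {r p : Sym ρ} (hr : ∀ w : W, w • r = r)
    (hp : p ∈ Sym.invSpan ρ) : r * p ∈ Sym.invSpan ρ := by
  induction hp using Submodule.span_induction with
  | mem p hp =>
    obtain ⟨s, hs, b, y, hy, rfl⟩ := hp
    exact Submodule.subset_span ⟨r * s, fun w => by rw [smul_mul', hr, hs], b, y, hy,
      (mul_assoc _ _ _).symm⟩
  | zero => rw [mul_zero]; exact Submodule.zero_mem _
  | add p q _ _ hp hq => rw [mul_add]; exact Submodule.add_mem _ hp hq
  | smul c p _ hp => rw [mul_smul_comm]; exact Submodule.smul_mem _ c hp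

/-- The complements generate the polynomial ring over the invariants. -/
theorem Sym.deg_le_invSpan (n : ℕ) : Sym.deg ρ (2 * n) ≤ Sym.invSpan ρ := by
  induction n using Nat.strong_induction_on with
  | _ n ih =>
  have hI : ∀ q ∈ Sym.coinvIdeal ρ, Sym.proj ρ (2 * n) q ∈ Sym.invSpan ρ := by
    intro q hq
    induction hq using Submodule.closure_induction with
    | zero => rw [map_zero]; exact Submodule.zero_mem _
    | add x y _ _ hx hy => rw [map_add]; exact Submodule.add_mem _ hx hy
    | smul_mem r x hx =>
      rw [smul_eq_mul, Sym.proj_mul]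
      refine Submodule.sum_mem _ fun i hi => ?_
      rw [Finset.HasAntidiagonal.mem_antidiagonal] at hi
      by_cases h0 : i.2 = 0
      · rw [h0, Sym.proj_zero_of_mem_J hx, mul_zero]; exact Submodule.zero_mem _
      · rw [mul_comm]
        exact Sym.inv_mul_mem_invSpan (J_proj ρ hx _).1 (ih i.1 (by omega) (Sym.proj_mem ρ _ r))
  intro p hp
  obtain ⟨y, hy, q, hqd, hq, hpq⟩ := Sym.exists_harm_add hp
  rw [hpq]
  refine Submodule.add_mem _ ?_
    (Submodule.subset_span ⟨1, fun w => smul_one w, n, y, hy, (one_mul _).symm⟩)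
  rw [← Sym.proj_same ρ hqd]
  exact hI _ hq

/-- Elements of the complements which are linearly independent remain so over the invariants. -/
theorem Sym.harm_independent (hρ : IsComplexReflectionGroup ρ) {N : ℕ} {κ : Fin N → Type*}
    [∀ b, Fintype (κ b)] {y : ∀ b : Fin N, κ b → Sym ρ}
    (hy : ∀ (b : Fin N) (j : κ b), y b j ∈ Sym.harm ρ (2 * (b : ℕ)))
    (hli : ∀ b, LinearIndependent ℂ (y b)) {g : (Σ b, κ b) → Sym ρ}
    (hg : ∀ i, ∀ w : W, w • g i = g i) (hrel : ∑ i, g i * y i.1 i.2 = 0) : g = 0 := by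
  classical
  let e := Fintype.equivFin (Σ b, κ b)
  have h1 := Sym.eq_zero_of_sum_inv_mul hρ (y := fun i => y (e.symm i).1 (e.symm i).2)
    (g := fun i => g (e.symm i)) (fun c hc => ?_) (fun i => hg _) ?_
  · funext i
    simpa using congrFun h1 (e i)
  · have hc' : ∑ b : Fin N, ∑ j : κ b, c (e ⟨b, j⟩) • y b j ∈ Sym.coinvIdeal ρ := by
      have h4 := Fintype.sum_equiv e (fun s => c (e s) • y s.1 s.2)
        (fun i => c i • y (e.symm i).1 (e.symm i).2) fun s =>
          congrArg (fun t : Σ b, κ b => c (e s) • y t.1 t.2) (e.symm_apply_apply s).symm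
      rw [Fintype.sum_sigma] at h4
      exact h4 ▸ hc
    have h2 : ∀ (b : Fin N) (j : κ b), c (e ⟨b, j⟩) = 0 := by
      intro b
      have h3 := Sym.proj_mem_coinvIdeal hc' b
      rw [map_sum, Finset.sum_eq_single b, map_sum] at h3
      · refine Fintype.linearIndependent_iff.1 (hli b) _ (Sym.eq_zero_of_mem_harm
          (Submodule.sum_mem _ fun j _ => Submodule.smul_mem _ _ (hy b j)) ?_)
        convert h3 using 1
        refine Finset.sum_congr rfl fun j _ => ?_
        rw [map_smul, Sym.proj_same ρ (Sym.harm_le_deg _ (hy b j))]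
      · intro b' _ hne
        rw [map_sum]
        refine Finset.sum_eq_zero fun j _ => ?_
        have h4 : (b : ℕ) ≠ b' := fun h => hne (Fin.ext h.symm)
        rw [map_smul, Sym.proj_ne ρ (by omega) (Sym.harm_le_deg _ (hy b' j)), smul_zero]
      · intro h; exact (h (Finset.mem_univ _)).elim
    funext i
    have := h2 (e.symm i).1 (e.symm i).2
    simpa using this
  · rw [← hrel, ← e.symm.sum_comp]

/-- In terms of characters, the polynomial ring is the tensor product of the invariants and of the
complements: the products of a basis of the invariants and bases of the complements form a basis. -/
theorem Sym.character_degRep [FiniteDimensional ℂ h] (hρ : IsComplexReflectionGroup ρ) (n : ℕ)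
    (g : W) : (Sym.degRep ρ (2 * n)).character g =
      ∑ b : Fin (n + 1), (Module.finrank ℂ (Sym.inv ρ (n - b)) : ℂ) *
        (Sym.harmRep ρ (2 * (b : ℕ))).character g := by
  classical
  have hfR := fun a => Sym.finiteDimensional_inv (ρ := ρ) a
  have hfD := fun d => Sym.finiteDimensional_deg ρ d
  have hfH := fun d => Sym.finiteDimensional_harm (ρ := ρ) d
  let R := fun a => Module.finBasis ℂ (Sym.inv ρ a)
  let Y := fun b : Fin (n + 1) => Module.finBasis ℂ (Sym.harm ρ (2 * (b : ℕ)))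
  let v : (Σ b : Fin (n + 1), Fin (Module.finrank ℂ (Sym.inv ρ (n - b))) ×
      Fin (Module.finrank ℂ (Sym.harm ρ (2 * (b : ℕ))))) → Sym.deg ρ (2 * n) :=
    fun s => ⟨(R _ s.2.1 : Sym ρ) * (Y s.1 s.2.2 : Sym ρ), by
      have h1 := Sym.mul_mem_deg ρ (R _ s.2.1).2.1 (Sym.harm_le_deg _ (Y s.1 s.2.2).2)
      have h2 := s.1.2
      rwa [show 2 * ((n - (s.1 : ℕ) : ℕ) : ℤ) + 2 * ((s.1 : ℕ) : ℤ) = 2 * n by omega] at h1⟩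
  have hli : LinearIndependent ℂ v := by
    rw [Fintype.linearIndependent_iff]
    intro c hc
    have h1 := Sym.harm_independent hρ (N := n + 1) (y := fun b j => (Y b j : Sym ρ))
      (fun b j => (Y b j).2)
      (fun b => (Y b).linearIndependent.map' (Submodule.subtype _) (Submodule.ker_subtype _))
      (g := fun i => ∑ k, c ⟨i.1, k, i.2⟩ • (R (n - i.1) k : Sym ρ))
      (fun i w => by
        rw [Finset.smul_sum]
        exact Finset.sum_congr rfl fun k _ => by rw [smul_comm, (R _ k).2.2])
      (by
        have h2 : ((∑ s, c s • v s : Sym.deg ρ (2 * n)) : Sym ρ) = 0 := congrArg Subtype.val hc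
        rw [Submodule.coe_sum, Fintype.sum_sigma] at h2
        rw [Fintype.sum_sigma, ← h2]
        refine Finset.sum_congr rfl fun b _ => ?_
        rw [Fintype.sum_prod_type_right]
        refine Finset.sum_congr rfl fun j _ => ?_
        rw [Finset.sum_mul]
        refine Finset.sum_congr rfl fun k _ => ?_
        rw [smul_mul_assoc]
        rfl)
    rintro ⟨b, k, j⟩
    refine Fintype.linearIndependent_iff.1 (R (n - b)).linearIndependent
      (fun k => c ⟨b, k, j⟩) (Subtype.ext ?_) k
    have h2 := congrFun h1 ⟨b, j⟩
    rw [Submodule.coe_sum]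
    exact h2
  -- the component of degree `n` of `r * y` is the product of `y` and of a component of `r`
  have hspan : ∀ p ∈ Sym.invSpan ρ, Sym.proj ρ (2 * n) p ∈
      (Submodule.span ℂ (Set.range v)).map (Sym.deg ρ (2 * n)).subtype := by
    intro p hp
    induction hp using Submodule.span_induction with
    | zero => rw [map_zero]; exact Submodule.zero_mem _
    | add p q _ _ hp hq => rw [map_add]; exact Submodule.add_mem _ hp hq
    | smul c p _ hp => rw [map_smul]; exact Submodule.smul_mem _ c hp
    | mem p hp =>
      obtain ⟨r, hr, b, y, hy, rfl⟩ := hp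
      rw [Sym.proj_mul]
      refine Submodule.sum_mem _ fun i hi => ?_
      rw [Finset.HasAntidiagonal.mem_antidiagonal] at hi
      by_cases hb : i.2 = b
      · subst hb
        obtain ⟨a, b⟩ := i
        obtain rfl : a = n - b := by omega
        have hr' : Sym.proj ρ (2 * ((n - b : ℕ) : ℤ)) r ∈ Sym.inv ρ (n - b) :=
          ⟨Sym.proj_mem ρ _ _, fun w => by rw [← Sym.proj_smul, hr]⟩
        rw [Sym.proj_same ρ (Sym.harm_le_deg _ hy)]
        let b' : Fin (n + 1) := ⟨b, by omega⟩
        have e1 := (R (n - b)).sum_repr ⟨_, hr'⟩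
        have e2 := (Y b').sum_repr ⟨y, hy⟩
        have e1' := congrArg (Submodule.subtype _) e1
        have e2' := congrArg (Submodule.subtype _) e2
        rw [map_sum] at e1' e2'
        have e3 := congrArg₂ (· * ·) e1' e2'
        change _ = Sym.proj ρ (2 * ((n - b : ℕ) : ℤ)) r * y at e3
        rw [← e3]
        rw [Finset.sum_mul_sum]
        refine Submodule.sum_mem _ fun k _ => Submodule.sum_mem _ fun j _ => ?_
        rw [map_smul, map_smul, smul_mul_smul_comm]
        exact Submodule.smul_mem _ _ ⟨v ⟨b', k, j⟩, Submodule.subset_span ⟨_, rfl⟩, rfl⟩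
      · rw [Sym.proj_ne ρ (by omega) (Sym.harm_le_deg _ hy), mul_zero]
        exact Submodule.zero_mem _
  have hsp : ⊤ ≤ Submodule.span ℂ (Set.range v) := by
    intro p _
    have h1 := hspan p (Sym.deg_le_invSpan n p.2)
    rw [Sym.proj_same ρ p.2] at h1
    obtain ⟨q, hq, hqp⟩ := h1
    rwa [← show q = p from Subtype.ext hqp]
  let B := Module.Basis.mk hli hsp
  have hB : ∀ s, B s = v s := Module.Basis.mk_apply hli hsp
  -- the action on the basis only involves the second factor, as the first one is invariant
  have hgv : ∀ b k j, Sym.degRep ρ (2 * n) g (v ⟨b, k, j⟩) =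
      ∑ i, (Y b).repr (Sym.harmRep ρ (2 * (b : ℕ)) g (Y b j)) i •
        B ⟨b, k, i⟩ := by
    intro b k j
    have e2 := congrArg (Submodule.subtype _)
      ((Y b).sum_repr (Sym.harmRep ρ (2 * (b : ℕ)) g (Y b j)))
    refine Subtype.ext ?_
    rw [Sym.degRep_coe]
    change g • ((R (n - b) k : Sym ρ) * (Y b j : Sym ρ)) = _
    rw [smul_mul', (R (n - b) k).2.2]
    change (R (n - b) k : Sym ρ) * (Submodule.subtype _)
      (Sym.harmRep ρ (2 * (b : ℕ)) g (Y b j)) = _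
    rw [← e2, map_sum, Finset.mul_sum, Submodule.coe_sum]
    refine Finset.sum_congr rfl fun i _ => ?_
    rw [map_smul, mul_smul_comm, hB]
    rfl
  rw [Representation.character, LinearMap.trace_eq_matrix_trace ℂ B, Matrix.trace,
    Fintype.sum_sigma]
  refine Finset.sum_congr rfl fun b _ => ?_
  rw [Fintype.sum_prod_type, Representation.character, LinearMap.trace_eq_matrix_trace ℂ (Y b),
    Matrix.trace]
  have hdiag : ∀ k j, (LinearMap.toMatrix B B (Sym.degRep ρ (2 * n) g)).diag ⟨b, k, j⟩ =
      (LinearMap.toMatrix (Y b) (Y b) (Sym.harmRep ρ (2 * (b : ℕ)) g)).diag j := by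
    intro k j
    rw [Matrix.diag_apply, Matrix.diag_apply, LinearMap.toMatrix_apply, LinearMap.toMatrix_apply,
      hB, hgv, map_sum, Finsupp.finsetSum_apply, Finset.sum_eq_single j]
    · rw [map_smul, Module.Basis.repr_self, Finsupp.smul_apply, Finsupp.single_eq_same, smul_eq_mul,
        mul_one]
    · intro i _ hij
      rw [map_smul, Module.Basis.repr_self, Finsupp.smul_apply, Finsupp.single_eq_of_ne, smul_zero]
      intro heq
      simp only [Sigma.mk.injEq, heq_eq_eq, Prod.mk.injEq, true_and] at heq
      exact hij heq.symm
    · intro h; exact (h (Finset.mem_univ _)).elim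
  simp only [hdiag]
  rw [Finset.sum_const, Finset.card_univ, Fintype.card_fin, nsmul_eq_mul]

end Freeness

/-! ### Characters of `P_χ` and of the coinvariant module -/

open scoped TensorProduct

section Coinvariants

theorem character_of_tprod_equiv {W : Type*} [Group W] {V₁ V₂ V₃ : Type*} [AddCommGroup V₁] [Module ℂ V₁]
    [FiniteDimensional ℂ V₁] [AddCommGroup V₂] [Module ℂ V₂] [FiniteDimensional ℂ V₂]
    [AddCommGroup V₃] [Module ℂ V₃] {σ₁ : Representation ℂ W V₁} {σ₂ : Representation ℂ W V₂}
    {σ₃ : Representation ℂ W V₃} (e : (σ₁.tprod σ₂).Equiv σ₃) (g : W) :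
    σ₃.character g = σ₁.character g * σ₂.character g := by
  rw [← Representation.char_iso e, Representation.char_tensor, Pi.mul_apply]

variable {W : Type u} [Group W] {h : Type u} [AddCommGroup h] [Module ℂ h]
variable {ρ : Representation ℂ W h}

theorem AW.mk_mul_mk (p q : Sym ρ) (v w : W) :
    (AW.mk p v * AW.mk q w : AW ρ) = AW.mk (p * v • q) (v * w) := by
  rw [AW.mk, AW.mk, AW.mk, SkewMonoidAlgebra.single_mul_single]

theorem AW.mk_eq_mul (p : Sym ρ) (w : W) : (AW.mk p w : AW ρ) = AW.mk p 1 * AW.mk 1 w := by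
  rw [AW.mk_mul_mk, one_smul, mul_one, one_mul]

theorem AW.mk_one_mul (p : Sym ρ) (w : W) :
    (AW.mk 1 w * AW.mk p 1 : AW ρ) = AW.mk (w • p) 1 * AW.mk 1 w := by
  rw [AW.mk_mul_mk, AW.mk_mul_mk, one_smul, mul_one, one_mul, mul_one, one_mul]

theorem AW.mk_add (p q : Sym ρ) (w : W) : (AW.mk (p + q) w : AW ρ) = AW.mk p w + AW.mk q w :=
  SkewMonoidAlgebra.single_add _ _ _

theorem AW.mk_smul (c : ℂ) (p : Sym ρ) (w : W) : (AW.mk (c • p) w : AW ρ) = c • AW.mk p w :=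
  (SkewMonoidAlgebra.smul_single _ _ _).symm

theorem AW.mk_zero (w : W) : (AW.mk 0 w : AW ρ) = 0 := SkewMonoidAlgebra.single_zero _

theorem AW.coeff_mk_mul (p : Sym ρ) (a : AW ρ) (w : W) :
    (AW.mk p 1 * a).coeff w = p * a.coeff w := by
  classical
  induction a using AW.ind with
  | mk q v =>
    rw [AW.mk_mul_mk, one_smul, one_mul, AW.mk, AW.mk, SkewMonoidAlgebra.coeff_single_apply,
      SkewMonoidAlgebra.coeff_single_apply, mul_ite, mul_zero]
  | add a b ha hb =>
    rw [mul_add, SkewMonoidAlgebra.coeff_add, SkewMonoidAlgebra.coeff_add, Finsupp.add_apply,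
      Finsupp.add_apply, ha, hb, mul_add]

variable (ρ) in
/-- The linear map `A_W → ℂ[h*]` which sends `p w` to `p`. -/
def AW.aug : AW ρ →ₗ[ℂ] Sym ρ :=
  (Finsupp.lsum ℂ fun _ : W => LinearMap.id) ∘ₗ
    (SkewMonoidAlgebra.coeffLinearEquiv (S := ℂ)).toLinearMap

theorem AW.aug_mk (p : Sym ρ) (w : W) : AW.aug ρ (AW.mk p w) = p := by
  simp only [AW.aug, LinearMap.comp_apply]
  erw [Finsupp.lsum_single]
  rfl

theorem AW.aug_mk_mul (p : Sym ρ) (w : W) (a : AW ρ) :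
    AW.aug ρ (AW.mk p w * a) = p * w • AW.aug ρ a := by
  induction a using AW.ind with
  | mk q v => rw [AW.mk_mul_mk, AW.aug_mk, AW.aug_mk]
  | add a b ha hb => rw [mul_add, map_add, ha, hb, map_add, smul_add, mul_add]

theorem AW.aug_mem {d : ℤ} {a : AW ρ} (ha : a ∈ AW.deg ρ d) : AW.aug ρ a ∈ Sym.deg ρ d := by
  have h1 : a = ∑ w ∈ a.support, AW.mk (a.coeff w) w := by
    conv_lhs => rw [← SkewMonoidAlgebra.sum_single a, SkewMonoidAlgebra.sum_def]
    rfl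
  rw [h1, map_sum]
  exact Submodule.sum_mem _ fun w _ => by rw [AW.aug_mk]; exact ha w

variable [Finite W]

namespace GrMod

theorem smul_projZeroEquiv (χ : Irr W) (w : W) (v : χ.L.V) :
    (AW.mk 1 w : AW ρ) • (projZeroEquiv ρ χ v : projCover ρ χ) =
      (projZeroEquiv ρ χ (χ.L.rep w v) : projCover ρ χ) :=
  (congrArg Subtype.val (LinearMap.congr_fun ((projZeroEquiv ρ χ).isIntertwining' w) v)).symm

theorem projZeroEquiv_idemVec (χ : Irr W) :
    (projZeroEquiv ρ χ (χ.L.rep.asModuleEquiv (idemVec χ)) : projCover ρ χ) = projGen ρ χ :=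
  irrHom_idemVec ⟨projGen ρ χ, projGen_mem χ⟩

theorem projIncl_projZeroEquiv (χ : Irr W) (v : χ.L.rep.asModule) :
    projIncl ρ χ (projZeroEquiv ρ χ (χ.L.rep.asModuleEquiv v) : projCover ρ χ) =
      AW.ofGroupAlgebra ρ (idealEquiv χ v) := by
  change projIncl ρ χ (AW.ofGroupAlgebra ρ (idealEquiv χ v) • projGen ρ χ) = _
  rw [map_smul, projIncl_projGen, idemA, smul_eq_mul, ← map_mul, mul_idem (idealEquiv χ v).2]

/-- The embedding of `L_χ` in the group algebra as the left ideal generated by `e_χ`. -/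
def idealIncl (χ : Irr W) : χ.L.V →ₗ[ℂ] MonoidAlgebra ℂ W where
  toFun v := idealEquiv χ (χ.L.rep.asModuleEquiv.symm v)
  map_add' v w := by rw [map_add, map_add, Submodule.coe_add]
  map_smul' c v := by
    rw [Representation.asModuleEquiv_symm_map_smul, map_smul, Submodule.coe_smul, smul_eq_mul,
      ← Algebra.smul_def]
    rfl

theorem idealIncl_injective (χ : Irr W) : Function.Injective (idealIncl χ) := fun _ _ hvw =>
  χ.L.rep.asModuleEquiv.symm.injective ((idealEquiv χ).injective (Subtype.ext hvw))

/-- The multiplication `ℂ[h*]_d ⊗ L_χ → (P_χ)_d`. -/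
def projMul (ρ : Representation ℂ W h) (χ : Irr W) (d : ℤ) :
    Representation.IntertwiningMap ((Sym.degRep ρ d).tprod χ.L.rep)
      ((projCover ρ χ).degRep d) where
  toLinearMap := TensorProduct.lift (LinearMap.mk₂ ℂ
    (fun (p : Sym.deg ρ d) (v : χ.L.V) =>
      (⟨(AW.mk (p : Sym ρ) 1 : AW ρ) • (projZeroEquiv ρ χ v : projCover ρ χ), by
        have := (projCover ρ χ).smul_mem (AW.mk_mem ρ p.2 1) (projZeroEquiv ρ χ v).2
        rwa [add_zero] at this⟩ : (projCover ρ χ).deg d))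
    (fun p q v => Subtype.ext (by
      change (AW.mk ((p : Sym ρ) + q) 1 : AW ρ) • _ = _
      rw [AW.mk_add, add_smul]; rfl))
    (fun c p v => Subtype.ext (by
      change (AW.mk (c • (p : Sym ρ)) 1 : AW ρ) • _ = _
      rw [AW.mk_smul, smul_assoc]; rfl))
    (fun p v w => Subtype.ext (by
      dsimp only
      rw [map_add, Submodule.coe_add, smul_add]; rfl))
    (fun c p v => Subtype.ext (by
      dsimp only
      rw [map_smul, Submodule.coe_smul, smul_comm]; rfl)))
  isIntertwining' w := TensorProduct.ext' fun p v => Subtype.ext (by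
    change (AW.mk (w • (p : Sym ρ)) 1 : AW ρ) • (projZeroEquiv ρ χ (χ.L.rep w v) : projCover ρ χ) =
      (AW.mk 1 w : AW ρ) • (AW.mk (p : Sym ρ) 1 : AW ρ) • (projZeroEquiv ρ χ v : projCover ρ χ)
    rw [smul_smul, AW.mk_one_mul, ← smul_smul, smul_projZeroEquiv])

theorem projMul_tmul (χ : Irr W) (d : ℤ) (p : Sym.deg ρ d) (v : χ.L.V) :
    (projMul ρ χ d (p ⊗ₜ v) : projCover ρ χ) =
      (AW.mk (p : Sym ρ) 1 : AW ρ) • (projZeroEquiv ρ χ v : projCover ρ χ) := rfl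

theorem projMul_surjective (χ : Irr W) (d : ℤ) : Function.Surjective (projMul ρ χ d) := by
  intro x
  have hx : projIncl ρ χ x.1 ∈ AW.deg ρ d := projIncl_mem.2 x.2
  set a := projIncl ρ χ x.1 with ha
  have h1 : a = ∑ w ∈ a.support, AW.mk (a.coeff w) w := by
    conv_lhs => rw [← SkewMonoidAlgebra.sum_single a, SkewMonoidAlgebra.sum_def]
    rfl
  refine ⟨∑ w ∈ a.support, (⟨a.coeff w, hx w⟩ : Sym.deg ρ d) ⊗ₜ[ℂ]
    χ.L.rep w (χ.L.rep.asModuleEquiv (idemVec χ)), Subtype.ext ?_⟩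
  rw [← projIncl_smul_projGen x.1, ← ha, map_sum, Submodule.coe_sum]
  conv_rhs => rw [h1]
  rw [Finset.sum_smul]
  refine Finset.sum_congr rfl fun w _ => ?_
  rw [projMul_tmul, AW.mk_eq_mul (a.coeff w) w, mul_smul, ← projZeroEquiv_idemVec, smul_projZeroEquiv]

theorem projMul_injective (χ : Irr W) (d : ℤ) : Function.Injective (projMul ρ χ d) := by
  classical
  let b := Module.finBasis ℂ χ.L.V
  rw [injective_iff_map_eq_zero]
  intro t ht
  obtain ⟨p, rfl⟩ := (TensorProduct.equivFinsuppOfBasisRight (M := Sym.deg ρ d) b).symm.surjective t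
  suffices hp : ∀ i, p i = 0 by rw [show p = 0 from Finsupp.ext hp, map_zero]
  rw [TensorProduct.equivFinsuppOfBasisRight_symm_apply, Finsupp.sum_fintype p (fun i m => m ⊗ₜ[ℂ] b i)
    (fun i => TensorProduct.zero_tmul _ _), map_sum] at ht
  let x : Fin (Module.finrank ℂ χ.L.V) → MonoidAlgebra ℂ W := fun i =>
    idealEquiv χ (χ.L.rep.asModuleEquiv.symm (b i))
  have h1 : ∑ i, AW.mk (p i : Sym ρ) 1 * AW.ofGroupAlgebra ρ (x i) = 0 := by
    have h2 := congrArg (fun y : (projCover ρ χ).deg d => projIncl ρ χ y.1) ht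
    rw [Submodule.coe_sum, map_sum, Submodule.coe_zero, map_zero] at h2
    rw [← h2]
    refine Finset.sum_congr rfl fun i _ => ?_
    rw [projMul_tmul, map_smul, smul_eq_mul]
    congr 1
    exact (projIncl_projZeroEquiv χ (χ.L.rep.asModuleEquiv.symm (b i))).symm
  have hx : LinearIndependent ℂ x :=
    b.linearIndependent.map' (idealIncl χ) (LinearMap.ker_eq_bot.2 (idealIncl_injective χ))
  intro i
  refine Subtype.ext ((Module.forall_dual_apply_eq_zero_iff ℂ _).1 fun f => ?_)
  refine Fintype.linearIndependent_iff.1 hx (fun i => f (p i)) ?_ i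
  ext w
  have h2 := congrArg (fun a => f (SkewMonoidAlgebra.coeffLinearEquiv (S := ℂ) a w)) h1
  rw [map_sum, Finsupp.finsetSum_apply, map_sum, map_zero, Finsupp.zero_apply, map_zero] at h2
  change (MonoidAlgebra.coeff _) w = 0
  rw [MonoidAlgebra.coeff_sum, Finsupp.finsetSum_apply, ← h2]
  refine Finset.sum_congr rfl fun i _ => ?_
  change f (p i) * (x i).coeff w = f ((AW.mk (p i : Sym ρ) 1 * AW.ofGroupAlgebra ρ (x i)).coeff w)
  rw [AW.coeff_mk_mul, AW.coeff_ofGroupAlgebra, mul_comm (p i : Sym ρ), ← Algebra.smul_def,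
    map_smul, smul_eq_mul, mul_comm]

/-- The part of degree `d` of `P_χ` is `ℂ[h*]_d ⊗ L_χ`. -/
theorem character_projCover [FiniteDimensional ℂ h] (χ : Irr W) (d : ℤ) (g : W) :
    ((projCover ρ χ).degRep d).character g =
      (Sym.degRep ρ d).character g * χ.L.rep.character g := by
  have := Sym.finiteDimensional_deg ρ d
  exact character_of_tprod_equiv ((projMul ρ χ d).ofBijective
    ⟨projMul_injective χ d, projMul_surjective χ d⟩) g

omit [Finite W] in
theorem triv_rep_apply (w : W) (v : (Irr.triv W).L.V) : (Irr.triv W).L.rep w v = v := by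
  obtain ⟨e⟩ : Nonempty ((Irr.triv W).L.rep.Equiv (Representation.trivial ℂ W ℂ)) :=
    Quotient.exact (Quotient.out_eq (Irr.triv W))
  exact e.injective (LinearMap.congr_fun (e.isIntertwining' w) v)

/-- Since `w e_triv = e_triv`, the module `P_triv` is `ℂ[h*] e_triv`. -/
theorem smul_projGen_triv (a : AW ρ) :
    a • projGen ρ (Irr.triv W) = (AW.mk (AW.aug ρ a) 1 : AW ρ) • projGen ρ (Irr.triv W) := by
  induction a using AW.ind with
  | mk p w =>
    rw [AW.aug_mk, AW.mk_eq_mul p w, mul_smul]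
    congr 1
    rw [← projZeroEquiv_idemVec, smul_projZeroEquiv, triv_rep_apply]
  | add a b ha hb => rw [add_smul, ha, hb, map_add, AW.mk_add, add_smul]

theorem aug_idemA_triv : AW.aug ρ (idemA ρ (Irr.triv W)) = 1 := by
  have h0 : idemA ρ (Irr.triv W) ≠ 0 := fun h0 =>
    projGen_ne_zero (ρ := ρ) (Irr.triv W)
      (projIncl_injective _ (by rw [projIncl_projGen, h0, map_zero]))
  have h1 : idemA ρ (Irr.triv W) =
      AW.mk (AW.aug ρ (idemA ρ (Irr.triv W))) 1 * idemA ρ (Irr.triv W) := by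
    have := congrArg (projIncl ρ _) (smul_projGen_triv (idemA ρ (Irr.triv W)))
    rw [map_smul, map_smul, projIncl_projGen, smul_eq_mul, idemA_mul_self] at this
    exact this
  obtain ⟨w, hw⟩ : ∃ w, (idemA ρ (Irr.triv W)).coeff w ≠ 0 := by
    by_contra hn
    push Not at hn
    exact h0 (by ext w; exact hn w)
  have h2 := congrArg (fun a : AW ρ => a.coeff w) h1
  rw [AW.coeff_mk_mul] at h2
  -- `Sym ρ` is a domain
  exact mul_right_cancel₀ hw (by rw [one_mul]; exact h2.symm)

theorem aug_mk_smul_projGen (p : Sym ρ) :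
    AW.aug ρ (projIncl ρ (Irr.triv W) ((AW.mk p 1 : AW ρ) • projGen ρ (Irr.triv W))) = p := by
  rw [map_smul, projIncl_projGen, smul_eq_mul, AW.aug_mk_mul, one_smul, aug_idemA_triv, mul_one]

theorem aug_mem_coinvIdeal {x : projCover ρ (Irr.triv W)} (hx : x ∈ JM ρ (projCover ρ (Irr.triv W))) :
    AW.aug ρ (projIncl ρ (Irr.triv W) x) ∈ Sym.coinvIdeal ρ := by
  induction hx using Submodule.span_induction with
  | mem x hx =>
    obtain ⟨p, hp, m, rfl⟩ := hx
    rw [map_smul, smul_eq_mul, AW.aug_mk_mul]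
    exact Ideal.mul_mem_right _ _ (Ideal.subset_span hp)
  | zero => rw [map_zero, map_zero]; exact Submodule.zero_mem _
  | add x y _ _ hx hy => rw [map_add, map_add]; exact Submodule.add_mem _ hx hy
  | smul a x _ hx =>
    rw [map_smul, smul_eq_mul]
    induction a using AW.ind with
    | mk q w =>
      rw [AW.aug_mk_mul]
      exact Ideal.mul_mem_left _ _ (Sym.smul_mem_coinvIdeal w hx)
    | add a b ha hb => rw [add_mul, map_add]; exact Submodule.add_mem _ ha hb

theorem mk_smul_projGen_mem_JM {p : Sym ρ} (hp : p ∈ Sym.coinvIdeal ρ) :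
    (AW.mk p 1 : AW ρ) • projGen ρ (Irr.triv W) ∈ JM ρ (projCover ρ (Irr.triv W)) := by
  induction hp using Submodule.closure_induction with
  | zero => rw [AW.mk_zero, zero_smul]; exact Submodule.zero_mem _
  | add x y _ _ hx hy => rw [AW.mk_add, add_smul]; exact Submodule.add_mem _ hx hy
  | smul_mem r x hx =>
    refine Submodule.subset_span ⟨x, hx, (AW.mk r 1 : AW ρ) • projGen ρ (Irr.triv W), ?_⟩
    rw [smul_smul, AW.mk_mul_mk, one_smul, one_mul, smul_eq_mul, mul_comm]

variable (ρ) in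
/-- The map `y ↦ y e_triv` from the harmonic complement to the coinvariant module. -/
def harmMap (d : ℤ) : Representation.IntertwiningMap (Sym.harmRep ρ d)
    ((projCover0 ρ (Irr.triv W)).degRep d) where
  toLinearMap :=
    { toFun y := ⟨(JM ρ (projCover ρ (Irr.triv W))).mkQ
          ((AW.mk (y : Sym ρ) 1 : AW ρ) • projGen ρ (Irr.triv W)),
        (AW.mk (y : Sym ρ) 1 : AW ρ) • projGen ρ (Irr.triv W), by
          have := (projCover ρ (Irr.triv W)).smul_mem (AW.mk_mem ρ (Sym.harm_le_deg d y.2) 1)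
            (projGen_mem (Irr.triv W)).1
          rwa [add_zero] at this, rfl⟩
      map_add' y z := Subtype.ext (by
        dsimp only
        rw [Submodule.coe_add, AW.mk_add, add_smul, map_add]; rfl)
      map_smul' c y := Subtype.ext (by
        dsimp only
        rw [Submodule.coe_smul, AW.mk_smul, smul_assoc]; rfl) }
  isIntertwining' w := LinearMap.ext fun y => Subtype.ext (by
    change (JM ρ (projCover ρ (Irr.triv W))).mkQ
      ((AW.mk (w • (y : Sym ρ)) 1 : AW ρ) • projGen ρ (Irr.triv W)) =
      (AW.mk 1 w : AW ρ) • (JM ρ (projCover ρ (Irr.triv W))).mkQ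
        ((AW.mk (y : Sym ρ) 1 : AW ρ) • projGen ρ (Irr.triv W))
    rw [← map_smul, smul_smul, smul_projGen_triv (AW.mk 1 w * _), AW.aug_mk_mul, AW.aug_mk,
      one_mul])

theorem harmMap_bijective (d : ℤ) : Function.Bijective (harmMap ρ d) := by
  constructor
  · rw [injective_iff_map_eq_zero]
    intro y hy
    have h1 : (JM ρ (projCover ρ (Irr.triv W))).mkQ
        ((AW.mk (y : Sym ρ) 1 : AW ρ) • projGen ρ (Irr.triv W)) = 0 := congrArg Subtype.val hy
    have h2 := aug_mem_coinvIdeal ((Submodule.Quotient.mk_eq_zero _).1 h1)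
    rw [aug_mk_smul_projGen] at h2
    exact Subtype.ext (Sym.eq_zero_of_mem_harm y.2 h2)
  · rintro ⟨_, x, hx, rfl⟩
    obtain ⟨y, hy, q, -, hq, hp⟩ := Sym.exists_harm_add (AW.aug_mem (projIncl_mem.2 hx))
    refine ⟨⟨y, hy⟩, Subtype.ext ?_⟩
    change (JM ρ (projCover ρ (Irr.triv W))).mkQ _ = (JM ρ (projCover ρ (Irr.triv W))).mkQ x
    rw [← projIncl_smul_projGen x, smul_projGen_triv (projIncl ρ _ x), hp, AW.mk_add, add_smul, map_add,
      show (JM ρ (projCover ρ (Irr.triv W))).mkQ ((AW.mk q 1 : AW ρ) • projGen ρ (Irr.triv W)) = 0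
        from (Submodule.Quotient.mk_eq_zero _).2 (mk_smul_projGen_mem_JM hq), zero_add]

/-- The coinvariant module `C_triv` is in each degree a complement of the ideal generated by the
invariants vanishing at `0`. -/
theorem character_projCover0_triv (d : ℤ) :
    ((projCover0 ρ (Irr.triv W)).degRep d).character = (Sym.harmRep ρ d).character :=
  (Representation.char_iso ((harmMap ρ d).ofBijective (harmMap_bijective d))).symm

variable [FiniteDimensional ℂ h]

variable (ρ) in
theorem projCover0_locFinite (χ : Irr W) : (projCover0 ρ χ).LocFinite :=
  (projCover_locFinite χ).of_surjective (quotπ _ _ _) (Submodule.mkQ_surjective _)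

/-- The multiplicities of `P_η` are the products of the dimensions of the spaces of invariants and of
the multiplicities of `C_triv`, that is the entries of `Ω`. -/
theorem mdim_projCover (hρ : IsComplexReflectionGroup ρ) (χ η : Irr W) (n : ℕ) :
    (projCover ρ η).mdim χ (2 * n) = ∑ x ∈ Finset.HasAntidiagonal.antidiagonal n,
      Module.finrank ℂ (Sym.inv ρ x.1) * Module.finrank ℂ
        ((projCover0 ρ (Irr.triv W)).homW (χ.L.rep.tprod η.dual.L.rep) (2 * x.2)) := by
  classical
  have := Fintype.ofFinite W
  have h1 := finrank_homW_char (projCover_locFinite (ρ := ρ) η) χ.L.rep (2 * n)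
  have h2 := fun b : ℕ => finrank_homW_char (projCover0_locFinite ρ (Irr.triv W))
    (χ.L.rep.tprod η.dual.L.rep) (2 * b)
  rw [finrank_homW] at h1
  have h3 : ((projCover ρ η).mdim χ (2 * n) : ℂ) = ∑ b : Fin (n + 1),
      (Module.finrank ℂ (Sym.inv ρ (n - b)) : ℂ) * (Module.finrank ℂ
        ((projCover0 ρ (Irr.triv W)).homW (χ.L.rep.tprod η.dual.L.rep) (2 * (b : ℕ))) : ℂ) := by
    rw [h1]
    simp only [h2, character_projCover, Sym.character_degRep hρ, character_projCover0_triv,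
      Representation.char_tensor, Pi.mul_apply, Irr.character_dual, inv_inv, Finset.mul_sum,
      Finset.sum_mul]
    rw [Finset.sum_comm]
    exact Finset.sum_congr rfl fun b _ => Finset.sum_congr rfl fun g _ => by ring
  rw [Finset.Nat.sum_antidiagonal_eq_sum_range_succ_mk, ← Finset.sum_range_reflect,
    ← Fin.sum_univ_eq_sum_range (fun j => Module.finrank ℂ (Sym.inv ρ (n + 1 - 1 - j)) *
      Module.finrank ℂ ((projCover0 ρ (Irr.triv W)).homW (χ.L.rep.tprod η.dual.L.rep)
        (2 * ((n - (n + 1 - 1 - j) : ℕ) : ℤ)))) (n + 1)]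
  apply Nat.cast_injective (R := ℂ)
  rw [h3, Nat.cast_sum]
  refine Finset.sum_congr rfl fun b _ => ?_
  have hb := b.2
  rw [Nat.cast_mul, show n + 1 - 1 - (b : ℕ) = n - b by omega, show n - (n - (b : ℕ)) = b by omega]

end GrMod

end Coinvariants

/-! ### Block unitriangular matrices -/

section BlockMatrices

variable {n α R : Type*} [Fintype n] [DecidableEq n] [LinearOrder α] [CommRing R]

/-- Block upper triangular matrices whose diagonal blocks are identity matrices. -/
structure IsBlockUni (b : n → α) (U : Matrix n n R) : Prop where
  lower : ∀ i j, b j < b i → U i j = 0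
  diag : ∀ i j, b i = b j → U i j = (1 : Matrix n n R) i j

/-- Block diagonal matrices. -/
def IsBlockDiag (b : n → α) (D : Matrix n n R) : Prop := ∀ i j, b i ≠ b j → D i j = 0

variable {b : n → α} {U V D : Matrix n n R}

omit [Fintype n] in
theorem IsBlockUni.blockTriangular (hU : IsBlockUni b U) : U.BlockTriangular b :=
  fun i j hij => hU.lower i j hij

theorem IsBlockUni.det (hU : IsBlockUni b U) : U.det = 1 := by
  rw [hU.blockTriangular.det]
  refine Finset.prod_eq_one fun a _ => ?_
  have : U.toSquareBlock b a = 1 := by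
    ext i j
    have := hU.diag i j (i.2.trans j.2.symm)
    simp only [Matrix.toSquareBlock_def, Matrix.of_apply, this, Matrix.one_apply, Subtype.ext_iff]
  rw [this, Matrix.det_one]

theorem IsBlockUni.isUnit_det (hU : IsBlockUni b U) : IsUnit U.det := hU.det ▸ isUnit_one

theorem IsBlockUni.mul_apply (hU : IsBlockUni b U) (hV : V.BlockTriangular b) {i j : n}
    (hij : b i = b j) : (U * V) i j = V i j := by
  rw [Matrix.mul_apply, Finset.sum_eq_single i, hU.diag i i rfl, Matrix.one_apply_eq, one_mul]
  · intro k _ hk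
    rcases lt_trichotomy (b k) (b i) with h | h | h
    · rw [hU.lower _ _ h, zero_mul]
    · rw [hU.diag _ _ h.symm, Matrix.one_apply_ne hk.symm, zero_mul]
    · rw [hV (hij ▸ h), mul_zero]
  · intro h; exact (h (Finset.mem_univ _)).elim

theorem IsBlockUni.mul (hU : IsBlockUni b U) (hV : IsBlockUni b V) : IsBlockUni b (U * V) where
  lower _ _ hij := hU.blockTriangular.mul hV.blockTriangular hij
  diag _ _ hij := (hU.mul_apply hV.blockTriangular hij).trans (hV.diag _ _ hij)

theorem IsBlockUni.inv (hU : IsBlockUni b U) : IsBlockUni b U⁻¹ := by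
  have := U.invertibleOfIsUnitDet hU.isUnit_det
  have h1 : U⁻¹.BlockTriangular b := Matrix.blockTriangular_inv_of_blockTriangular hU.blockTriangular
  exact ⟨fun _ _ hij => h1 hij, fun i j hij => by
    rw [← hU.mul_apply h1 hij, Matrix.mul_nonsing_inv U hU.isUnit_det]⟩

theorem IsBlockDiag.inv (hD : IsBlockDiag b D) (hu : IsUnit D.det) : IsBlockDiag b D⁻¹ := by
  have := D.invertibleOfIsUnitDet hu
  have h1 : D⁻¹.BlockTriangular b :=
    Matrix.blockTriangular_inv_of_blockTriangular fun i j hij => hD i j hij.ne'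
  have h2 : D⁻¹.BlockTriangular (OrderDual.toDual ∘ b) :=
    Matrix.blockTriangular_inv_of_blockTriangular fun i j hij =>
      hD i j (ne_of_lt (OrderDual.toDual_lt_toDual.1 hij))
  intro i j hij
  rcases lt_or_gt_of_ne hij with h | h
  · exact h2 (OrderDual.toDual_lt_toDual.2 h)
  · exact h1 h

/-- The product of a block diagonal matrix and a block unitriangular one has the same diagonal
blocks. -/
theorem IsBlockDiag.mul_apply (hD : IsBlockDiag b D) (hU : IsBlockUni b U) {i j : n}
    (hij : b i = b j) : (D * U) i j = D i j := by
  rw [Matrix.mul_apply, Finset.sum_eq_single j, hU.diag j j rfl, Matrix.one_apply_eq, mul_one]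
  · intro k _ hk
    by_cases h : b i = b k
    · rw [hU.diag k j (h.symm.trans hij), Matrix.one_apply_ne hk, mul_zero]
    · rw [hD _ _ h, zero_mul]
  · intro h; exact (h (Finset.mem_univ _)).elim

theorem IsBlockDiag.mul_lower (hD : IsBlockDiag b D) (hU : IsBlockUni b U) {i j : n}
    (hij : b j < b i) : (D * U) i j = 0 := by
  rw [Matrix.mul_apply]
  refine Finset.sum_eq_zero fun k _ => ?_
  by_cases h : b i = b k
  · rw [hU.lower k j (h ▸ hij), mul_zero]
  · rw [hD _ _ h, zero_mul]

omit [Fintype n] [DecidableEq n] [LinearOrder α] in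
theorem IsBlockDiag.transpose (hD : IsBlockDiag b D) : IsBlockDiag b D.transpose :=
  fun i j hij => hD j i hij.symm

/-- A matrix has at most one decomposition `ᵗU D V` with `U`, `V` block unitriangular and `D` block
diagonal and invertible. -/
theorem blockDecomposition_unique {U' V' D' : Matrix n n R} (hU : IsBlockUni b U)
    (hV : IsBlockUni b V) (hD : IsBlockDiag b D) (hU' : IsBlockUni b U') (hV' : IsBlockUni b V')
    (hD' : IsBlockDiag b D') (hdet : IsUnit D.det)
    (h : U'.transpose * D' * V' = U.transpose * D * V) : U' = U ∧ V' = V ∧ D' = D := by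
  have hZ := hU.mul hU'.inv
  have hY := hV'.mul hV.inv
  -- both sides of this identity are triangular, in opposite directions
  have key : (U * U'⁻¹).transpose * D = D' * (V' * V⁻¹) := by
    have h1 : U'⁻¹.transpose * U'.transpose = 1 := by
      rw [← Matrix.transpose_mul, Matrix.mul_nonsing_inv _ hU'.isUnit_det, Matrix.transpose_one]
    calc (U * U'⁻¹).transpose * D
        = U'⁻¹.transpose * (U.transpose * D * V) * V⁻¹ := by
          rw [Matrix.transpose_mul]
          simp only [Matrix.mul_assoc]
          rw [Matrix.mul_nonsing_inv V hV.isUnit_det, Matrix.mul_one]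
      _ = (U'⁻¹.transpose * U'.transpose) * D' * V' * V⁻¹ := by
          rw [← h]; simp only [Matrix.mul_assoc]
      _ = D' * (V' * V⁻¹) := by rw [h1, Matrix.one_mul, Matrix.mul_assoc]
  have key' : D.transpose * (U * U'⁻¹) = (D' * (V' * V⁻¹)).transpose := by
    rw [← key, Matrix.transpose_mul, Matrix.transpose_transpose]
  have hL : ∀ i j, b i = b j → D' i j = D i j := fun i j hij => by
    have h1 := hD'.mul_apply hY hij
    have h2 := hD.transpose.mul_apply hZ hij.symm
    rw [key', Matrix.transpose_apply, h1] at h2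
    exact h2
  have hDD : D' = D := by
    ext i j
    by_cases hij : b i = b j
    · exact hL i j hij
    · rw [hD i j hij, hD' i j hij]
  subst hDD
  have hDY : D' * (V' * V⁻¹) = D' := by
    ext i j
    rcases lt_trichotomy (b i) (b j) with hij | hij | hij
    · have h2 := hD.transpose.mul_lower hZ hij
      rw [key', Matrix.transpose_apply] at h2
      rw [h2, hD _ _ hij.ne]
    · exact hD.mul_apply hY hij
    · rw [hD.mul_lower hY hij, hD _ _ hij.ne']
  have hY1 : V' * V⁻¹ = 1 := by
    have := congrArg (D'⁻¹ * ·) hDY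
    simpa only [← Matrix.mul_assoc, Matrix.nonsing_inv_mul _ hdet, Matrix.one_mul] using this
  have hZ1 : U * U'⁻¹ = 1 := by
    rw [hDY] at key
    have := congrArg (· * D'⁻¹) key
    simp only [Matrix.mul_assoc, Matrix.mul_nonsing_inv _ hdet, Matrix.mul_one] at this
    rw [← Matrix.transpose_transpose (U * U'⁻¹), this, Matrix.transpose_one]
  refine ⟨?_, ?_, rfl⟩
  · have := congrArg (· * U') hZ1
    simp only [Matrix.mul_assoc, Matrix.nonsing_inv_mul _ hU'.isUnit_det, Matrix.mul_one,
      Matrix.one_mul] at this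
    exact this.symm
  · have := congrArg (· * V) hY1
    simpa only [Matrix.mul_assoc, Matrix.nonsing_inv_mul _ hV.isUnit_det, Matrix.mul_one,
      Matrix.one_mul] using this

end BlockMatrices

/-! ### The matrix equation -/

section Series

/-- Multiplication by `2` on exponents, the order embedding which underlies `inclT`. -/
def doubling : ℤ ↪o ℤ where
  toFun n := 2 * n
  inj' _ _ hab := mul_left_cancel₀ two_ne_zero hab
  map_rel_iff' := mul_le_mul_iff_right₀ two_pos

theorem inclT_coeff_even (x : LaurentSeries ℚ) (n : ℤ) : (inclT x).coeff (2 * n) = x.coeff n :=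
  HahnSeries.embDomain_coeff (f := doubling)

theorem inclT_coeff_odd (x : LaurentSeries ℚ) {n : ℤ} (hn : n % 2 ≠ 0) : (inclT x).coeff n = 0 :=
  HahnSeries.embDomain_of_notMem_range (f := doubling) (by
    rintro ⟨m, rfl⟩
    exact hn (Int.mul_emod_right 2 m))

theorem inclT_injective : Function.Injective inclT := by
  intro x y hxy
  ext n
  rw [← inclT_coeff_even, hxy, inclT_coeff_even]

/-- The inclusion of power series in Laurent series. -/
abbrev toLaurent : PowerSeries ℚ →+* LaurentSeries ℚ := HahnSeries.ofPowerSeries ℤ ℚ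

theorem halfSeries_eq {c : ℤ → ℕ} (h0 : ∀ i < 0, c i = 0) (h1 : ∀ i, i % 2 ≠ 0 → c i = 0) :
    halfSeries c = inclT (toLaurent (PowerSeries.mk fun n => (c (2 * n) : ℚ))) := by
  have hb : BddBelow (Function.support fun i => (c i : ℚ)) := by
    refine ⟨0, fun i hi => ?_⟩
    by_contra hneg
    exact hi (by simp [h0 i (not_le.1 hneg)])
  ext n
  rw [halfSeries, dif_pos hb]
  change (c n : ℚ) = _
  by_cases hn : n % 2 = 0
  · obtain ⟨m, rfl⟩ : ∃ m, n = 2 * m := ⟨n / 2, by omega⟩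
    rw [inclT_coeff_even]
    have h2 := PowerSeries.coeff_coe (PowerSeries.mk fun n : ℕ => (c (2 * n) : ℚ)) m
    refine Eq.trans ?_ h2.symm
    split_ifs with hm
    · rw [h0 _ (by omega), Nat.cast_zero]
    · rw [PowerSeries.coeff_mk, Int.natAbs_of_nonneg (not_lt.1 hm)]
  · rw [inclT_coeff_odd _ hn, h1 n hn, Nat.cast_zero]

end Series

section Main

variable {W : Type u} [Group W] [Finite W] {h : Type u} [AddCommGroup h] [Module ℂ h]
variable {ρ : Representation ℂ W h}

open GrMod

theorem mult_eq_hilb {M : GrMod (AW.deg ρ)} (hb : M.BoundedBelow 0) (he : M.IsEven) (η : Irr W) :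
    mult M η = inclT (toLaurent (M.hilb η)) := by
  rw [mult, gdimHomW]
  simp only [finrank_homW]
  rw [halfSeries_eq (fun i hi => mdim_eq_zero (hb i hi) η) fun i hi => mdim_eq_zero (he i hi) η]
  rfl

theorem isBlockUni_of_solution [DecidableEq (Irr W)] {P : Phyla W}
    {Kp Km Λ : Matrix (Irr W) (Irr W) (LaurentSeries ℚ)}
    (hS : IsLusztigShojiSolution ρ P Kp Km Λ) :
    IsBlockUni P.index Kp ∧ IsBlockUni P.index (sigma Km) ∧ IsBlockDiag P.index Λ := by
  refine ⟨⟨fun χ η hχη => ?_, fun χ η hχη => ?_⟩, ⟨fun χ η hχη => ?_, fun χ η hχη => ?_⟩,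
    fun χ η hχη => not_imp_comm.1 (hS.block χ η) hχη⟩
  · exact hS.plus_zero χ η hχη.le fun h => (h ▸ hχη).false
  · by_cases h : η = χ
    · subst h; rw [Matrix.one_apply_eq, hS.plus_diag]
    · rw [Matrix.one_apply_ne (Ne.symm h), hS.plus_zero χ η hχη.ge h]
  -- `sigma` replaces `χ`, `η` by their duals, and the condition on `Km` dualizes once more
  · refine hS.minus_zero _ _ ?_ fun h => ?_
    · rw [Irr.dual_dual, Irr.dual_dual]; exact hχη.le
    · rw [Irr.dual_dual, Irr.dual_dual] at h
      exact (h ▸ hχη).false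
  · by_cases h : η = χ
    · subst h
      rw [Matrix.one_apply_eq]
      exact hS.minus_diag _
    · rw [Matrix.one_apply_ne (Ne.symm h)]
      refine hS.minus_zero _ _ ?_ ?_
      · rw [Irr.dual_dual, Irr.dual_dual]; exact hχη.ge
      · rw [Irr.dual_dual, Irr.dual_dual]; exact h

variable [FiniteDimensional ℂ h]

variable (ρ) in
/-- The matrix of the graded multiplicities `[P_χ : L_η]`. -/
def projMatrix : Matrix (Irr W) (Irr W) (PowerSeries ℚ) := fun χ η => (projCover ρ χ).hilb η

theorem isUnit_det_projMatrix [DecidableEq (Irr W)] : IsUnit (projMatrix ρ).det := by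
  rw [PowerSeries.isUnit_iff_constantCoeff, RingHom.map_det]
  have : PowerSeries.constantCoeff.mapMatrix (projMatrix ρ) = 1 := by
    ext χ η
    rw [RingHom.mapMatrix_apply, Matrix.map_apply, projMatrix, hilb,
      ← PowerSeries.coeff_zero_eq_constantCoeff_apply, PowerSeries.coeff_mk, Nat.cast_zero,
      mul_zero, mdim_projCover_zero, Matrix.one_apply]
    by_cases hη : η = χ
    · rw [if_pos hη, if_pos hη.symm, Nat.cast_one]
    · rw [if_neg hη, if_neg (Ne.symm hη), Nat.cast_zero]
  rw [this, Matrix.det_one]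
  exact isUnit_one

theorem isBlockUni_plus [DecidableEq (Irr W)] {P : Phyla W} {K : Irr W → GrMod (AW.deg ρ)}
    (hK : ∀ χ, Nonempty (K χ ≅ trace ρ P χ)) :
    IsBlockUni P.index (Matrix.of fun χ η => (K χ).hilb η) where
  lower χ η hχη := (trace_props (hK χ)).2.2.2.2 η hχη.le fun h => (h ▸ hχη).false
  diag χ η hχη := by
    by_cases h : η = χ
    · subst h
      rw [Matrix.one_apply_eq]
      exact (trace_props (hK η)).2.2.2.1
    · rw [Matrix.one_apply_ne (Ne.symm h)]
      exact (trace_props (hK χ)).2.2.2.2 η hχη.ge h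

/-- If the matrix `Ω` is, up to a unit, the transpose of the matrix of multiplicities of the `P_χ`, the
orthogonality of a Kostka system gives the solution of the matrix equation. -/
theorem exists_lambda [DecidableEq (Irr W)] {P : Phyla W} {Kp Km : Irr W → GrMod (AW.deg ρ)}
    (hK : IsKostkaSystem P Kp Km) {u : PowerSeries ℚ} (hu : IsUnit u) :
    ∃ Λ : Matrix (Irr W) (Irr W) (PowerSeries ℚ), IsBlockDiag P.index Λ ∧ IsUnit Λ.det ∧
      (Matrix.of fun χ η => (Kp χ).hilb η).transpose * Λ *
        (Matrix.of fun χ η => (Km (Irr.dual χ)).hilb (Irr.dual η)) =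
      u • (projMatrix ρ).transpose := by
  set U : Matrix (Irr W) (Irr W) (PowerSeries ℚ) := Matrix.of fun χ η => (Kp χ).hilb η with hU
  set V : Matrix (Irr W) (Irr W) (PowerSeries ℚ) :=
    Matrix.of fun χ η => (Km (Irr.dual χ)).hilb (Irr.dual η) with hV
  have hUu : IsBlockUni P.index U := isBlockUni_plus hK.plus
  have hVu : IsBlockUni P.index V := by
    have h1 := isBlockUni_plus hK.minus
    have hb : ∀ χ, P.conj.index (Irr.dual χ) = P.index χ := fun χ => by
      change P.index (Irr.dual (Irr.dual χ)) = _
      rw [Irr.dual_dual]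
    refine ⟨fun χ η hχη => h1.lower _ _ ?_, fun χ η hχη => (h1.diag (Irr.dual χ) (Irr.dual η)
      ?_).trans ?_⟩
    · rw [hb, hb]; exact hχη
    · rw [hb, hb]; exact hχη
    · simp only [Matrix.one_apply, Irr.dual_injective.eq_iff]
  set Q := (projMatrix ρ).transpose with hQ
  have hQu : IsUnit Q.det := by rw [hQ, Matrix.det_transpose]; exact isUnit_det_projMatrix
  have hUt : IsUnit U.transpose.det := by rw [Matrix.det_transpose]; exact hUu.isUnit_det
  -- the entries are the coefficients of the pairings `⟨K⁺, (K⁻)^*⟩`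
  have hHd : IsBlockDiag P.index (V * Q⁻¹ * U.transpose) := by
    intro η χ hne
    obtain ⟨hl, hb, he, -⟩ := trace_props (hK.minus (Irr.dual η))
    obtain ⟨hl', hb', -⟩ := trace_props (hK.plus χ)
    have hf : ∀ χ, ∑ ψ, (V * Q⁻¹) η ψ * (projCover ρ χ).hilb ψ =
        (Km (Irr.dual η)).dual.hilbNeg χ := fun χ => by
      have h2 : (V * Q⁻¹ * Q) η χ = V η χ := by
        rw [Matrix.mul_assoc, Matrix.nonsing_inv_mul _ hQu, Matrix.mul_one]
      rw [Matrix.mul_apply] at h2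
      rw [hilbNeg_dual hl]
      exact h2
    ext a
    have h3 := gEP_eq hl.dual he.dual hb.dual hf hl' hb' a
    have h4 : gEP (Kp χ) (Km (Irr.dual η)).dual = 0 := by
      by_contra h5
      have h6 := hK.orthogonal χ _ h5
      rw [Irr.dual_dual] at h6
      exact hne h6.symm
    rw [h4] at h3
    rw [Matrix.mul_apply]
    exact h3.symm.trans (by simp)
  have hHu : IsUnit (V * Q⁻¹ * U.transpose).det := by
    rw [Matrix.det_mul, Matrix.det_mul]
    exact (hVu.isUnit_det.mul (Matrix.isUnit_nonsing_inv_det _ hQu)).mul hUt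
  refine ⟨u • (V * Q⁻¹ * U.transpose)⁻¹, fun i j hij => ?_, ?_, ?_⟩
  · rw [Matrix.smul_apply, hHd.inv hHu i j hij, smul_zero]
  · rw [Matrix.det_smul]
    exact (hu.pow _).mul (Matrix.isUnit_nonsing_inv_det _ hHu)
  · rw [Matrix.mul_inv_rev, Matrix.mul_inv_rev, Matrix.nonsing_inv_nonsing_inv _ hQu,
      Matrix.mul_smul, Matrix.smul_mul]
    congr 1
    rw [← Matrix.mul_assoc, Matrix.mul_nonsing_inv _ hUt, Matrix.one_mul, Matrix.mul_assoc,
      Matrix.nonsing_inv_mul _ hVu.isUnit_det, Matrix.mul_one]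

omit [Finite W] [FiniteDimensional ℂ h] in
theorem finrank_homW_eq_zero {M : GrMod (AW.deg ρ)} {i : ℤ} (hM : M.deg i = ⊥) {V : Type*}
    [AddCommGroup V] [Module ℂ V] (τ : Representation ℂ W V) :
    Module.finrank ℂ (M.homW τ i) = 0 := by
  have : Subsingleton (M.homW τ i) := by
    refine subsingleton_of_forall_eq 0 fun f => Subtype.ext (LinearMap.ext fun v => ?_)
    exact (Submodule.mem_bot ℂ).1 (hM ▸ f.2.2 v)
  exact Module.finrank_zero_of_subsingleton

/-- The matrix `Ω` is, up to a unit, the transpose of the matrix of graded multiplicities of the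
modules `P_χ`; the unit is the inverse of the Hilbert series of the ring of invariants. -/
theorem Omega_eq (hρ : IsComplexReflectionGroup ρ) : ∃ u : PowerSeries ℚ, IsUnit u ∧
    ∀ χ η, Omega ρ χ η = inclT (toLaurent (u * (projCover ρ η).hilb χ)) := by
  let R : PowerSeries ℚ := PowerSeries.mk fun n => (Module.finrank ℂ (Sym.inv ρ n) : ℚ)
  have hR : IsUnit R := by
    rw [PowerSeries.isUnit_iff_constantCoeff, ← PowerSeries.coeff_zero_eq_constantCoeff_apply,
      PowerSeries.coeff_mk, Sym.finrank_inv_zero]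
    simp
  obtain ⟨r, hr⟩ := hR
  refine ⟨(r⁻¹ : (PowerSeries ℚ)ˣ), Units.isUnit _, fun χ η => ?_⟩
  let q : projCover ρ (Irr.triv W) ⟶ projCover0 ρ (Irr.triv W) := quotπ _ _ _
  have hq : Function.Surjective (lin q) := Submodule.mkQ_surjective _
  have hb : (projCover0 ρ (Irr.triv W)).BoundedBelow 0 :=
    (projCover_boundedBelow (Irr.triv W)).of_surjective q hq
  have he : (projCover0 ρ (Irr.triv W)).IsEven := (projCover_isEven _).of_surjective q hq
  rw [Omega, gdimHomW, halfSeries_eq (fun i hi => finrank_homW_eq_zero (hb i hi) _)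
    fun i hi => finrank_homW_eq_zero (he i hi) _]
  congr 2
  rw [Units.eq_inv_mul_iff_mul_eq, hr]
  ext n
  rw [PowerSeries.coeff_mul, hilb, PowerSeries.coeff_mk, mdim_projCover hρ]
  simp only [PowerSeries.coeff_mk, Nat.cast_sum, Nat.cast_mul, R]

end Main

end KostkaSystem

end

open KostkaSystem in
theorem theorem2 {W h : Type u} [Group W] [Finite W] [AddCommGroup h] [Module ℂ h]
    [FiniteDimensional ℂ h] (ρ : Representation ℂ W h)
    (hρ : KostkaSystem.IsComplexReflectionGroup ρ) (P : KostkaSystem.Phyla W)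
    (Kp Km : KostkaSystem.Irr W → KostkaSystem.GrMod (KostkaSystem.AW.deg ρ))
    (hK : KostkaSystem.IsKostkaSystem P Kp Km) :
    ∃ Mp Mm Λ : Matrix (KostkaSystem.Irr W) (KostkaSystem.Irr W) (LaurentSeries ℚ),
      (∀ χ η, KostkaSystem.inclT (Mp χ η) = KostkaSystem.mult (Kp χ) η) ∧
      (∀ χ η, KostkaSystem.inclT (Mm χ η) = KostkaSystem.mult (Km χ) η) ∧
      KostkaSystem.IsLusztigShojiSolution ρ P Mp Mm Λ ∧
      ∀ Mp' Mm' Λ', KostkaSystem.IsLusztigShojiSolution ρ P Mp' Mm' Λ' → Mp' = Mp ∧ Mm' = Mm ∧ Λ' = Λ := by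
  classical
  obtain ⟨u, hu, hΩ⟩ := Omega_eq hρ
  obtain ⟨Λ, hΛ, hΛu, hLS⟩ := exists_lambda hK hu
  have hp := fun χ => trace_props (hK.plus χ)
  have hm := fun χ => trace_props (hK.minus χ)
  have hS : IsLusztigShojiSolution ρ P (fun χ η => toLaurent ((Kp χ).hilb η))
      (fun χ η => toLaurent ((Km χ).hilb η)) (Λ.map toLaurent) := by
    refine ⟨fun χ => ?_, fun χ η hη hne => ?_, fun χ => ?_, fun χ η hη hne => ?_,
      fun χ η hne => ?_, ?_⟩
    · rw [(hp χ).2.2.2.1, map_one]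
    · rw [(hp χ).2.2.2.2 η hη hne, map_zero]
    · rw [(hm χ).2.2.2.1, map_one]
    · rw [(hm χ).2.2.2.2 η hη fun h => hne (h ▸ rfl), map_zero]
    · by_contra hb
      exact hne (by rw [Matrix.map_apply, hΛ χ η hb, map_zero])
    · have h1 := congrArg (fun M => M.map toLaurent) hLS
      simp only [Matrix.map_mul] at h1
      ext χ η : 1
      rw [Matrix.map_apply, hΩ]
      congr 1
      exact congrFun (congrFun h1 χ) η
  refine ⟨_, _, _, fun χ η => ?_, fun χ η => ?_, hS, fun Mp' Mm' Λ' hS' => ?_⟩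
  · rw [mult_eq_hilb (hp χ).2.1 (hp χ).2.2.1]
  · rw [mult_eq_hilb (hm χ).2.1 (hm χ).2.2.1]
  · obtain ⟨hU, hV, hD⟩ := isBlockUni_of_solution hS
    obtain ⟨hU', hV', hD'⟩ := isBlockUni_of_solution hS'
    have hdet : IsUnit (Λ.map toLaurent).det := by
      have := hΛu.map toLaurent
      rwa [RingHom.map_det] at this
    have heq : Mp'.transpose * Λ' * sigma Mm' = _ :=
      Matrix.map_injective inclT_injective (hS'.equation.trans hS.equation.symm)
    obtain ⟨h1, h2, h3⟩ := blockDecomposition_unique hU hV hD hU' hV' hD' hdet heq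
    refine ⟨h1, ?_, h3⟩
    funext χ η
    have h4 := congrFun (congrFun h2 (Irr.dual χ)) (Irr.dual η)
    change Mm' (Irr.dual (Irr.dual χ)) (Irr.dual (Irr.dual η)) =
      toLaurent ((Km (Irr.dual (Irr.dual χ))).hilb (Irr.dual (Irr.dual η))) at h4
    rwa [Irr.dual_dual, Irr.dual_dual] at h4
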